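/- Let $n\ge 2$, $\theta\in\mathbb R$, and let $\omega_1,\dots,\omega_n$ lie in the open half plane $H(\theta)=\{re^{i(\theta+\phi)} : r>0,\ -\pi/2<\phi<\pi/2\}$, with $\operatorname{Im}(\omega_j/\omega_k)\ne 0$ for all $j\neq k$. For $a\in H(\theta)$ let $\zeta_n(s,a;\omega)$ denote the meromorphic continuation to $\mathbb C$ of the Barnes zeta-function $\sum_{m_1,\dots,m_n\ge 0}(a+\omega_1m_1+\cdots+\omega_nm_n)^{-s}$ ($\operatorname{Re}s>n$; the arguments are taken in $(\theta-\pi/2,\theta+\pi/2)$), and put $a(0)=\omega_1+\cdots+\omega_n$. Let $I_k^{+}$ (resp. $I_k^{-}$) be the set of $j\ne k$ with $\operatorname{Im}(\omega_j/\omega_k)>0$ (resp. $<0$), and let $\delta(J)=0$ if $J\ne\emptyset$, $\delta(\emptyset)=(-1)^{n+1}$. Let $B_m(y)$ be the Bernoulli polynomials, $\frac{te^{ty}}{e^t-1}=\sum_{m\ge 0} B_m(y)\frac{t^m}{m!}$. (a) The series defining $\zeta_n(s,a(0);\omega)$ converges absolutely for $\operatorname{Re}s>n$ and has a meromorphic continuation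 to $\mathbb C$. For every integer $l\neq n$ the two series over $m$ below converge absolutely for each $k$; moreover, if $l>n$, then $\zeta_n(s,a(0);\omega)$ is holomorphic at $s=n-l$, and one has $$ \begin{aligned} &\sum_{k=1}^n \omega_k^{-1}\Biggl(\sum_{m>0}(2m\pi i\omega_k^{-1})^{n-l-1}\biggl(\prod_{j\ne k}\frac{1}{e^{2m\pi i\omega_j/\omega_k}-1}-\delta(I_k^-)\biggr) +\sum_{m>0}(-2m\pi i\omega_k^{-1})^{n-l-1}\biggl(\prod_{j\ne k}\frac{1}{e^{-2m\pi i\omega_j/\omega_k}-1}-\delta(I_k^+)\biggr)\\ &\qquad+\delta(I_k^-)(2\pi i\omega_k^{-1})^{n-l-1}\zeta(1-n+l)+\delta(I_k^+)(-2\pi i\omega_k^{-1})^{n-l-1}\zeta(1-n+l)\Biggr)\\ &=\begin{cases}\dfrac{(-1)^{l-n+1}}{(l-n)!}\,\zeta_n(n-l,a(0);\omega)&(l>n)\\[2mm] -(n-l-1)!\,\operatorname{Res}_{s=n-l}\zeta_n(s,a(0);\omega)&(l<n)\end{cases}\\ &=-\sum_{\substack{m_1,\dots,m_n\ge 0\\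 m_1+\cdots+m_n=l}}\ \prod_{j=1}^n\frac{B_{m_j}(0)}{m_j!}\,\omega_j^{m_j-1}, \end{aligned} $$ where $\zeta$ is the Riemann zeta-function and the empty sum is $0$. (b) (Ramanujan's formula, which is deduced from the case $n=2$.) For every integer $N\neq 0$ and all real $\alpha,\beta>0$ with $\alpha\beta=\pi^2$, $$ \begin{aligned} \alpha^{-N}\Bigl\{\tfrac12\zeta(2N+1)+\sum_{k=1}^\infty\frac{1}{(e^{2k\alpha}-1)k^{2N+1}}\Bigr\} ={}&(-\beta)^{-N}\Bigl\{\tfrac12\zeta(2N+1)+\sum_{k=1}^\infty\frac{1}{(e^{2k\beta}-1)k^{2N+1}}\Bigr\}\\ &-2^{2N}\sum_{k=0}^{N+1}(-1)^k\frac{B_{2k}(0)}{(2k)!}\frac{B_{2N+2-2k}(0)}{(2N+2-2k)!}\,\alpha^{N+1-k}\beta^k, \end{aligned} $$ where both infinite series converge absolutely and the empty sum is $0$. -/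

import Mathlib

open scoped Nat

noncomputable section

/-- The open half plane `H(θ)` with normal vector `e^{iθ}`, i.e. the set of all `r e^{i(θ + u)}` with
`r > 0` and `-π/2 < u < π/2`. -/
def halfPlaneH (θ : ℝ) : Set ℂ :=
  {z | ∃ r u : ℝ, 0 < r ∧ -(Real.pi / 2) < u ∧ u < Real.pi / 2 ∧
    z = r * Complex.exp (Complex.I * (θ + u))}

/-- The logarithm on `H(θ)` whose imaginary part lies in `(θ - π/2, θ + π/2)`. -/
def logH (θ : ℝ) (x : ℂ) : ℂ :=
  Complex.log (x * Complex.exp (-(Complex.I * θ))) + Complex.I * θ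

/-- The general term `(a + ω₁ m₁ + ⋯ + ωₙ mₙ)^{-s}` of the Barnes multiple Dirichlet series, for
`a, ω₁, …, ωₙ ∈ H(θ)`; the power is taken with the argument in `(θ - π/2, θ + π/2)`. -/
def barnesTerm {n : ℕ} (θ : ℝ) (a : ℂ) (ω : Fin n → ℂ) (s : ℂ) (m : Fin n → ℕ) : ℂ :=
  Complex.exp (-s * logH θ (a + ∑ j, ω j * (m j : ℂ)))

/-- `Z` is the meromorphic continuation to `ℂ` of the Barnes multiple Dirichlet series: it is
meromorphic on `ℂ` (in normal form, so that removable singularities are removed and the value at a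
pole is `0`), and it is the sum of the (absolutely convergent) series for `Re s > n`. -/
structure IsBarnesZeta {n : ℕ} (θ : ℝ) (a : ℂ) (ω : Fin n → ℂ) (Z : ℂ → ℂ) : Prop where
  meromorphic : MeromorphicNFOn Z Set.univ
  hasSum : ∀ s : ℂ, (n : ℝ) < s.re → HasSum (barnesTerm θ a ω s) (Z s)

/-- The meromorphic continuation is unique. -/
theorem IsBarnesZeta.unique {n : ℕ} {θ : ℝ} {a : ℂ} {ω : Fin n → ℂ} {Z W : ℂ → ℂ}
    (hZ : IsBarnesZeta θ a ω Z) (hW : IsBarnesZeta θ a ω W) : Z = W := by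
  have hZm := hZ.meromorphic.meromorphicOn
  have hWm := hW.meromorphic.meromorphicOn
  have hd : MeromorphicOn (Z - W) Set.univ := hZm.sub hWm
  have key : ∀ s : ℂ, meromorphicOrderAt (Z - W) s = ⊤ := by
    intro s
    by_contra hs
    have h2 := hd.meromorphicOrderAt_ne_top_of_isPreconnected (x := s) (y := ((n + 1 : ℝ) : ℂ))
      isPreconnected_univ (Set.mem_univ _) (Set.mem_univ _) hs
    apply h2
    rw [meromorphicOrderAt_eq_top_iff]
    apply eventually_nhdsWithin_of_eventually_nhds
    have hop : IsOpen {z : ℂ | (n : ℝ) < z.re} := isOpen_lt continuous_const Complex.continuous_re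
    filter_upwards [hop.mem_nhds (show (n : ℝ) < (((n + 1 : ℝ) : ℂ)).re by simp)] with z hz
    have := (hZ.hasSum z hz).unique (hW.hasSum z hz)
    simp [this]
  funext s
  have h1 := (meromorphicOrderAt_eq_top_iff.mp (key s))
  have h2 : Z =ᶠ[nhdsWithin s {s}ᶜ] W := by
    filter_upwards [h1] with z hz
    exact sub_eq_zero.mp hz
  exact (((hZ.meromorphic (Set.mem_univ s)).eventuallyEq_nhdsNE_iff_eventuallyEq_nhds
    (hW.meromorphic (Set.mem_univ s))).mp h2).eq_of_nhds

open Classical in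
/-- The Barnes zeta-function `ζₙ(s, a; ω₁, …, ωₙ)` on the whole of `ℂ`: the (unique) meromorphic
continuation of the Barnes multiple Dirichlet series. -/
def barnesZeta {n : ℕ} (θ : ℝ) (a : ℂ) (ω : Fin n → ℂ) : ℂ → ℂ :=
  if h : ∃ Z : ℂ → ℂ, IsBarnesZeta θ a ω Z then h.choose else 0

/-- `a(y) = ω₁ (1 - y) + ⋯ + ωₙ (1 - y)`. -/
def barnesA {n : ℕ} (ω : Fin n → ℂ) (y : ℝ) : ℂ := ∑ j, ω j * (1 - (y : ℂ))

/-- The residue `Res_{s = c} f(s)` at an isolated singularity: `(2πi)⁻¹` times the integral over all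
small enough circles around `c`. -/
def residueAt (f : ℂ → ℂ) (c : ℂ) : ℂ :=
  Filter.limUnder (nhdsWithin (0 : ℝ) (Set.Ioi 0))
    (fun r : ℝ => (2 * (Real.pi : ℂ) * Complex.I)⁻¹ * ∮ z in C(c, r), f z)

/-- `I_k⁺`, the set of all `j ≠ k` with `Im (ω_j / ω_k) > 0`. -/
def indexPos {n : ℕ} (ω : Fin n → ℂ) (k : Fin n) : Finset (Fin n) :=
  Finset.univ.filter (fun j => j ≠ k ∧ 0 < (ω j / ω k).im)

/-- `I_k⁻`, the set of all `j ≠ k` with `Im (ω_j / ω_k) < 0`. -/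
def indexNeg {n : ℕ} (ω : Fin n → ℂ) (k : Fin n) : Finset (Fin n) :=
  Finset.univ.filter (fun j => j ≠ k ∧ (ω j / ω k).im < 0)

/-- `δ(J) = 0` for `J ≠ ∅` and `δ(∅) = (-1)^{n+1}`. -/
def deltaJ {n : ℕ} (J : Finset (Fin n)) : ℂ := if J = ∅ then (-1) ^ (n + 1) else 0

/-- The term `(2mπi ω_k⁻¹)^{n-l-1} (∏_{j ≠ k} 1 / (e^{2mπi ω_j/ω_k} - 1) - δ(I_k⁻))`. -/
def termPos {n : ℕ} (ω : Fin n → ℂ) (l : ℤ) (k : Fin n) (m : ℕ+) : ℂ :=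
  (2 * (m : ℂ) * Real.pi * Complex.I * (ω k)⁻¹) ^ ((n : ℤ) - l - 1) *
    ((∏ j ∈ Finset.univ.erase k,
        1 / (Complex.exp (2 * (m : ℂ) * Real.pi * Complex.I * ω j / ω k) - 1)) -
      deltaJ (indexNeg ω k))

/-- The term `(-2mπi ω_k⁻¹)^{n-l-1} (∏_{j ≠ k} 1 / (e^{-2mπi ω_j/ω_k} - 1) - δ(I_k⁺))`. -/
def termNeg {n : ℕ} (ω : Fin n → ℂ) (l : ℤ) (k : Fin n) (m : ℕ+) : ℂ :=
  (-2 * (m : ℂ) * Real.pi * Complex.I * (ω k)⁻¹) ^ ((n : ℤ) - l - 1) *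
    ((∏ j ∈ Finset.univ.erase k,
        1 / (Complex.exp (-2 * (m : ℂ) * Real.pi * Complex.I * ω j / ω k) - 1)) -
      deltaJ (indexPos ω k))

/-- The regularized double series, with its correction terms in the Riemann zeta-function. -/
def regularizedSeries {n : ℕ} (ω : Fin n → ℂ) (l : ℤ) : ℂ :=
  ∑ k, (ω k)⁻¹ *
    ((∑' m : ℕ+, termPos ω l k m) + (∑' m : ℕ+, termNeg ω l k m)
      + deltaJ (indexNeg ω k) * (2 * Real.pi * Complex.I * (ω k)⁻¹) ^ ((n : ℤ) - l - 1)
          * riemannZeta (1 - n + l)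
      + deltaJ (indexPos ω k) * (-2 * Real.pi * Complex.I * (ω k)⁻¹) ^ ((n : ℤ) - l - 1)
          * riemannZeta (1 - n + l))

/-- The (finite) set of all `(m₁, …, mₙ)` with `m₁, …, mₙ ≥ 0` and `m₁ + ⋯ + mₙ = l`. -/
def tuplesWithSum (n : ℕ) (l : ℤ) : Finset (Fin n → ℕ) :=
  (Fintype.piFinset fun _ : Fin n => Finset.range (l.toNat + 1)).filter
    (fun m => ∑ j, (m j : ℤ) = l)

theorem mem_tuplesWithSum {n : ℕ} {l : ℤ} {m : Fin n → ℕ} :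
    m ∈ tuplesWithSum n l ↔ ∑ j, (m j : ℤ) = l := by
  simp only [tuplesWithSum, Finset.mem_filter, Fintype.mem_piFinset, Finset.mem_range,
    and_iff_right_iff_imp]
  intro h j
  have := Finset.single_le_sum (f := fun j => (m j : ℤ)) (fun i _ => by positivity)
    (Finset.mem_univ j)
  omega

/-- The value `B_m(y)` of the Bernoulli polynomial, where `t e^{ty} / (e^t - 1) = ∑ B_m(y) t^m / m!`. -/
def bernoulliB (m : ℕ) (y : ℂ) : ℂ := Polynomial.aeval y (Polynomial.bernoulli m)

/-- `-∑_{m₁ + ⋯ + mₙ = l} ∏_j (B_{m_j}(0) / m_j!) ω_j^{m_j - 1}`. -/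
def bernoulliSum {n : ℕ} (ω : Fin n → ℂ) (l : ℤ) : ℂ :=
  -∑ m ∈ tuplesWithSum n l,
    ∏ j, bernoulliB (m j) 0 / ((m j)! : ℂ) * ω j ^ ((m j : ℤ) - 1)

/-- The term `1 / ((e^{2kα} - 1) k^{2N+1})`. -/
def ramanujanTerm (α : ℝ) (N : ℤ) (k : ℕ+) : ℂ :=
  1 / ((Complex.exp (2 * (k : ℂ) * α) - 1) * (k : ℂ) ^ (2 * N + 1))

end

/-! Two independent computations meet in the coefficient `laurentCoeff ω 0 l` of z^{l-n} in ∏_j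
1/(e^{ω_j z} - 1).

Residue side. For 0 < y < 1 integrate z^{n-l-1} ∏_j e^{yω_j z}/(e^{ω_j z} - 1) over circles growing
to infinity. The residue at 0 is `laurentCoeff ω y l`; all other poles 2πim/ω_k are simple, because
no ratio ω_j/ω_k with j ≠ k is real. On radii that avoid the moduli of the poles each factor decays
exponentially in |Re(ω_j z)|, and since n ≥ 2 these real parts cannot all be small, so the integrals
tend to 0 (`exists_radii_tendsto_zero`). Hence the residues along the 2n rays sum to -`laurentCoeff
ω y l` (`sum_tsum_barnesResidue`).

At y = 0 the decay is lost, so y → 0+ is taken ray by ray (`ray_sum`). Along a ray the product of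
the factors 1/(e^{m x_j} - 1) tends exponentially fast to a constant, which is δ(I_k^∓). After
subtraction of this constant the series converges dominatedly in y. What was subtracted is a
multiple of ∑ m^p e^{myw} with p = n-l-1, equal to D y^{-1-p} + ζ(-p) + o(1), where D = 0 if p < 0
(`exists_tendsto_expSum`); p = -1, that is l = n, is the excluded logarithmic case. The total is a
polynomial in y and thus has a limit, so the singular coefficients D must cancel when summed over
all rays (`regularizedSeries_eq_bernoulliSum`).

Zeta side. Rotation by e^{-iθ} places all ω_j in Re > 0. As a(0) shifts every m_j to m_j + 1,
Γ(s)ζ_n(s) is, up to the factor e^{-isθ}, the Mellin transform of ∏_j 1/(e^{ν_j t} - 1)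
(`hasSum_Gamma_mul_exp`). Removing K terms of the expansion at t = 0 continues it to Re s > n - K,
with at most a simple pole at n - l, whose residue is the l-th Laurent coefficient
(`exists_mellinCont_eq`). Division by Γ gives the residues of ζ_n for l < n, and for l > n a zero of
1/Γ cancels the pole and leaves a value (`residueAt_barnesZeta`, `barnesZeta_neg`).

Ramanujan's formula is the residue side for n = 2, ω = (1, iα/π), l = 2N + 2, multiplied by a
constant. -/

noncomputable section

/-! ### Taylor coefficients and the Bernoulli generating function -/

/-- The Taylor series at `0` of a complex function. -/
def taylorPS (f : ℂ → ℂ) : PowerSeries ℂ :=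
  PowerSeries.mk fun n => iteratedDeriv n f 0 / (n ! : ℂ)

theorem coeff_taylorPS (f : ℂ → ℂ) (n : ℕ) :
    PowerSeries.coeff n (taylorPS f) = iteratedDeriv n f 0 / (n ! : ℂ) := by
  simp [taylorPS]

theorem taylorPS_mul {f g : ℂ → ℂ} (hf : AnalyticAt ℂ f 0) (hg : AnalyticAt ℂ g 0) :
    taylorPS (f * g) = taylorPS f * taylorPS g := by
  ext n
  rw [coeff_taylorPS, PowerSeries.coeff_mul, iteratedDeriv_mul hf.contDiffAt hg.contDiffAt,
    Finset.Nat.sum_antidiagonal_eq_sum_range_succ_mk, Finset.sum_div]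
  refine Finset.sum_congr rfl fun i hi => ?_
  have hi' : i ≤ n := Nat.lt_succ_iff.mp (Finset.mem_range.mp hi)
  rw [coeff_taylorPS, coeff_taylorPS, Nat.cast_choose ℂ hi']
  have h1 : (i ! : ℂ) ≠ 0 := by exact_mod_cast i.factorial_ne_zero
  have h2 : ((n - i)! : ℂ) ≠ 0 := by exact_mod_cast (n - i).factorial_ne_zero
  have h3 : (n ! : ℂ) ≠ 0 := by exact_mod_cast n.factorial_ne_zero
  field_simp

theorem taylorPS_congr {f g : ℂ → ℂ} (h : f =ᶠ[nhds 0] g) : taylorPS f = taylorPS g := by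
  ext n
  rw [coeff_taylorPS, coeff_taylorPS, h.iteratedDeriv_eq]

theorem taylorPS_const (c : ℂ) : taylorPS (fun _ => c) = PowerSeries.C c := by
  ext n
  rw [coeff_taylorPS, iteratedDeriv_const, PowerSeries.coeff_C]
  split_ifs with h
  · simp [h]
  · simp

theorem taylorPS_prod {ι : Type*} (s : Finset ι) {f : ι → ℂ → ℂ}
    (hf : ∀ i ∈ s, AnalyticAt ℂ (f i) 0) :
    taylorPS (∏ i ∈ s, f i) = ∏ i ∈ s, taylorPS (f i) := by
  classical
  induction s using Finset.induction_on with
  | empty => exact (taylorPS_const 1).trans (by simp)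
  | insert a s ha ih =>
    rw [Finset.prod_insert ha, Finset.prod_insert ha, taylorPS_mul (hf a (by simp)),
      ih fun i hi => hf i (by simp [hi])]
    exact Finset.analyticAt_prod s fun i hi => hf i (by simp [hi])

theorem taylorPS_id : taylorPS (fun z => z) = PowerSeries.X := by
  ext n
  rw [coeff_taylorPS, iteratedDeriv_fun_id_zero, PowerSeries.coeff_X]
  split_ifs with h
  · simp [h]
  · simp

theorem taylorPS_exp_mul (c : ℂ) :
    taylorPS (fun z => Complex.exp (c * z)) = PowerSeries.rescale c (PowerSeries.exp ℂ) := by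
  ext n
  rw [coeff_taylorPS, iteratedDeriv_cexp_const_mul, PowerSeries.coeff_rescale,
    PowerSeries.coeff_exp]
  simp [div_eq_mul_inv]

theorem taylorPS_add {f g : ℂ → ℂ} (hf : AnalyticAt ℂ f 0) (hg : AnalyticAt ℂ g 0) :
    taylorPS (f + g) = taylorPS f + taylorPS g := by
  ext n
  simp only [coeff_taylorPS, map_add]
  rw [iteratedDeriv_add hf.contDiffAt hg.contDiffAt, add_div]

theorem AnalyticAt.dslope_same {f : ℂ → ℂ} {a : ℂ} (hf : AnalyticAt ℂ f a) :
    AnalyticAt ℂ (dslope f a) a := by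
  obtain ⟨p, hp⟩ := hf
  exact hp.has_fpower_series_dslope_fslope.analyticAt

theorem eq_add_mul_dslope (f : ℂ → ℂ) (z : ℂ) : f z = f 0 + z * dslope f 0 z := by
  have := sub_smul_dslope f 0 z
  simp only [sub_zero, smul_eq_mul] at this
  rw [this]; ring

theorem taylorPS_eq_add_X_mul {f : ℂ → ℂ} (hf : AnalyticAt ℂ f 0) :
    taylorPS f = PowerSeries.C (f 0) + PowerSeries.X * taylorPS (dslope f 0) := by
  have hid : AnalyticAt ℂ (fun z : ℂ => z) 0 := analyticAt_id
  have h : f = (fun _ => f 0) + (fun z => z) * dslope f 0 := by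
    funext z; exact eq_add_mul_dslope f z
  conv_lhs => rw [h]
  rw [taylorPS_add analyticAt_const (hid.mul hf.dslope_same), taylorPS_const,
    taylorPS_mul hid hf.dslope_same, taylorPS_id]

/-- Taylor's formula with an analytic remainder. -/
theorem exists_taylor_remainder {f : ℂ → ℂ} (hf : AnalyticAt ℂ f 0) (N : ℕ) :
    ∃ g : ℂ → ℂ, AnalyticAt ℂ g 0 ∧ ∀ z, f z =
      ∑ i ∈ Finset.range N, PowerSeries.coeff i (taylorPS f) * z ^ i + z ^ N * g z := by
  induction N generalizing f with
  | zero => exact ⟨f, hf, by simp⟩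
  | succ N ih =>
    -- The difference quotient at 0 is again analytic and its Taylor coefficients are those of `f`
    -- shifted by one.
    obtain ⟨g, hg, h⟩ := ih hf.dslope_same
    refine ⟨g, hg, fun z => ?_⟩
    rw [eq_add_mul_dslope f z, h z, Finset.sum_range_succ', taylorPS_eq_add_X_mul hf, mul_add,
      Finset.mul_sum]
    simp only [map_add, PowerSeries.coeff_succ_X_mul, PowerSeries.coeff_C, PowerSeries.coeff_zero_X_mul]
    simp only [Nat.add_eq_zero_iff, one_ne_zero, and_false, if_false, zero_add, if_true, add_zero,
      pow_zero, mul_one]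
    rw [add_comm (f 0), add_right_comm, add_assoc, add_assoc]
    congr 1
    · exact Finset.sum_congr rfl fun i _ => by ring
    · ring

/-- The entire function `(e^{ωz} - 1) / z`. -/
def expSlope (ω : ℂ) : ℂ → ℂ := dslope (fun z => Complex.exp (ω * z) - 1) 0

theorem mul_expSlope (ω z : ℂ) : z * expSlope ω z = Complex.exp (ω * z) - 1 := by
  have := eq_add_mul_dslope (fun z => Complex.exp (ω * z) - 1) z
  simp only [mul_zero, Complex.exp_zero, sub_self, zero_add] at this
  exact this.symm

theorem expSlope_zero (ω : ℂ) : expSlope ω 0 = ω := by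
  rw [expSlope, dslope_same]
  have : HasDerivAt (fun z : ℂ => Complex.exp (ω * z) - 1) (Complex.exp (ω * 0) * (ω * 1)) 0 :=
    (((hasDerivAt_id (0 : ℂ)).const_mul ω).cexp).sub_const 1
  simpa using this.deriv

theorem analyticAt_expSlope (ω : ℂ) : AnalyticAt ℂ (expSlope ω) 0 :=
  AnalyticAt.dslope_same (by fun_prop)

/-- The function `z e^{yωz} / (e^{ωz} - 1)`. -/
def bernoulliGen (y ω z : ℂ) : ℂ := Complex.exp (y * ω * z) / expSlope ω z

theorem analyticAt_bernoulliGen (y : ℂ) {ω : ℂ} (hω : ω ≠ 0) :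
    AnalyticAt ℂ (bernoulliGen y ω) 0 :=
  AnalyticAt.div (by fun_prop) (analyticAt_expSlope ω) (by rwa [expSlope_zero])

theorem bernoulliGen_of_ne (y ω : ℂ) {z : ℂ} (hz : z ≠ 0) :
    bernoulliGen y ω z = z * (Complex.exp (y * ω * z) / (Complex.exp (ω * z) - 1)) := by
  rw [bernoulliGen, ← mul_expSlope ω z]
  field_simp

/-- Both ω times the Taylor series and the generating function of the Bernoulli polynomials rescaled
by ω, when multiplied by e^{ωX} - 1, give ωX e^{yωX}. The common factor can be cancelled; the extra
ω is what lowers the exponent to m - 1. -/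
theorem coeff_taylorPS_bernoulliGen (y : ℂ) {ω : ℂ} (hω : ω ≠ 0) (m : ℕ) :
    PowerSeries.coeff m (taylorPS (bernoulliGen y ω)) =
      bernoulliB m y / (m ! : ℂ) * ω ^ ((m : ℤ) - 1) := by
  have hE : taylorPS (fun z => Complex.exp (ω * z) - 1) =
      PowerSeries.rescale ω (PowerSeries.exp ℂ) - 1 := by
    have : (fun z => Complex.exp (ω * z) - 1) =
        (fun z => Complex.exp (ω * z)) + fun _ => (-1 : ℂ) := by
      funext z; simp [sub_eq_add_neg]
    rw [this, taylorPS_add (by fun_prop) analyticAt_const, taylorPS_exp_mul, taylorPS_const]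
    simp [sub_eq_add_neg]
  have h1 : taylorPS (bernoulliGen y ω) * (PowerSeries.rescale ω (PowerSeries.exp ℂ) - 1) =
      PowerSeries.X * PowerSeries.rescale (y * ω) (PowerSeries.exp ℂ) := by
    rw [← hE, ← taylorPS_exp_mul, ← taylorPS_id,
      ← taylorPS_mul (analyticAt_bernoulliGen y hω) (by fun_prop),
      ← taylorPS_mul (f := fun z : ℂ => z) analyticAt_id (g := fun z => Complex.exp (y * ω * z)) (by fun_prop)]
    refine taylorPS_congr ?_
    have hne : ∀ᶠ z in nhds (0 : ℂ), expSlope ω z ≠ 0 :=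
      (analyticAt_expSlope ω).continuousAt.eventually_ne (by rwa [expSlope_zero])
    filter_upwards [hne] with z hz
    simp only [Pi.mul_apply, bernoulliGen]
    rw [← mul_expSlope ω z]
    field_simp
  have h2 := congrArg (PowerSeries.rescale ω) (Polynomial.bernoulli_generating_function (A := ℂ) y)
  rw [map_mul, map_mul, map_sub, map_one, PowerSeries.rescale_rescale, PowerSeries.rescale_X] at h2
  -- Its coefficient at X is ω.
  have hne : PowerSeries.rescale ω (PowerSeries.exp ℂ) - 1 ≠ 0 := by
    intro h
    have := congrArg (PowerSeries.coeff 1) h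
    simp [PowerSeries.coeff_rescale, PowerSeries.coeff_exp, PowerSeries.coeff_one] at this
    exact hω this
  have h3 : PowerSeries.C ω * taylorPS (bernoulliGen y ω) = PowerSeries.rescale ω
      (PowerSeries.mk fun n => Polynomial.aeval y ((1 / (n ! : ℚ)) • Polynomial.bernoulli n)) := by
    apply mul_right_cancel₀ hne
    rw [h2, mul_assoc, h1]
    ring
  have h4 := congrArg (PowerSeries.coeff m) h3
  rw [PowerSeries.coeff_C_mul, PowerSeries.coeff_rescale, PowerSeries.coeff_mk] at h4
  have h5 : PowerSeries.coeff m (taylorPS (bernoulliGen y ω)) =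
    ω⁻¹ * (ω * PowerSeries.coeff m (taylorPS (bernoulliGen y ω))) := by field_simp
  rw [h5, h4, zpow_sub₀ hω, bernoulliB, map_smul, Algebra.smul_def]
  simp
  ring

/-- `∑_{m₁ + ⋯ + mₙ = l} ∏_j (B_{m_j}(y) / m_j!) ω_j^{m_j - 1}`, the coefficient of `z^{l - n}` in the
Laurent expansion of `∏_j e^{yω_jz} / (e^{ω_jz} - 1)`. -/
def laurentCoeff {n : ℕ} (ω : Fin n → ℂ) (y : ℂ) (l : ℤ) : ℂ :=
  ∑ m ∈ tuplesWithSum n l, ∏ j, bernoulliB (m j) y / ((m j)! : ℂ) * ω j ^ ((m j : ℤ) - 1)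

theorem bernoulliSum_eq {n : ℕ} (ω : Fin n → ℂ) (l : ℤ) :
    bernoulliSum ω l = -laurentCoeff ω 0 l := rfl

theorem laurentCoeff_of_neg {n : ℕ} (ω : Fin n → ℂ) (y : ℂ) {l : ℤ} (hl : l < 0) :
    laurentCoeff ω y l = 0 := by
  refine Finset.sum_eq_zero fun m hm => ?_
  rw [mem_tuplesWithSum] at hm
  have : 0 ≤ ∑ j, (m j : ℤ) := Finset.sum_nonneg fun i _ => by positivity
  omega

theorem coeff_taylorPS_prod_bernoulliGen {n : ℕ} {ω : Fin n → ℂ} (hω : ∀ j, ω j ≠ 0) (y : ℂ)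
    (l : ℕ) :
    PowerSeries.coeff l (taylorPS (∏ j, bernoulliGen y (ω j))) = laurentCoeff ω y l := by
  rw [taylorPS_prod _ fun j _ => analyticAt_bernoulliGen y (hω j), PowerSeries.coeff_prod,
    laurentCoeff]
  refine Finset.sum_nbij' (fun m j => m j) (fun m => Finsupp.equivFunOnFinite.symm m) ?_ ?_ ?_ ?_ ?_
  · intro m hm
    rw [Finset.mem_finsuppAntidiag] at hm
    rw [mem_tuplesWithSum]
    exact_mod_cast hm.1
  · intro m hm
    rw [mem_tuplesWithSum] at hm
    rw [Finset.mem_finsuppAntidiag]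
    refine ⟨?_, by simp⟩
    have : ∑ j, m j = l := by exact_mod_cast hm
    simpa using this
  · intro m _; ext j; simp
  · intro m _; funext j; simp
  · intro m _
    exact Finset.prod_congr rfl fun j _ => coeff_taylorPS_bernoulliGen y (hω j) _

/-- This is the finiteness that later forces the singular terms in y to cancel. -/
theorem continuous_laurentCoeff {n : ℕ} (ω : Fin n → ℂ) (l : ℤ) :
    Continuous fun y => laurentCoeff ω y l := by
  unfold laurentCoeff bernoulliB
  fun_prop

/-! ### Residue theorem for the kernel -/

theorem circleIntegral_eq_zero_of_analyticAt {f : ℂ → ℂ} {R : ℝ} (hR : 0 < R)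
    (hf : ∀ z ∈ Metric.closedBall (0 : ℂ) R, AnalyticAt ℂ f z) : ∮ z in C(0, R), f z = 0 :=
  Complex.circleIntegral_eq_zero_of_differentiable_on_off_countable hR.le Set.countable_empty
    (fun z hz => (hf z hz).continuousAt.continuousWithinAt)
    fun z hz => (hf z (Metric.ball_subset_closedBall hz.1)).differentiableAt

/-- The residue theorem on a disc, for a function with prescribed principal parts `P i` at finitely
many points `q i`. -/
theorem circleIntegral_eq_sum_of_principalPart {ι : Type*} (S : Finset ι) (q r : ι → ℂ)
    (P : ι → ℂ → ℂ) {R : ℝ} (hR : 0 < R) {f : ℂ → ℂ} (hinj : Set.InjOn q S)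
    (hq : ∀ i ∈ S, ‖q i‖ < R) (hP : ∀ i ∈ S, ∀ z, z ≠ q i → AnalyticAt ℂ (P i) z)
    (hPint : ∀ i ∈ S, ∮ z in C(0, R), P i z = 2 * Real.pi * Complex.I * r i)
    (hf : ∀ z ∈ Metric.closedBall (0 : ℂ) R, (∀ i ∈ S, z ≠ q i) → AnalyticAt ℂ f z)
    (hfP : ∀ i ∈ S, ∃ g, AnalyticAt ℂ g (q i) ∧
      ∀ᶠ z in nhdsWithin (q i) {q i}ᶜ, f z = P i z + g z) :
    ∮ z in C(0, R), f z = 2 * Real.pi * Complex.I * ∑ i ∈ S, r i := by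
  classical
  induction S using Finset.induction_on generalizing f with
  | empty => simpa using circleIntegral_eq_zero_of_analyticAt hR fun z hz => hf z hz (by simp)
  | insert a S ha ih =>
    obtain ⟨g, hg, hgf⟩ := hfP a (by simp)
    -- Subtracting one principal part and filling the hole with the value of the analytic part makes
    -- the function analytic at `q a`, so that the induction hypothesis for the remaining points
    -- applies.
    set f' : ℂ → ℂ := Function.update (fun z => f z - P a z) (q a) (g (q a)) with hf'
    have hne : ∀ i ∈ S, q i ≠ q a := fun i hi h =>
      ha ((hinj (by simp [hi]) (by simp) h) ▸ hi)
    have hf'z : ∀ z, z ≠ q a → f' =ᶠ[nhds z] fun z => f z - P a z := fun z hz => by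
      filter_upwards [isOpen_ne.mem_nhds hz] with w hw
      exact Function.update_of_ne hw _ _
    have hf'a : f' =ᶠ[nhds (q a)] g := by
      rw [eventually_nhdsWithin_iff] at hgf
      filter_upwards [hgf] with w hw
      by_cases h : w = q a
      · subst h; simp [hf']
      · rw [hf', Function.update_of_ne h, hw h]; ring
    have key := ih (f := f') (hinj.mono (by simp)) (fun i hi => hq i (by simp [hi]))
      (fun i hi => hP i (by simp [hi])) (fun i hi => hPint i (by simp [hi])) ?_ ?_
    · have h1 : ∮ z in C(0, R), f' z = ∮ z in C(0, R), (f z - P a z) := by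
        refine circleIntegral.integral_congr hR.le fun z hz => ?_
        refine Function.update_of_ne ?_ _ _
        rintro rfl
        have := hq a (by simp)
        simp at hz
        linarith
      have hsph : ∀ z ∈ Metric.sphere (0 : ℂ) R, ∀ i ∈ insert a S, z ≠ q i := by
        rintro z hz i hi rfl
        have := hq i hi
        simp at hz
        linarith
      rw [circleIntegral.integral_sub, hPint a (by simp)] at h1
      · rw [Finset.sum_insert ha]
        linear_combination key - h1
      · refine ContinuousOn.circleIntegrable hR.le fun z hz => ?_
        exact (hf z (Metric.sphere_subset_closedBall hz)
          (hsph z hz)).continuousAt.continuousWithinAt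
      · refine ContinuousOn.circleIntegrable hR.le fun z hz => ?_
        exact (hP a (by simp) z (hsph z hz a (by simp))).continuousAt.continuousWithinAt
    · intro z hz hzS
      by_cases h : z = q a
      · rw [h]; exact hg.congr hf'a.symm
      · refine AnalyticAt.congr ?_ (hf'z z h).symm
        refine (hf z hz ?_).sub (hP a (by simp) z h)
        simpa [h] using hzS
    · intro i hi
      obtain ⟨g', hg', h⟩ := hfP i (by simp [hi])
      refine ⟨fun z => g' z - P a z, hg'.sub (hP a (by simp) _ (hne i hi)), ?_⟩
      filter_upwards [h, (hf'z _ (hne i hi)).filter_mono nhdsWithin_le_nhds] with z h1 h2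
      rw [h2, h1]; ring

/-- The principal part at a simple zero of `e^{ωz} - 1`. -/
theorem exists_eq_div_sub_add {h : ℂ → ℂ} {ω q : ℂ} (hω : ω ≠ 0) (hq : Complex.exp (ω * q) = 1)
    (hh : AnalyticAt ℂ h q) : ∃ g, AnalyticAt ℂ g q ∧ ∀ᶠ z in nhdsWithin q {q}ᶜ,
      h z / (Complex.exp (ω * z) - 1) = (h q / ω) * (z - q)⁻¹ + g z := by
  set E := dslope (fun z => Complex.exp (ω * z) - 1) q with hE
  have hEa : AnalyticAt ℂ E q := AnalyticAt.dslope_same (by fun_prop)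
  have hEq : E q = ω := by
    rw [hE, dslope_same]
    have : HasDerivAt (fun z : ℂ => Complex.exp (ω * z) - 1) (Complex.exp (ω * q) * (ω * 1)) q :=
      (((hasDerivAt_id q).const_mul ω).cexp).sub_const 1
    simpa [hq] using this.deriv
  have hEz : ∀ z, (z - q) * E z = Complex.exp (ω * z) - 1 := fun z => by
    have := sub_smul_dslope (fun z => Complex.exp (ω * z) - 1) q z
    simpa [hq] using this
  have hH : AnalyticAt ℂ (fun z => h z / E z) q := hh.div hEa (by rwa [hEq])
  -- With `E z` = (e^{ωz} - 1)/(z - q), the quotient equals H(z)/(z - q) for H = h/E, so the regular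
  -- part is the difference quotient of H at q.
  refine ⟨_, hH.dslope_same, ?_⟩
  have hne := hEa.continuousAt.eventually_ne (show E q ≠ 0 by rwa [hEq])
  filter_upwards [hne.filter_mono nhdsWithin_le_nhds, self_mem_nhdsWithin] with z hz hzq
  have hzq' : z - q ≠ 0 := sub_ne_zero.mpr hzq
  have h1 := sub_smul_dslope (fun z => h z / E z) q z
  simp only [smul_eq_mul, hEq] at h1
  rw [← hEz]
  rw [show dslope (fun z => h z / E z) q z = (h z / E z - h q / ω) / (z - q) by
    rw [← h1]; field_simp]
  field_simp
  ring

/-- The function `z^{n-l-1} ∏_j e^{yω_jz} / (e^{ω_jz} - 1)`. -/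
def barnesKernel {n : ℕ} (ω : Fin n → ℂ) (y : ℂ) (l : ℤ) (z : ℂ) : ℂ :=
  z ^ ((n : ℤ) - l - 1) * ∏ j, (Complex.exp (y * ω j * z) / (Complex.exp (ω j * z) - 1))

/-- The residue of `barnesKernel ω y l` at `2πim/ω_k`. -/
def barnesResidue {n : ℕ} (ω : Fin n → ℂ) (y : ℂ) (l : ℤ) (k : Fin n) (m : ℤ) : ℂ :=
  (ω k)⁻¹ * ((m * (2 * Real.pi * Complex.I / ω k)) ^ ((n : ℤ) - l - 1) *
    Complex.exp (y * ω k * (m * (2 * Real.pi * Complex.I / ω k))) * ∏ j ∈ Finset.univ.erase k,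
      (Complex.exp (y * ω j * (m * (2 * Real.pi * Complex.I / ω k))) /
        (Complex.exp (ω j * (m * (2 * Real.pi * Complex.I / ω k))) - 1)))

theorem analyticAt_barnesKernel {n : ℕ} (ω : Fin n → ℂ) (y : ℂ) (l : ℤ) {z : ℂ} (hz : z ≠ 0)
    (h : ∀ j, Complex.exp (ω j * z) ≠ 1) : AnalyticAt ℂ (barnesKernel ω y l) z := by
  unfold barnesKernel
  refine AnalyticAt.mul (analyticAt_id.zpow hz) ?_
  refine Finset.analyticAt_fun_prod _ fun j _ => ?_
  exact AnalyticAt.div (by fun_prop) (by fun_prop) (sub_ne_zero.mpr (h j))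

/-- Away from 0 the kernel is z^{-l-1} times the product of the functions `bernoulliGen`, so
expanding that product to order l + 1 captures every negative power. -/
theorem exists_barnesKernel_eq_at_zero {n : ℕ} {ω : Fin n → ℂ} (hω : ∀ j, ω j ≠ 0) (y : ℂ)
    (l : ℤ) : ∃ g, AnalyticAt ℂ g 0 ∧ ∀ᶠ z in nhdsWithin (0 : ℂ) {0}ᶜ, barnesKernel ω y l z =
      (∑ i ∈ Finset.range (l + 1).toNat, laurentCoeff ω y i * z ^ ((i : ℤ) - l - 1)) + g z := by
  obtain ⟨g, hg, h⟩ := exists_taylor_remainder (f := ∏ j, bernoulliGen y (ω j))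
    (Finset.analyticAt_prod _ fun j _ => analyticAt_bernoulliGen y (hω j)) (l + 1).toNat
  have hker : ∀ z : ℂ, z ≠ 0 →
      barnesKernel ω y l z = z ^ (-l - 1) * (∏ j, bernoulliGen y (ω j)) z := by
    intro z hz
    rw [barnesKernel, Finset.prod_apply, Finset.prod_congr rfl fun j _ => bernoulliGen_of_ne y (ω j) hz,
      Finset.prod_mul_distrib, ← mul_assoc]
    congr 1
    simp only [Finset.prod_const, Finset.card_univ, Fintype.card_fin]
    rw [← zpow_natCast, ← zpow_add₀ hz]
    congr 1; ring
  -- The integer exponent is 0 for l ≥ -1 and -l-1 > 0 otherwise, so the outer `toNat` loses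
  -- nothing.
  refine ⟨fun z => z ^ (((l + 1).toNat : ℤ) - l - 1).toNat * g z,
    AnalyticAt.mul (by fun_prop) hg, ?_⟩
  filter_upwards [self_mem_nhdsWithin] with z hz
  have hz : z ≠ 0 := hz
  rw [hker z hz, h z, mul_add, Finset.mul_sum]
  congr 1
  · refine Finset.sum_congr rfl fun i _ => ?_
    rw [coeff_taylorPS_prod_bernoulliGen hω, mul_left_comm, ← zpow_natCast, ← zpow_add₀ hz]
    congr 2; ring
  · rw [← mul_assoc, ← zpow_natCast, ← zpow_natCast, ← zpow_add₀ hz]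
    congr 2
    omega

/-- If another factor were singular at 2πim/ω_k, then ω_j/ω_k would be the real number m'/m. So only
the k-th factor is singular and the pole comes from a simple zero of e^{ω_k z} - 1. -/
theorem exists_barnesKernel_eq_at_pole {n : ℕ} {ω : Fin n → ℂ} (hω : ∀ j, ω j ≠ 0)
    (him : ∀ j k, j ≠ k → (ω j / ω k).im ≠ 0) (y : ℂ) (l : ℤ) (k : Fin n) {m : ℤ} (hm : m ≠ 0) :
    ∃ g, AnalyticAt ℂ g (m * (2 * Real.pi * Complex.I / ω k)) ∧
      ∀ᶠ z in nhdsWithin (m * (2 * Real.pi * Complex.I / ω k)) {m * (2 * Real.pi * Complex.I / ω k)}ᶜ,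
        barnesKernel ω y l z =
          barnesResidue ω y l k m * (z - m * (2 * Real.pi * Complex.I / ω k))⁻¹ + g z := by
  set q : ℂ := m * (2 * Real.pi * Complex.I / ω k) with hq
  have hm' : (m : ℂ) ≠ 0 := by exact_mod_cast hm
  have hpi := Complex.two_pi_I_ne_zero
  have hq0 : q ≠ 0 := mul_ne_zero hm' (div_ne_zero hpi (hω k))
  have hqk : Complex.exp (ω k * q) = 1 := by
    rw [Complex.exp_eq_one_iff]
    refine ⟨m, ?_⟩
    rw [hq]; field_simp [hω k]
  have hqj : ∀ j, j ≠ k → Complex.exp (ω j * q) ≠ 1 := by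
    intro j hj h
    rw [Complex.exp_eq_one_iff] at h
    obtain ⟨m', h⟩ := h
    refine him j k hj ?_
    have : ω j / ω k = ((m' / m : ℝ) : ℂ) := by
      push_cast
      have hk := hω k
      rw [hq] at h
      field_simp at h ⊢
      linear_combination h
    rw [this, Complex.ofReal_im]
  obtain ⟨g, hg, h⟩ := exists_eq_div_sub_add (h := fun z => z ^ ((n : ℤ) - l - 1) *
    Complex.exp (y * ω k * z) * ∏ j ∈ Finset.univ.erase k,
      (Complex.exp (y * ω j * z) / (Complex.exp (ω j * z) - 1))) (hω k) hqk (by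
    refine ((analyticAt_id.zpow hq0).mul (by fun_prop)).mul
      (Finset.analyticAt_fun_prod _ fun j hj => ?_)
    exact AnalyticAt.div (by fun_prop) (by fun_prop)
      (sub_ne_zero.mpr (hqj j (Finset.ne_of_mem_erase hj))))
  refine ⟨g, hg, ?_⟩
  filter_upwards [h] with z hz
  rw [barnesKernel, barnesResidue, ← hq, ← Finset.mul_prod_erase _ _ (Finset.mem_univ k),
    inv_mul_eq_div, ← hz]
  ring

/-- Only the power z^{-1} has a nonzero integral; it sits at index i = l and is absent for negative
l. -/
theorem circleIntegral_laurent (l : ℤ) (a : ℕ → ℂ) {R : ℝ} (hR : 0 < R) :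
    ∮ z in C(0, R), (∑ i ∈ Finset.range (l + 1).toNat, a i * z ^ ((i : ℤ) - l - 1)) =
      2 * Real.pi * Complex.I * if 0 ≤ l then a l.toNat else 0 := by
  have hint : ∀ i ∈ Finset.range (l + 1).toNat,
      CircleIntegrable (fun z => a i * z ^ ((i : ℤ) - l - 1)) 0 R := by
    intro i _
    refine ContinuousOn.circleIntegrable hR.le fun z hz => ?_
    have hz0 : z ≠ 0 := by rintro rfl; simp at hz; linarith
    exact (continuousAt_const.mul (continuousAt_zpow₀ z _ (Or.inl hz0))).continuousWithinAt
  rw [circleIntegral.integral_fun_sum hint]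
  have hterm : ∀ i : ℕ, ∮ z in C(0, R), a i * z ^ ((i : ℤ) - l - 1) =
      if (i : ℤ) = l then 2 * Real.pi * Complex.I * a i else 0 := by
    intro i
    have h1 := circleIntegral.integral_const_mul (a i) (fun z : ℂ => z ^ ((i : ℤ) - l - 1)) 0 R
    rw [h1]
    split_ifs with h
    · have h2 := circleIntegral.integral_sub_center_inv (0 : ℂ) hR.ne'
      simp only [sub_zero] at h2
      rw [show (i : ℤ) - l - 1 = -1 by omega]
      simp only [zpow_neg_one, h2]
      ring
    · have h2 := circleIntegral.integral_sub_zpow_of_ne (n := (i : ℤ) - l - 1)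
        (by omega) (0 : ℂ) 0 R
      simp only [sub_zero] at h2
      rw [h2, mul_zero]
  simp_rw [hterm]
  split_ifs with hl
  · rw [Finset.sum_eq_single l.toNat]
    · rw [if_pos (by omega)]
    · intro i _ hi; rw [if_neg (by omega)]
    · intro hi; simp at hi; omega
  · rw [mul_zero]
    refine Finset.sum_eq_zero fun i hi => ?_
    simp at hi; omega

/-- The hypothesis `hgood` says that no pole lies on the circle, since |2πm/ω_j| = R means R|ω_j|/2π
= |m|; the floors then count the poles inside along each direction. -/
theorem circleIntegral_barnesKernel {n : ℕ} {ω : Fin n → ℂ} (hω : ∀ j, ω j ≠ 0)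
    (him : ∀ j k, j ≠ k → (ω j / ω k).im ≠ 0) (y : ℂ) (l : ℤ) {R : ℝ} (hR : 0 < R)
    (hgood : ∀ j, ∀ m : ℤ, R * ‖ω j‖ / (2 * Real.pi) ≠ m) :
    ∮ z in C(0, R), barnesKernel ω y l z = 2 * Real.pi * Complex.I * (laurentCoeff ω y l +
      ∑ k, ∑ m ∈ (Finset.Icc (-(⌊R * ‖ω k‖ / (2 * Real.pi)⌋₊ : ℤ))
        ⌊R * ‖ω k‖ / (2 * Real.pi)⌋₊).erase 0, barnesResidue ω y l k m) := by
  have hpi := Complex.two_pi_I_ne_zero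
  have hpi' : 0 < 2 * Real.pi := by positivity
  have hnorm : ∀ (k : Fin n) (m : ℤ),
      ‖(m : ℂ) * (2 * Real.pi * Complex.I / ω k)‖ = |(m : ℝ)| * (2 * Real.pi) / ‖ω k‖ := by
    intro k m
    rw [norm_mul, norm_div, norm_mul, norm_mul, Complex.norm_I, Complex.norm_real,
      Real.norm_of_nonneg Real.pi_pos.le, Complex.norm_intCast]
    simp; ring
  have hωp : ∀ k, 0 < ‖ω k‖ := fun k => norm_pos_iff.mpr (hω k)
  have hmem : ∀ (k : Fin n) (m : ℤ), m ∈ Finset.Icc (-(⌊R * ‖ω k‖ / (2 * Real.pi)⌋₊ : ℤ))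
      ⌊R * ‖ω k‖ / (2 * Real.pi)⌋₊ ↔ |(m : ℝ)| * (2 * Real.pi) / ‖ω k‖ ≤ R := by
    intro k m
    have : 0 ≤ R * ‖ω k‖ / (2 * Real.pi) := by positivity
    rw [Finset.mem_Icc, ← abs_le, div_le_iff₀ (hωp k), ← le_div_iff₀ hpi', ← Int.cast_abs,
      Int.abs_eq_natAbs, Int.cast_natCast, ← Nat.le_floor_iff this]
    norm_cast
  set T : Finset (Σ _ : Fin n, ℤ) := Finset.univ.sigma fun k =>
    (Finset.Icc (-(⌊R * ‖ω k‖ / (2 * Real.pi)⌋₊ : ℤ)) ⌊R * ‖ω k‖ / (2 * Real.pi)⌋₊).erase 0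
    with hT
  have hTmem : ∀ x ∈ T, x.2 ≠ 0 ∧ |(x.2 : ℝ)| * (2 * Real.pi) / ‖ω x.1‖ ≤ R := by
    intro x hx
    rw [hT, Finset.mem_sigma, Finset.mem_erase, hmem] at hx
    exact hx.2
  -- `none` stands for the pole at the origin and `some ⟨k, m⟩` for the pole 2πim/ω_k.
  let q : Option (Σ _ : Fin n, ℤ) → ℂ := fun o =>
    o.elim 0 fun x => x.2 * (2 * Real.pi * Complex.I / ω x.1)
  let r : Option (Σ _ : Fin n, ℤ) → ℂ := fun o =>
    o.elim (if 0 ≤ l then laurentCoeff ω y l.toNat else 0) fun x => barnesResidue ω y l x.1 x.2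
  let P : Option (Σ _ : Fin n, ℤ) → ℂ → ℂ := fun o z =>
    o.elim (∑ i ∈ Finset.range (l + 1).toNat, laurentCoeff ω y i * z ^ ((i : ℤ) - l - 1))
      fun x => barnesResidue ω y l x.1 x.2 * (z - x.2 * (2 * Real.pi * Complex.I / ω x.1))⁻¹
  have hq0 : ∀ x ∈ T, q (some x) ≠ 0 := fun x hx =>
    mul_ne_zero (by exact_mod_cast (hTmem x hx).1) (div_ne_zero hpi (hω _))
  have hqR : ∀ x ∈ T, ‖q (some x)‖ < R := by
    intro x hx
    change ‖(x.2 : ℂ) * (2 * Real.pi * Complex.I / ω x.1)‖ < R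
    rw [hnorm]
    refine lt_of_le_of_ne (hTmem x hx).2 fun h => ?_
    apply hgood x.1 |x.2|
    rw [← h]
    have := (hωp x.1).ne'
    push_cast
    field_simp
  have key := circleIntegral_eq_sum_of_principalPart (Finset.insertNone T) q r P hR
    (f := barnesKernel ω y l) ?_ ?_ ?_ ?_ ?_ ?_
  · rw [key, Finset.sum_insertNone, hT, Finset.sum_sigma]
    congr 2
    change (if 0 ≤ l then laurentCoeff ω y l.toNat else 0) = _
    split_ifs with h
    · rw [Int.toNat_of_nonneg h]
    · rw [laurentCoeff_of_neg ω y (by omega)]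
  -- Poles with different k are distinct, since a coincidence would make ω_{k'}/ω_k real.
  · rintro (_ | x) hx (_ | x') hx' h
    · rfl
    · exact absurd h.symm (hq0 x' (by simpa using hx'))
    · exact absurd h (hq0 x (by simpa using hx))
    · have hx := hTmem x (by simpa using hx)
      have hx' := hTmem x' (by simpa using hx')
      obtain ⟨k, m⟩ := x
      obtain ⟨k', m'⟩ := x'
      change (m : ℂ) * (2 * Real.pi * Complex.I / ω k) =
        m' * (2 * Real.pi * Complex.I / ω k') at h
      have hm : (m : ℂ) ≠ 0 := by exact_mod_cast hx.1
      have h1 : ω k' / ω k = ((m' / m : ℝ) : ℂ) := by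
        push_cast
        have hk := hω k
        have hk' := hω k'
        have hpi2 : (Real.pi : ℂ) ≠ 0 := by exact_mod_cast Real.pi_ne_zero
        field_simp at h ⊢
        linear_combination h
      have hkk : k' = k := by
        by_contra hne
        exact him k' k hne (by rw [h1, Complex.ofReal_im])
      subst hkk
      have := mul_right_cancel₀ (div_ne_zero hpi (hω k')) h
      have : m = m' := by exact_mod_cast this
      rw [this]
  · rintro (_ | x) hx
    · simpa [q] using hR
    · exact hqR x (by simpa using hx)
  · rintro (_ | x) hx z hz
    · change AnalyticAt ℂ (fun z => ∑ i ∈ Finset.range (l + 1).toNat,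
        laurentCoeff ω y i * z ^ ((i : ℤ) - l - 1)) z
      exact Finset.analyticAt_fun_sum _ fun i _ => analyticAt_const.mul (analyticAt_id.zpow hz)
    · exact analyticAt_const.mul ((analyticAt_id.sub analyticAt_const).inv (sub_ne_zero.mpr hz))
  · rintro (_ | x) hx
    · exact circleIntegral_laurent l _ hR
    · have hx := hqR x (by simpa using hx)
      change ∮ z in C(0, R), barnesResidue ω y l x.1 x.2 * (z - q (some x))⁻¹ = _
      have h1 := circleIntegral.integral_const_mul (barnesResidue ω y l x.1 x.2)
        (fun z : ℂ => (z - q (some x))⁻¹) 0 R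
      rw [h1, circleIntegral.integral_sub_inv_of_mem_ball (by simpa using hx), mul_comm]
      rfl
  · intro z hz hzq
    refine analyticAt_barnesKernel ω y l (hzq none (by simp)) fun j hj => ?_
    rw [Complex.exp_eq_one_iff] at hj
    obtain ⟨m, hm⟩ := hj
    have hz' : z = m * (2 * Real.pi * Complex.I / ω j) := by
      have := hω j
      field_simp
      linear_combination hm
    have hm0 : m ≠ 0 := by
      rintro rfl
      exact hzq none (by simp) (hz'.trans (by simp [q]))
    refine hzq (some ⟨j, m⟩) ?_ hz'
    rw [Finset.some_mem_insertNone, hT, Finset.mem_sigma, Finset.mem_erase, hmem, ← hnorm, ← hz']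
    exact ⟨by simp, hm0, by simpa using hz⟩
  · rintro (_ | x) hx
    · exact exists_barnesKernel_eq_at_zero hω y l
    · exact exists_barnesKernel_eq_at_pole hω him y l x.1 (hTmem x (by simpa using hx)).1

/-! ### Decay of the kernel on large circles -/

/-- Pigeonhole: try the n + 1 radii R₀ + ih. If all fail, two fail for the same j. Their values of R
a_j differ by between hμ and 1/4, where μ ≤ a_j ≤ M and (n+1)hM = 1/4, yet this difference is within
2ε = hμ/2 of an integer. That integer must be 0, which contradicts the lower bound. -/
theorem exists_radius_far_from_int {n : ℕ} {a : Fin n → ℝ} (ha : ∀ j, 0 < a j) :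
    ∃ ε > 0, ∀ R₀ : ℝ, ∃ R ≥ R₀, ∀ j, ∀ m : ℤ, ε ≤ |R * a j - m| := by
  set M : ℝ := 1 + ∑ j, a j with hM
  set μ : ℝ := (1 + ∑ j, (a j)⁻¹)⁻¹ with hμ
  have hsum : ∀ (f : Fin n → ℝ), (∀ j, 0 < f j) → ∀ j, f j ≤ ∑ i, f i := fun f hf j =>
    Finset.single_le_sum (fun i _ => (hf i).le) (Finset.mem_univ j)
  have hMa : ∀ j, a j ≤ M := fun j => by linarith [hsum a ha j]
  have hM0 : 0 < M := by
    have : 0 ≤ ∑ j, a j := Finset.sum_nonneg fun i _ => (ha i).le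
    linarith
  have hμ0 : 0 < μ := by
    have : 0 ≤ ∑ j, (a j)⁻¹ := Finset.sum_nonneg fun i _ => (inv_pos.mpr (ha i)).le
    positivity
  have hμa : ∀ j, μ ≤ a j := fun j => by
    have := hsum (fun j => (a j)⁻¹) (fun j => inv_pos.mpr (ha j)) j
    rw [hμ]
    exact inv_le_of_inv_le₀ (ha j) (by linarith)
  set h : ℝ := 1 / (4 * (n + 1) * M) with hh
  have h0 : 0 < h := by positivity
  have hnh : (n + 1) * (h * M) = 1 / 4 := by rw [hh]; field_simp
  refine ⟨h * μ / 4, by positivity, fun R₀ => ?_⟩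
  by_contra! hbad
  have hR : ∀ i : Fin (n + 1), R₀ ≤ R₀ + i * h := fun i => by
    have : 0 ≤ (i : ℝ) * h := by positivity
    linarith
  choose j m hjm using fun i : Fin (n + 1) => hbad (R₀ + i * h) (hR i)
  obtain ⟨i, i', hne, hij⟩ := Fintype.exists_ne_map_eq_of_card_lt j (by simp)
  wlog hlt : i < i' generalizing i i'
  · exact this i' i hne.symm hij.symm (lt_of_le_of_ne (not_lt.mp hlt) hne.symm)
  have e1 := abs_lt.mp (hjm i)
  have e2 := abs_lt.mp (hjm i')
  rw [← hij] at e2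
  have hd : (i : ℝ) + 1 ≤ i' := by exact_mod_cast hlt
  have hd' : (i' : ℝ) ≤ n := by exact_mod_cast Nat.lt_succ_iff.mp i'.2
  have hi0 : (0 : ℝ) ≤ i := by positivity
  have hha : h * μ ≤ h * a (j i) := mul_le_mul_of_nonneg_left (hμa _) h0.le
  have hha' : h * a (j i) ≤ h * M := mul_le_mul_of_nonneg_left (hMa _) h0.le
  have hhM : 0 < h * M := by positivity
  have hhμ : 0 < h * μ := by positivity
  have hμ4 : h * M ≤ 1 / 4 := by nlinarith
  have low : h * a (j i) ≤ ((i' : ℝ) - i) * (h * a (j i)) := by nlinarith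
  have upp : ((i' : ℝ) - i) * (h * a (j i)) ≤ 1 / 4 := by
    calc ((i' : ℝ) - i) * (h * a (j i)) ≤ (n + 1) * (h * M) := by
          apply mul_le_mul _ hha' (by linarith) (by positivity); linarith
      _ = 1 / 4 := hnh
  have hm : m i = m i' := by
    have l1 : ((m i : ℝ) - m i') < 1 := by nlinarith
    have l2 : ((m i' : ℝ) - m i) < 1 := by nlinarith
    have l1 : m i - m i' < 1 := by exact_mod_cast l1
    have l2 : m i' - m i < 1 := by exact_mod_cast l2
    omega
  rw [← hm] at e2
  nlinarith

/-- Close to the imaginary axis the first summand can vanish, and the second reduces a lower bound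
to keeping cos(Im z) away from 1. -/
theorem norm_sq_exp_sub_one (z : ℂ) :
    ‖Complex.exp z - 1‖ ^ 2 =
      (Real.exp z.re - 1) ^ 2 + 2 * Real.exp z.re * (1 - Real.cos z.im) := by
  rw [Complex.sq_norm, Complex.normSq_apply]
  simp only [Complex.sub_re, Complex.exp_re, Complex.one_re, Complex.sub_im, Complex.exp_im,
    Complex.one_im]
  have := Real.sin_sq_add_cos_sq z.im
  linear_combination Real.exp z.re ^ 2 * this

theorem cos_le_of_far_from_int {η w : ℝ} (hη : 0 ≤ η)
    (hw : ∀ m : ℤ, η ≤ |w - m * (2 * Real.pi)|) :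
    Real.cos w ≤ 1 - 2 / Real.pi ^ 2 * η ^ 2 := by
  have hpi := Real.pi_pos
  set m := round (w / (2 * Real.pi))
  have h1 : |w - m * (2 * Real.pi)| ≤ Real.pi := by
    have := abs_sub_round (w / (2 * Real.pi))
    have h2 : w - m * (2 * Real.pi) = (w / (2 * Real.pi) - m) * (2 * Real.pi) := by field_simp
    rw [h2, abs_mul, abs_of_pos (by positivity : 0 < 2 * Real.pi)]
    nlinarith
  rw [← Real.cos_sub_int_mul_two_pi w m]
  refine (Real.cos_le_one_sub_mul_cos_sq h1).trans ?_
  have : η ^ 2 ≤ (w - m * (2 * Real.pi)) ^ 2 := by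
    rw [← sq_abs (w - m * (2 * Real.pi))]
    exact pow_le_pow_left₀ hη (hw m) 2
  have h3 : 0 ≤ 2 / Real.pi ^ 2 := by positivity
  nlinarith

/-- The quotient has size e^{(y-1)Re z} far to the right and e^{y Re z} far to the left, so the rate
min(y, 1-y) serves both sides. In the strip |Re z| < η it suffices to bound the denominator from
below. -/
theorem exists_norm_exp_div_le {ε y : ℝ} (hε : 0 < ε) (hy0 : 0 < y) (hy1 : y < 1) :
    ∃ C > 0, ∃ c > 0, ∀ z : ℂ, (∀ m : ℤ, ε ≤ |‖z‖ / (2 * Real.pi) - m|) →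
      ‖Complex.exp (y * z) / (Complex.exp z - 1)‖ ≤ C * Real.exp (-c * |z.re|) := by
  have hpi := Real.pi_pos
  set c := min y (1 - y) with hc
  have hc0 : 0 < c := lt_min hy0 (by linarith)
  have hcy : c ≤ y := min_le_left _ _
  have hcy' : c ≤ 1 - y := min_le_right _ _
  set η := Real.pi * ε with hη
  have hη0 : 0 < η := by positivity
  set κ := Real.sqrt (2 * Real.exp (-η) * (2 / Real.pi ^ 2 * η ^ 2)) with hκ
  have hκ0 : 0 < κ := by positivity
  have hD : 0 < 1 - Real.exp (-η) := by
    have : Real.exp (-η) < 1 := by rw [Real.exp_lt_one_iff]; linarith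
    linarith
  refine ⟨max (1 / (1 - Real.exp (-η))) (Real.exp η / κ * Real.exp (c * η)), by positivity, c, hc0,
    fun z hz => ?_⟩
  have hnum : ‖Complex.exp (y * z)‖ = Real.exp (y * z.re) := by
    rw [Complex.norm_exp, Complex.re_ofReal_mul]
  rw [norm_div, hnum]
  by_cases hx : η ≤ |z.re|
  · refine le_trans ?_ (mul_le_mul_of_nonneg_right (le_max_left _ _) (Real.exp_pos _).le)
    have hlow : |Real.exp z.re - 1| ≤ ‖Complex.exp z - 1‖ := by
      have := abs_norm_sub_norm_le (Complex.exp z) 1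
      rwa [Complex.norm_exp, norm_one] at this
    have hexpη : Real.exp (-|z.re|) ≤ Real.exp (-η) := Real.exp_le_exp.mpr (by linarith)
    rcases le_total 0 z.re with h | h
    · rw [abs_of_nonneg h] at hx hexpη ⊢
      have h1 : Real.exp z.re * (1 - Real.exp (-η)) ≤ ‖Complex.exp z - 1‖ := by
        refine le_trans ?_ ((le_abs_self _).trans hlow)
        have : Real.exp z.re * Real.exp (-z.re) = 1 := by rw [← Real.exp_add]; simp
        nlinarith [Real.exp_pos z.re]
      rw [div_le_iff₀ (lt_of_lt_of_le (by positivity) h1)]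
      calc Real.exp (y * z.re) ≤ Real.exp (-c * z.re) * Real.exp z.re := by
            rw [← Real.exp_add]; apply Real.exp_le_exp.mpr; nlinarith
        _ = 1 / (1 - Real.exp (-η)) * Real.exp (-c * z.re) *
            (Real.exp z.re * (1 - Real.exp (-η))) := by field_simp
        _ ≤ _ := by gcongr
    · rw [abs_of_nonpos h] at hx hexpη ⊢
      rw [neg_neg] at hexpη
      have h1 : 1 - Real.exp (-η) ≤ ‖Complex.exp z - 1‖ := by
        refine le_trans ?_ ((neg_le_abs _).trans hlow)
        linarith
      rw [div_le_iff₀ (lt_of_lt_of_le hD h1)]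
      calc Real.exp (y * z.re) ≤ Real.exp (-c * -z.re) := by
            apply Real.exp_le_exp.mpr; nlinarith
        _ = 1 / (1 - Real.exp (-η)) * Real.exp (-c * -z.re) * (1 - Real.exp (-η)) := by
            field_simp
        _ ≤ _ := by gcongr
  · push Not at hx
    refine le_trans ?_ (mul_le_mul_of_nonneg_right (le_max_right _ _) (Real.exp_pos _).le)
    -- The hypothesis keeps |z| at distance 2πε = 2η from 2πℤ, and |z| differs from |Im z| by at
    -- most |Re z| < η; this is the reason for η = πε.
    have hfar : ∀ m : ℤ, η ≤ |(|z.im|) - m * (2 * Real.pi)| := by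
      intro m
      have h1 : 2 * η ≤ |‖z‖ - m * (2 * Real.pi)| := by
        have h2 : ‖z‖ - m * (2 * Real.pi) = (‖z‖ / (2 * Real.pi) - m) * (2 * Real.pi) := by
          field_simp
        rw [h2, abs_mul, abs_of_pos (by positivity : 0 < 2 * Real.pi), hη]
        nlinarith [hz m]
      have h3 : |(‖z‖ - |z.im|)| ≤ |z.re| := by
        rw [abs_of_nonneg (sub_nonneg.mpr (Complex.abs_im_le_norm z))]
        linarith [Complex.norm_le_abs_re_add_abs_im z]
      have h4 := abs_sub_abs_le_abs_sub (‖z‖ - m * (2 * Real.pi)) (‖z‖ - |z.im|)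
      rw [show ‖z‖ - m * (2 * Real.pi) - (‖z‖ - |z.im|) = |z.im| - m * (2 * Real.pi) by ring] at h4
      linarith
    have hcos := cos_le_of_far_from_int hη0.le hfar
    rw [Real.cos_abs] at hcos
    have hκz : κ ≤ ‖Complex.exp z - 1‖ := by
      rw [hκ]
      apply Real.sqrt_le_iff.mpr ⟨norm_nonneg _, ?_⟩
      rw [norm_sq_exp_sub_one]
      have h1 : Real.exp (-η) ≤ Real.exp z.re :=
        Real.exp_le_exp.mpr (by linarith [neg_abs_le z.re])
      have h2 : Real.exp (-η) * (2 / Real.pi ^ 2 * η ^ 2) ≤ Real.exp z.re * (1 - Real.cos z.im) :=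
        mul_le_mul h1 (by linarith) (by positivity) (Real.exp_pos _).le
      nlinarith [sq_nonneg (Real.exp z.re - 1)]
    rw [div_le_iff₀ (lt_of_lt_of_le hκ0 hκz)]
    have h5 : Real.exp (y * z.re) ≤ Real.exp η := by
      apply Real.exp_le_exp.mpr
      nlinarith [le_abs_self z.re, abs_nonneg z.re]
    have h6 : 1 ≤ Real.exp (c * η) * Real.exp (-c * |z.re|) := by
      rw [← Real.exp_add]; apply Real.one_le_exp; nlinarith
    calc Real.exp (y * z.re) ≤ Real.exp η * 1 := by rwa [mul_one]
      _ ≤ Real.exp η * (Real.exp (c * η) * Real.exp (-c * |z.re|)) := by gcongr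
      _ = Real.exp η / κ * Real.exp (c * η) * Real.exp (-c * |z.re|) * κ := by field_simp
      _ ≤ _ := by gcongr

/-- Two of the ω_j are linearly independent over ℝ, so Re(ω_0 t) and Re(ω_1 t) determine t. With a
single ω there would be no decay along the line of its poles. -/
theorem exists_mul_norm_le_sum_abs_re {n : ℕ} (hn : 2 ≤ n) {ω : Fin n → ℂ} (hω : ∀ j, ω j ≠ 0)
    (him : ∀ j k, j ≠ k → (ω j / ω k).im ≠ 0) :
    ∃ κ > 0, ∀ t : ℂ, κ * ‖t‖ ≤ ∑ j, |(ω j * t).re| := by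
  let j₀ : Fin n := ⟨0, by omega⟩
  let j₁ : Fin n := ⟨1, by omega⟩
  have hne : j₁ ≠ j₀ := by simp [j₀, j₁]
  set ρ := ω j₁ / ω j₀ with hρ
  have hρi : 0 < |ρ.im| := abs_pos.mpr (him _ _ hne)
  have h0 : 0 < ‖ω j₀‖ := norm_pos_iff.mpr (hω _)
  set D := |ρ.im| + |ρ.re| + 1 with hD
  have hD0 : 0 < D := by positivity
  refine ⟨|ρ.im| * ‖ω j₀‖ / D, by positivity, fun t => ?_⟩
  set w := ω j₀ * t with hw
  have hρw : ω j₁ * t = ρ * w := by rw [hρ, hw]; field_simp [hω j₀]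
  have hsum : |w.re| + |(ρ * w).re| ≤ ∑ j, |(ω j * t).re| := by
    have := Finset.sum_le_sum_of_subset_of_nonneg (Finset.subset_univ {j₀, j₁})
      (f := fun j => |(ω j * t).re|) fun i _ _ => abs_nonneg _
    rwa [Finset.sum_pair hne.symm, hρw] at this
  have h1 : |ρ.im| * |w.im| ≤ |(ρ * w).re| + |ρ.re| * |w.re| := by
    rw [← abs_mul, ← abs_mul, Complex.mul_re]
    have := abs_sub (ρ.re * w.re) (ρ.re * w.re - ρ.im * w.im)
    rw [show ρ.re * w.re - (ρ.re * w.re - ρ.im * w.im) = ρ.im * w.im by ring] at this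
    linarith
  have h2 := Complex.norm_le_abs_re_add_abs_im w
  have h3 : ‖w‖ = ‖ω j₀‖ * ‖t‖ := norm_mul _ _
  have h4 : |ρ.im| * ‖w‖ ≤ D * (|w.re| + |(ρ * w).re|) := by
    have := mul_le_mul_of_nonneg_left h2 hρi.le
    rw [hD]
    nlinarith [abs_nonneg w.re, abs_nonneg (ρ * w).re, abs_nonneg ρ.re, mul_nonneg (abs_nonneg ρ.re) (abs_nonneg (ρ * w).re), mul_nonneg (abs_nonneg ρ.im) (abs_nonneg (ρ * w).re)]
  rw [div_mul_eq_mul_div, div_le_iff₀ hD0, mul_assoc, ← h3]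
  nlinarith

theorem exists_radii_tendsto_zero {n : ℕ} (hn : 2 ≤ n) {ω : Fin n → ℂ} (hω : ∀ j, ω j ≠ 0)
    (him : ∀ j k, j ≠ k → (ω j / ω k).im ≠ 0) {y : ℝ} (hy0 : 0 < y) (hy1 : y < 1) (l : ℤ) :
    ∃ R : ℕ → ℝ, (∀ N, 0 < R N) ∧ Filter.Tendsto R Filter.atTop Filter.atTop ∧
      (∀ N j, ∀ m : ℤ, R N * ‖ω j‖ / (2 * Real.pi) ≠ m) ∧
      Filter.Tendsto (fun N => ∮ z in C(0, R N), barnesKernel ω y l z) Filter.atTop (nhds 0) := by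
  have hpi := Real.pi_pos
  obtain ⟨ε, hε, hrad⟩ := exists_radius_far_from_int (a := fun j => ‖ω j‖ / (2 * Real.pi))
    fun j => div_pos (norm_pos_iff.mpr (hω j)) (by positivity)
  obtain ⟨C, hC, c, hc, hbound⟩ := exists_norm_exp_div_le hε hy0 hy1
  obtain ⟨κ, hκ, hsum⟩ := exists_mul_norm_le_sum_abs_re hn hω him
  choose R hR hRε using fun N : ℕ => hrad (N + 1)
  have hR0 : ∀ N, 0 < R N := fun N => lt_of_lt_of_le (by positivity) (hR N)
  have hRtop : Filter.Tendsto R Filter.atTop Filter.atTop := by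
    refine Filter.tendsto_atTop_mono (fun N => ?_) tendsto_natCast_atTop_atTop
    linarith [hR N]
  refine ⟨R, hR0, hRtop, fun N j m h => ?_, ?_⟩
  · have := hRε N j m
    rw [← mul_div_assoc, h, sub_self, abs_zero] at this
    linarith
  -- The exponent n - l is n - l - 1 from the kernel plus one from the length of the circle.
  · have hlim := ((tendsto_rpow_mul_exp_neg_mul_atTop_nhds_zero (((n : ℤ) - l : ℤ) : ℝ) (c * κ)
      (by positivity)).comp hRtop).const_mul (2 * Real.pi * C ^ n)
    rw [mul_zero] at hlim
    refine squeeze_zero_norm (fun N => ?_) hlim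
    have hz : ∀ z ∈ Metric.sphere (0 : ℂ) (R N), ‖barnesKernel ω y l z‖ ≤
        R N ^ ((n : ℤ) - l - 1) * (C ^ n * Real.exp (-(c * κ) * R N)) := by
      intro z hz
      have hzR : ‖z‖ = R N := by simpa using hz
      rw [barnesKernel, norm_mul, norm_zpow, hzR, norm_prod]
      refine mul_le_mul_of_nonneg_left ?_ (zpow_nonneg (hR0 N).le _)
      calc ∏ j, ‖Complex.exp (y * ω j * z) / (Complex.exp (ω j * z) - 1)‖
          ≤ ∏ j, (C * Real.exp (-c * |(ω j * z).re|)) := by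
            refine Finset.prod_le_prod (fun _ _ => norm_nonneg _) fun j _ => ?_
            rw [mul_assoc]
            refine hbound _ fun m => ?_
            rw [norm_mul, hzR, mul_comm, mul_div_assoc]
            exact hRε N j m
        _ = C ^ n * Real.exp (-c * ∑ j, |(ω j * z).re|) := by
            rw [Finset.prod_mul_distrib, ← Real.exp_sum, Finset.mul_sum]; simp
        _ ≤ _ := by
            refine mul_le_mul_of_nonneg_left (Real.exp_le_exp.mpr ?_) (pow_pos hC n).le
            have := mul_le_mul_of_nonneg_left (hsum z) hc.le
            rw [hzR] at this
            linarith
    refine (circleIntegral.norm_integral_le_of_norm_le_const (hR0 N).le hz).trans (le_of_eq ?_)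
    simp only [Function.comp]
    rw [Real.rpow_intCast, show (n : ℤ) - l = (n - l - 1) + 1 by ring, zpow_add_one₀ (hR0 N).ne']
    ring_nf

/-! ### The sum of all residues for 0 < y < 1 -/

theorem sum_Icc_erase_zero {M : Type*} [AddCommMonoid M] (f : ℤ → M) (N : ℕ) :
    ∑ m ∈ (Finset.Icc (-(N : ℤ)) N).erase 0, f m =
      ∑ i ∈ Finset.range N, f (i + 1) + ∑ i ∈ Finset.range N, f (-(i + 1)) := by
  induction N with
  | zero => simp
  | succ N ih =>
    have h : (Finset.Icc (-((N + 1 : ℕ) : ℤ)) (N + 1 : ℕ)).erase 0 =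
        insert ((N : ℤ) + 1) (insert (-((N : ℤ) + 1)) ((Finset.Icc (-(N : ℤ)) N).erase 0)) := by
      ext m
      simp only [Finset.mem_erase, Finset.mem_Icc, Finset.mem_insert]
      omega
    rw [h, Finset.sum_insert, Finset.sum_insert, ih, Finset.sum_range_succ, Finset.sum_range_succ]
    · abel
    · simp
    · simp only [Finset.mem_erase, Finset.mem_Icc, Finset.mem_insert]
      omega

theorem tendsto_sum_pnat {f : ℤ → ℂ} (h1 : Summable fun m : ℕ+ => f m)
    (h2 : Summable fun m : ℕ+ => f (-m)) :
    Filter.Tendsto (fun N : ℕ => ∑ m ∈ (Finset.Icc (-(N : ℤ)) N).erase 0, f m) Filter.atTop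
      (nhds (∑' m : ℕ+, f m + ∑' m : ℕ+, f (-m))) := by
  have key : ∀ g : ℤ → ℂ, Summable (fun m : ℕ+ => g m) →
      Filter.Tendsto (fun N : ℕ => ∑ i ∈ Finset.range N, g (i + 1)) Filter.atTop
        (nhds (∑' m : ℕ+, g m)) := by
    intro g hg
    have h := (summable_pnat_iff_summable_succ (f := fun i : ℕ => g i)).mp hg
    have h3 := tsum_pnat_eq_tsum_succ (f := fun i : ℕ => g i)
    have h4 := h.hasSum.tendsto_sum_nat
    rw [← h3] at h4
    refine h4.congr fun N => Finset.sum_congr rfl fun i _ => by push_cast; rfl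
  refine ((key f h1).add (key (fun m => f (-m)) h2)).congr fun N => ?_
  rw [sum_Icc_erase_zero]

/-- A circle cuts the rays at heights depending on k; as each ray is summable by itself, the
truncations can be sent to infinity separately. -/
theorem sum_tsum_barnesResidue {n : ℕ} (hn : 2 ≤ n) {ω : Fin n → ℂ} (hω : ∀ j, ω j ≠ 0)
    (him : ∀ j k, j ≠ k → (ω j / ω k).im ≠ 0) {y : ℝ} (hy0 : 0 < y) (hy1 : y < 1) (l : ℤ)
    (h1 : ∀ k, Summable fun m : ℕ+ => barnesResidue ω y l k m)
    (h2 : ∀ k, Summable fun m : ℕ+ => barnesResidue ω y l k (-m)) :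
    ∑ k, (∑' m : ℕ+, barnesResidue ω y l k m + ∑' m : ℕ+, barnesResidue ω y l k (-m)) =
      -laurentCoeff ω y l := by
  obtain ⟨R, hR0, hRtop, hgood, hlim⟩ := exists_radii_tendsto_zero hn hω him hy0 hy1 l
  have hpi := Complex.two_pi_I_ne_zero
  have hfl : ∀ k, Filter.Tendsto (fun N => ⌊R N * ‖ω k‖ / (2 * Real.pi)⌋₊) Filter.atTop
      Filter.atTop := fun k => by
    refine tendsto_nat_floor_atTop.comp ?_
    have : 0 < ‖ω k‖ / (2 * Real.pi) := div_pos (norm_pos_iff.mpr (hω k)) (by positivity)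
    simpa [mul_div_assoc] using hRtop.atTop_mul_const this
  have hA := tendsto_finsetSum Finset.univ fun k _ =>
    (tendsto_sum_pnat (h1 k) (h2 k)).comp (hfl k)
  have hB := (hA.const_add (laurentCoeff ω y l)).const_mul (2 * Real.pi * Complex.I)
  have hC := tendsto_nhds_unique (hB.congr fun N =>
    (circleIntegral_barnesKernel hω him y l (hR0 N) (hgood N)).symm) hlim
  rw [mul_eq_zero, or_iff_right hpi] at hC
  linear_combination hC

/-! ### Sums ∑ m^p e^{mz} near z = 0 and zeta values -/

theorem summable_zpow_mul_exp_neg (p : ℤ) {c : ℝ} (hc : 0 < c) :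
    Summable fun m : ℕ+ => (m : ℝ) ^ p * Real.exp (-c * m) := by
  have h := (Real.summable_pow_mul_exp_neg_nat_mul p.toNat hc).comp_injective PNat.coe_injective
  refine Summable.of_nonneg_of_le (fun m => by positivity) (fun m => ?_) h
  refine mul_le_mul_of_nonneg_right ?_ (Real.exp_pos _).le
  rw [← zpow_natCast]
  exact zpow_le_zpow_right₀ (by exact_mod_cast m.pos) (Int.self_le_toNat p)

/-- The sum `∑_{m ≥ 1} m^p e^{mz}`. -/
def expSum (p : ℤ) (z : ℂ) : ℂ := ∑' m : ℕ+, (m : ℂ) ^ p * Complex.exp (m * z)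

theorem norm_zpow_mul_exp (p : ℤ) (z : ℂ) (m : ℕ+) :
    ‖(m : ℂ) ^ p * Complex.exp (m * z)‖ = (m : ℝ) ^ p * Real.exp (m * z.re) := by
  rw [norm_mul, norm_zpow, Complex.norm_exp, ← Complex.ofReal_natCast, Complex.re_ofReal_mul]
  simp

theorem summable_zpow_mul_exp (p : ℤ) {z : ℂ} (hz : z.re < 0) :
    Summable fun m : ℕ+ => (m : ℂ) ^ p * Complex.exp (m * z) := by
  refine Summable.of_norm ((summable_zpow_mul_exp_neg p (neg_pos.mpr hz)).congr fun m => ?_)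
  rw [norm_zpow_mul_exp, neg_neg, mul_comm z.re]

/-- Each derivative raises the exponent by one, so all p ≥ 0 reduce to the geometric series p = 0.
-/
theorem hasDerivAt_expSum (p : ℤ) {z : ℂ} (hz : z.re < 0) :
    HasDerivAt (expSum p) (expSum (p + 1) z) z := by
  have hpos : 0 < -z.re / 2 := by linarith
  refine hasDerivAt_tsum_of_isPreconnected (t := {w : ℂ | w.re < z.re / 2}) (y₀ := z)
    (g := fun (m : ℕ+) w => (m : ℂ) ^ p * Complex.exp (m * w))
    (g' := fun (m : ℕ+) w => (m : ℂ) ^ (p + 1) * Complex.exp (m * w))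
    (summable_zpow_mul_exp_neg (p + 1) hpos)
    (isOpen_lt Complex.continuous_re continuous_const)
    (convex_halfSpace_re_lt (z.re / 2)).isPreconnected ?_ ?_ ?_ (summable_zpow_mul_exp p hz) ?_
  · intro m w _
    have h : HasDerivAt (fun w : ℂ => Complex.exp (m * w)) (Complex.exp (m * w) * (m * 1)) w :=
      ((hasDerivAt_id w).const_mul (m : ℂ)).cexp
    refine (h.const_mul ((m : ℂ) ^ p)).congr_deriv ?_
    rw [zpow_add_one₀ (by exact_mod_cast m.ne_zero)]
    ring
  · intro m w hw
    rw [norm_zpow_mul_exp]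
    have hw : w.re < z.re / 2 := hw
    have hm : (0 : ℝ) < m := by exact_mod_cast m.pos
    refine mul_le_mul_of_nonneg_left (Real.exp_le_exp.mpr ?_) (by positivity)
    nlinarith
  all_goals simp only [Set.mem_ofPred_eq]; linarith

theorem isOpen_re_neg : IsOpen {w : ℂ | w.re < 0} :=
  isOpen_lt Complex.continuous_re continuous_const

theorem iteratedDeriv_expSum (p : ℕ) {z : ℂ} (hz : z.re < 0) :
    iteratedDeriv p (expSum 0) z = expSum p z := by
  induction p generalizing z with
  | zero => simp
  | succ p ih =>
    rw [iteratedDeriv_succ]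
    have h : iteratedDeriv p (expSum 0) =ᶠ[nhds z] expSum p := by
      filter_upwards [isOpen_re_neg.mem_nhds hz] with w hw using ih hw
    rw [h.deriv_eq, (hasDerivAt_expSum p hz).deriv]
    push_cast
    rfl

theorem expSum_zero {z : ℂ} (hz : z.re < 0) :
    expSum 0 z = Complex.exp z / (1 - Complex.exp z) := by
  have hlt : ‖Complex.exp z‖ < 1 := by
    rw [Complex.norm_exp, Real.exp_lt_one_iff]; exact hz
  have h := tsum_pnat_eq_tsum_succ (f := fun m : ℕ => Complex.exp z ^ m)
  simp only [pow_succ] at h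
  rw [tsum_mul_right, tsum_geometric_of_norm_lt_one hlt] at h
  rw [expSum, div_eq_inv_mul, ← h]
  exact tsum_congr fun m => by simp [Complex.exp_nat_mul]

theorem coe_bernoulliB_one (m : ℕ) : bernoulliB m 1 = (bernoulli' m : ℂ) := by
  have h := Polynomial.aeval_algebraMap_apply ℂ (1 : ℚ) (Polynomial.bernoulli m)
  rw [map_one] at h
  rw [bernoulliB, h, Polynomial.coe_aeval_eq_eval, Polynomial.bernoulli_eval_one]
  rfl

/-- The geometric series equals -1/z - g(z) with g analytic at 0. Differentiating p times, -1/z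
produces the subtracted singular term, and -g contributes -g^{(p)}(0) = -B'_{p+1}/(p+1) = ζ(-p),
with B' the Bernoulli numbers `bernoulli'`. -/
theorem tendsto_expSum_nat (p : ℕ) {w : ℂ} (hw : w.re < 0) :
    Filter.Tendsto (fun y : ℝ => expSum p (y * w) -
      (-(-1) ^ p * p ! * w ^ (-1 - p : ℤ)) * (y : ℂ) ^ (-1 - p : ℤ)) (nhdsWithin 0 (Set.Ioi 0))
      (nhds (riemannZeta (-p))) := by
  -- The parameter y = 1 appears because the geometric series is -e^z/(e^z - 1).
  have hB := analyticAt_bernoulliGen 1 (one_ne_zero (α := ℂ))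
  set g := dslope (bernoulliGen 1 1) 0 with hg
  have hga : AnalyticAt ℂ g 0 := hB.dslope_same
  have hB0 : bernoulliGen 1 1 0 = 1 := by simp [bernoulliGen, expSlope_zero]
  have hval : iteratedDeriv p g 0 = bernoulli' (p + 1) / (p + 1) := by
    have h1 := congrArg (PowerSeries.coeff (p + 1)) (taylorPS_eq_add_X_mul hB)
    rw [coeff_taylorPS_bernoulliGen 1 one_ne_zero, map_add, PowerSeries.coeff_succ_X_mul,
      PowerSeries.coeff_C, if_neg (by omega), zero_add, coeff_taylorPS, coe_bernoulliB_one] at h1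
    simp only [one_zpow, mul_one, ← hg] at h1
    have h2 : (p ! : ℂ) ≠ 0 := by exact_mod_cast p.factorial_ne_zero
    have h3 : (p + 1 : ℂ) ≠ 0 := by exact_mod_cast p.succ_ne_zero
    rw [Nat.factorial_succ] at h1
    push_cast at h1
    field_simp at h1 ⊢
    linear_combination -h1
  have hf0 : Set.EqOn (expSum 0) (fun z => -(Inv.inv z) - g z) {z | z.re < 0} := by
    intro z hz
    have hz : z.re < 0 := hz
    have hz0 : z ≠ 0 := by rintro rfl; simp at hz
    have h1 := eq_add_mul_dslope (bernoulliGen 1 1) z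
    rw [bernoulliGen_of_ne 1 1 hz0, hB0] at h1
    simp only [one_mul] at h1
    have h2 : Complex.exp z / (1 - Complex.exp z) = -(Complex.exp z / (Complex.exp z - 1)) := by
      rw [← neg_sub, div_neg]
    change expSum 0 z = -z⁻¹ - g z
    rw [expSum_zero hz, h2, hg]
    field_simp
    linear_combination -h1
  have hev : ∀ᶠ z in nhds (0 : ℂ), z.re < 0 →
      expSum p z - (-((-1) ^ p * p ! * z ^ (-1 - p : ℤ))) = - iteratedDeriv p g z := by
    filter_upwards [hga.eventually_analyticAt] with z hgz hz
    have hz0 : z ≠ 0 := by rintro rfl; simp at hz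
    rw [← iteratedDeriv_expSum p hz, hf0.iteratedDeriv_of_isOpen isOpen_re_neg p hz]
    have hinv : AnalyticAt ℂ (fun z : ℂ => -(Inv.inv z)) z := (analyticAt_inv hz0).neg
    have h3 := iteratedDeriv_sub (n := p) hinv.contDiffAt hgz.contDiffAt
    have h4 : iteratedDeriv p (fun z : ℂ => -(Inv.inv z)) z =
        -((-1) ^ p * p ! * z ^ (-1 - p : ℤ)) := by
      rw [iteratedDeriv_fun_neg, iteratedDeriv_eq_iterate, iter_deriv_inv]
    rw [h4] at h3
    change iteratedDeriv p ((fun z : ℂ => -(Inv.inv z)) - g) z - _ = _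
    rw [h3]; ring
  have hcont : ContinuousAt (iteratedDeriv p g) 0 := by
    rw [iteratedDeriv_eq_iterate]; exact (hga.iterated_deriv p).continuousAt
  have hyw : Filter.Tendsto (fun y : ℝ => (y : ℂ) * w) (nhdsWithin 0 (Set.Ioi 0)) (nhds 0) := by
    have : Continuous fun y : ℝ => (y : ℂ) * w := by fun_prop
    simpa using (this.tendsto 0).mono_left nhdsWithin_le_nhds
  have hlim := (hcont.tendsto.comp hyw).neg
  rw [hval] at hlim
  rw [riemannZeta_neg_nat_eq_bernoulli', neg_div]
  refine hlim.congr' ?_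
  filter_upwards [hyw.eventually hev, self_mem_nhdsWithin] with y hy hy0
  have hy0 : 0 < y := hy0
  simp only [Function.comp]
  rw [← hy (by rw [Complex.re_ofReal_mul]; nlinarith), mul_zpow]
  ring

/-- Here ∑ m^p itself converges and dominates, so there is no singular term. -/
theorem tendsto_expSum_neg {p : ℤ} (hp : p ≤ -2) {w : ℂ} (hw : w.re < 0) :
    Filter.Tendsto (fun y : ℝ => expSum p (y * w)) (nhdsWithin 0 (Set.Ioi 0))
      (nhds (riemannZeta (-p))) := by
  obtain ⟨k, rfl⟩ : ∃ k : ℕ, p = -(k : ℤ) := ⟨p.natAbs, by omega⟩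
  have hk : 1 < k := by omega
  have hzeta : riemannZeta (-((-(k : ℤ) : ℤ) : ℂ)) = ∑' m : ℕ+, (m : ℂ) ^ (-(k : ℤ)) := by
    push_cast
    rw [neg_neg, zeta_eq_tsum_one_div_nat_add_one_cpow (by simpa using hk),
      tsum_pnat_eq_tsum_succ (f := fun m : ℕ => (m : ℂ) ^ (-(k : ℤ)))]
    exact tsum_congr fun m => by simp
  rw [hzeta]
  have hs : Summable fun m : ℕ+ => (m : ℝ) ^ (-(k : ℤ)) := by
    have h := (Real.summable_one_div_nat_pow.mpr hk).comp_injective PNat.coe_injective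
    exact h.congr fun m => by simp
  refine tendsto_tsum_of_dominated_convergence hs (fun m => ?_) ?_
  · have : Continuous fun y : ℝ => (m : ℂ) ^ (-(k : ℤ)) * Complex.exp (m * (y * w)) := by fun_prop
    simpa using (this.tendsto 0).mono_left nhdsWithin_le_nhds
  · filter_upwards [self_mem_nhdsWithin] with y hy m
    have hy : 0 < y := hy
    rw [norm_zpow_mul_exp, Complex.re_ofReal_mul]
    have hm : (0 : ℝ) < m := by exact_mod_cast m.pos
    refine mul_le_of_le_one_right (by positivity) (Real.exp_le_one_iff.mpr ?_)
    have : y * w.re < 0 := mul_neg_of_pos_of_neg hy hw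
    nlinarith

/-- The value of D is irrelevant: it vanishes for p < 0, and for p ≥ 0 the contributions of all rays
will be shown to cancel. For p = -1 the sum is a logarithm and has no such expansion. -/
theorem exists_tendsto_expSum {p : ℤ} (hp : p ≠ -1) {w : ℂ} (hw : w.re < 0) :
    ∃ D : ℂ, (p < 0 → D = 0) ∧ Filter.Tendsto (fun y : ℝ => expSum p (y * w) -
      D * (y : ℂ) ^ (-1 - p)) (nhdsWithin 0 (Set.Ioi 0)) (nhds (riemannZeta (-p))) := by
  rcases lt_or_ge p 0 with h | h
  · exact ⟨0, fun _ => rfl, by simpa using tendsto_expSum_neg (by omega) hw⟩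
  · obtain ⟨k, rfl⟩ := Int.eq_ofNat_of_zero_le h
    refine ⟨-(-1) ^ k * k ! * w ^ (-1 - k : ℤ), fun h' => by omega, ?_⟩
    have := tendsto_expSum_nat k hw
    rwa [← Int.cast_natCast] at this

/-! ### The residue series along one ray as y → 0+ -/

theorem exp_sub_one_ne_zero_of_re_ne_zero {z : ℂ} (hz : z.re ≠ 0) : Complex.exp z - 1 ≠ 0 := by
  intro h
  have h1 := congrArg norm (sub_eq_zero.mp h)
  rw [Complex.norm_exp, norm_one, Real.exp_eq_one_iff] at h1
  exact hz h1

theorem exp_mul_le_exp_of_nonpos {x : ℝ} (hx : x ≤ 0) (m : ℕ+) :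
    Real.exp (m * x) ≤ Real.exp x := by
  have hm : (1 : ℝ) ≤ m := by exact_mod_cast m.pos
  exact Real.exp_le_exp.mpr (by nlinarith)

theorem one_sub_exp_le_norm {x : ℂ} (hx : x.re < 0) (m : ℕ+) :
    1 - Real.exp x.re ≤ ‖Complex.exp (m * x) - 1‖ := by
  have h := (neg_le_abs _).trans (abs_norm_sub_norm_le (Complex.exp (m * x)) 1)
  rw [Complex.norm_exp, norm_one, ← Complex.ofReal_natCast, Complex.re_ofReal_mul] at h
  have := exp_mul_le_exp_of_nonpos hx.le m
  push_cast at *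
  linarith

theorem one_sub_exp_pos {x : ℝ} (hx : x < 0) : 0 < 1 - Real.exp x := by
  have : Real.exp x < 1 := by rwa [Real.exp_lt_one_iff]
  linarith

/-- The bound must be uniform in y down to 0. For Re x < 0 the quotient is merely bounded; for Re x
> 0 it decays at rate (1-y)Re x, and y ≤ 1/2 keeps half of it. -/
theorem exists_norm_exp_div_le_of_re_ne_zero {x : ℂ} (hx : x.re ≠ 0) :
    ∃ C > 0, ∃ c ≥ 0, (0 < x.re → 0 < c) ∧ ∀ (m : ℕ+) (y : ℝ), 0 ≤ y → y ≤ 1 / 2 →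
      ‖Complex.exp (y * (m * x)) / (Complex.exp (m * x) - 1)‖ ≤ C * Real.exp (-c * m) := by
  have hre : ∀ (m : ℕ+) (y : ℝ), (y * (m * x)).re = y * (m * x.re) := fun m y => by
    rw [Complex.re_ofReal_mul, ← Complex.ofReal_natCast, Complex.re_ofReal_mul]
  rcases lt_or_gt_of_ne hx with h | h
  · have hD := one_sub_exp_pos h
    refine ⟨(1 - Real.exp x.re)⁻¹, inv_pos.mpr hD, 0, le_rfl, fun h' => absurd h (by linarith),
      fun m y hy0 _ => ?_⟩
    have hm : (0 : ℝ) < m := by exact_mod_cast m.pos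
    rw [norm_div, Complex.norm_exp, hre, neg_zero, zero_mul, Real.exp_zero, mul_one, ← one_div]
    refine div_le_div₀ zero_le_one (Real.exp_le_one_iff.mpr ?_) hD (one_sub_exp_le_norm h m)
    have : (m : ℝ) * x.re < 0 := mul_neg_of_pos_of_neg hm h
    nlinarith
  · have hD := one_sub_exp_pos (x := (-x).re) (by simpa using h)
    refine ⟨(1 - Real.exp (-x).re)⁻¹, inv_pos.mpr hD, x.re / 2, by linarith, fun _ => by linarith,
      fun m y _ hy1 => ?_⟩
    have hm : (0 : ℝ) < m := by exact_mod_cast m.pos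
    have h1 : Complex.exp (m * x) - 1 = -(Complex.exp (m * x) * (Complex.exp (m * -x) - 1)) := by
      rw [mul_sub, ← Complex.exp_add]; simp
    rw [h1, div_neg, norm_neg, ← div_div, ← Complex.exp_sub, norm_div, Complex.norm_exp,
      div_eq_inv_mul, Complex.sub_re, hre, ← Complex.ofReal_natCast, Complex.re_ofReal_mul]
    have h2 := one_sub_exp_le_norm (x := -x) (by simpa using h) m
    refine mul_le_mul (inv_anti₀ hD (by simpa using h2)) (Real.exp_le_exp.mpr ?_)
      (Real.exp_pos _).le (inv_pos.mpr hD).le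
    have : 0 < (m : ℝ) * x.re := mul_pos hm h
    nlinarith

theorem exists_norm_prod_sub_le {ι : Type*} (J : Finset ι) (x : ι → ℂ)
    (hx : ∀ j ∈ J, (x j).re < 0) :
    ∃ C ≥ 0, ∃ c > 0, ∀ m : ℕ+,
      ‖∏ j ∈ J, 1 / (Complex.exp (m * x j) - 1) - (-1) ^ J.card‖ ≤ C * Real.exp (-c * m) := by
  classical
  induction J using Finset.induction_on with
  | empty => exact ⟨0, le_rfl, 1, one_pos, by simp⟩
  | insert a J ha ih =>
    obtain ⟨C, hC, c, hc, hb⟩ := ih fun j hj => hx j (by simp [hj])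
    have hxa := hx a (by simp)
    have hD := one_sub_exp_pos hxa
    set D := (1 - Real.exp (x a).re)⁻¹ with hDdef
    have hD0 : 0 < D := inv_pos.mpr hD
    refine ⟨D * (C + 1) + C, by positivity, min c (-(x a).re), lt_min hc (by linarith), fun m => ?_⟩
    have hm : (0 : ℝ) < m := by exact_mod_cast m.pos
    rw [Finset.prod_insert ha, Finset.card_insert_of_notMem ha]
    set P := ∏ j ∈ J, 1 / (Complex.exp (m * x j) - 1) with hP
    have hne : Complex.exp (m * x a) - 1 ≠ 0 := by
      apply exp_sub_one_ne_zero_of_re_ne_zero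
      rw [← Complex.ofReal_natCast, Complex.re_ofReal_mul]
      exact (mul_neg_of_pos_of_neg hm hxa).ne
    -- This is 1/(E - 1) = E/(E - 1) - 1, where E is exponentially small.
    have hid : 1 / (Complex.exp (m * x a) - 1) * P - (-1) ^ (J.card + 1) =
        Complex.exp (m * x a) / (Complex.exp (m * x a) - 1) * P - (P - (-1) ^ J.card) := by
      field_simp
      ring
    have e1 : Real.exp (-c * m) ≤ Real.exp (-min c (-(x a).re) * m) :=
      Real.exp_le_exp.mpr (by nlinarith [min_le_left c (-(x a).re)])
    have e2 : Real.exp (m * (x a).re) ≤ Real.exp (-min c (-(x a).re) * m) :=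
      Real.exp_le_exp.mpr (by nlinarith [min_le_right c (-(x a).re)])
    have hPn : ‖P‖ ≤ C + 1 := by
      have h1 := norm_add_le (P - (-1) ^ J.card) ((-1) ^ J.card)
      rw [sub_add_cancel, norm_pow, norm_neg, norm_one, one_pow] at h1
      have h2 : Real.exp (-c * m) ≤ 1 := Real.exp_le_one_iff.mpr (by nlinarith)
      nlinarith [hb m]
    have hq : ‖Complex.exp (m * x a) / (Complex.exp (m * x a) - 1)‖ ≤
        D * Real.exp (m * (x a).re) := by
      rw [norm_div, div_eq_inv_mul, Complex.norm_exp, ← Complex.ofReal_natCast,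
        Complex.re_ofReal_mul]
      refine mul_le_mul_of_nonneg_right (inv_anti₀ hD ?_) (Real.exp_pos _).le
      simpa using one_sub_exp_le_norm hxa m
    rw [hid]
    calc _ ≤ ‖Complex.exp (m * x a) / (Complex.exp (m * x a) - 1)‖ * ‖P‖ + ‖P - (-1) ^ J.card‖ := by
          rw [← norm_mul]; exact norm_sub_le _ _
      _ ≤ D * Real.exp (-min c (-(x a).re) * m) * (C + 1) +
          C * Real.exp (-min c (-(x a).re) * m) := by
          refine add_le_add (mul_le_mul (hq.trans ?_) hPn (norm_nonneg _) (by positivity))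
            ((hb m).trans ?_)
          · exact mul_le_mul_of_nonneg_left e2 hD0.le
          · exact mul_le_mul_of_nonneg_left e1 hC
      _ = _ := by ring

open Classical in
/-- The limit of `∏_{j ∈ J} 1 / (e^{m x_j} - 1)` as `m → ∞`. -/
def prodLimit {ι : Type*} (J : Finset ι) (x : ι → ℂ) : ℂ :=
  if ∀ j ∈ J, (x j).re < 0 then (-1) ^ J.card else 0

/-- If all real parts are negative, the exponential in front has modulus at most 1 and the product
converges exponentially. Otherwise the limit constant is 0; distributing the exponential over the
factors leaves all of them bounded and one decaying. Uniformity in y provides the dominating series.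
-/
theorem exists_norm_exp_mul_prod_sub_le {ι : Type*} (J : Finset ι) (x : ι → ℂ)
    (hx : ∀ j ∈ J, (x j).re ≠ 0) :
    ∃ C ≥ 0, ∃ c > 0, ∀ (m : ℕ+) (y : ℝ), 0 ≤ y → y ≤ 1 / 2 →
      ‖Complex.exp (y * (m * ∑ j ∈ J, x j)) *
        (∏ j ∈ J, 1 / (Complex.exp (m * x j) - 1) - prodLimit J x)‖ ≤ C * Real.exp (-c * m) := by
  classical
  by_cases hneg : ∀ j ∈ J, (x j).re < 0
  · obtain ⟨C, hC, c, hc, h⟩ := exists_norm_prod_sub_le J x hneg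
    refine ⟨C, hC, c, hc, fun m y hy0 _ => ?_⟩
    rw [prodLimit, if_pos hneg, norm_mul]
    refine le_trans (mul_le_of_le_one_left (norm_nonneg _) ?_) (h m)
    rw [Complex.norm_exp, Real.exp_le_one_iff, Complex.re_ofReal_mul, ← Complex.ofReal_natCast,
      Complex.re_ofReal_mul, Complex.re_sum]
    have h1 : ∑ j ∈ J, (x j).re ≤ 0 := Finset.sum_nonpos fun j hj => (hneg j hj).le
    have hm : (0 : ℝ) < m := by exact_mod_cast m.pos
    exact mul_nonpos_of_nonneg_of_nonpos hy0 (mul_nonpos_of_nonneg_of_nonpos hm.le h1)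
  · have hsingle : ∀ j : ι, ∃ C > 0, ∃ c ≥ 0, j ∈ J → (0 < (x j).re → 0 < c) ∧
        ∀ (m : ℕ+) (y : ℝ), 0 ≤ y → y ≤ 1 / 2 →
          ‖Complex.exp (y * (m * x j)) / (Complex.exp (m * x j) - 1)‖ ≤ C * Real.exp (-c * m) := by
      intro j
      by_cases hj : j ∈ J
      · obtain ⟨C, hC, c, hc, h⟩ := exists_norm_exp_div_le_of_re_ne_zero (hx j hj)
        exact ⟨C, hC, c, hc, fun _ => h⟩
      · exact ⟨1, one_pos, 0, le_rfl, fun h => absurd h hj⟩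
    choose C hC c hc h using hsingle
    push Not at hneg
    obtain ⟨j₀, hj₀, hpos⟩ := hneg
    refine ⟨∏ j ∈ J, C j, (Finset.prod_pos fun j _ => hC j).le, ∑ j ∈ J, c j, ?_, fun m y hy0 hy1 => ?_⟩
    · exact lt_of_lt_of_le ((h j₀ hj₀).1 (lt_of_le_of_ne hpos (hx j₀ hj₀).symm))
        (Finset.single_le_sum (fun j _ => hc j) hj₀)
    · rw [prodLimit, if_neg (by push Not; exact ⟨j₀, hj₀, hpos⟩), sub_zero, Finset.mul_sum,
        Finset.mul_sum, Complex.exp_sum, ← Finset.prod_mul_distrib, norm_prod]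
      calc _ ≤ ∏ j ∈ J, (C j * Real.exp (-c j * m)) := by
            refine Finset.prod_le_prod (fun _ _ => norm_nonneg _) fun j hj => ?_
            rw [mul_one_div]
            exact (h j hj).2 m y hy0 hy1
        _ = _ := by
            rw [Finset.prod_mul_distrib, ← Real.exp_sum, ← Finset.sum_mul, Finset.sum_neg_distrib]

/-- The behaviour as `y → 0+` of the sum of the residues along one ray. -/
theorem ray_sum {ι : Type*} (J : Finset ι) (x : ι → ℂ) (hx : ∀ j ∈ J, (x j).re ≠ 0)
    (hJ : J.Nonempty) {u : ℂ} (hu : u.re = 0) {p : ℤ} (hp : p ≠ -1) :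
    (Summable fun m : ℕ+ => (m : ℂ) ^ p *
      (∏ j ∈ J, 1 / (Complex.exp (m * x j) - 1) - prodLimit J x)) ∧
    (∀ y : ℝ, 0 < y → y ≤ 1 / 2 → Summable fun m : ℕ+ => (m : ℂ) ^ p *
      (Complex.exp (y * (m * (u + ∑ j ∈ J, x j))) * ∏ j ∈ J, 1 / (Complex.exp (m * x j) - 1))) ∧
    ∃ D : ℂ, (p < 0 → D = 0) ∧ Filter.Tendsto (fun y : ℝ => (∑' m : ℕ+, (m : ℂ) ^ p *
      (Complex.exp (y * (m * (u + ∑ j ∈ J, x j))) * ∏ j ∈ J, 1 / (Complex.exp (m * x j) - 1))) -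
        D * (y : ℂ) ^ (-1 - p)) (nhdsWithin 0 (Set.Ioi 0))
      (nhds (∑' m : ℕ+, (m : ℂ) ^ p *
        (∏ j ∈ J, 1 / (Complex.exp (m * x j) - 1) - prodLimit J x) +
          prodLimit J x * riemannZeta (-p))) := by
  classical
  obtain ⟨C, hC, c, hc, hbound⟩ := exists_norm_exp_mul_prod_sub_le J x hx
  set w := u + ∑ j ∈ J, x j with hw
  let T : ℕ+ → ℂ := fun m => ∏ j ∈ J, 1 / (Complex.exp (m * x j) - 1) - prodLimit J x
  have hT : ∀ (m : ℕ+) (y : ℝ), 0 ≤ y → y ≤ 1 / 2 →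
      ‖(m : ℂ) ^ p * (Complex.exp (y * (m * w)) * T m)‖ ≤ C * ((m : ℝ) ^ p * Real.exp (-c * m)) := by
    intro m y hy0 hy1
    have h1 : ‖Complex.exp (y * (m * w))‖ = ‖Complex.exp (y * (m * ∑ j ∈ J, x j))‖ := by
      rw [Complex.norm_exp, Complex.norm_exp]
      congr 1
      rw [Complex.re_ofReal_mul, Complex.re_ofReal_mul, ← Complex.ofReal_natCast,
        Complex.re_ofReal_mul, Complex.re_ofReal_mul, hw, Complex.add_re, hu, zero_add]
    have h2 := hbound m y hy0 hy1
    rw [norm_mul, ← h1, ← norm_mul] at h2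
    rw [norm_mul, norm_zpow, Complex.norm_natCast]
    calc _ ≤ (m : ℝ) ^ p * (C * Real.exp (-c * m)) :=
          mul_le_mul_of_nonneg_left h2 (by positivity)
      _ = _ := by ring
  have hsum := (summable_zpow_mul_exp_neg p hc).mul_left C
  have hTs : ∀ y : ℝ, 0 ≤ y → y ≤ 1 / 2 →
      Summable fun m : ℕ+ => (m : ℂ) ^ p * (Complex.exp (y * (m * w)) * T m) := fun y h0 h1 =>
    Summable.of_norm_bounded hsum fun m => hT m y h0 h1
  have hT0 : Filter.Tendsto (fun y : ℝ => ∑' m : ℕ+, (m : ℂ) ^ p * (Complex.exp (y * (m * w)) * T m))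
      (nhdsWithin 0 (Set.Ioi 0)) (nhds (∑' m : ℕ+, (m : ℂ) ^ p * T m)) := by
    refine tendsto_tsum_of_dominated_convergence hsum (fun m => ?_) ?_
    · have : Continuous fun y : ℝ => (m : ℂ) ^ p * (Complex.exp (y * (m * w)) * T m) := by fun_prop
      simpa using (this.tendsto 0).mono_left nhdsWithin_le_nhds
    · filter_upwards [Ioc_mem_nhdsGT (show (0 : ℝ) < 1 / 2 by norm_num)] with y hy m
      exact hT m y hy.1.le hy.2
  -- The first part is dominated uniformly in y; all of the singular behaviour at y = 0 sits in the
  -- second, an `expSum`.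
  have hdec : ∀ (y : ℝ) (m : ℕ+), (m : ℂ) ^ p *
      (Complex.exp (y * (m * w)) * ∏ j ∈ J, 1 / (Complex.exp (m * x j) - 1)) =
      (m : ℂ) ^ p * (Complex.exp (y * (m * w)) * T m) +
        prodLimit J x * ((m : ℂ) ^ p * Complex.exp (m * (y * w))) := by
    intro y m
    rw [show (m : ℂ) * (y * w) = y * (m * w) by ring]
    simp only [T]
    ring
  have hs0 := hTs 0 le_rfl (by norm_num)
  simp only [Complex.ofReal_zero, zero_mul, Complex.exp_zero, one_mul] at hs0
  refine ⟨hs0, ?_⟩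
  by_cases hneg : ∀ j ∈ J, (x j).re < 0
  -- Nonemptiness of `J` makes the real part strictly negative, so the sum split off converges for y
  -- > 0.
  · have hwre : w.re < 0 := by
      rw [hw, Complex.add_re, hu, zero_add, Complex.re_sum]
      exact Finset.sum_neg hneg hJ
    have hs : ∀ y : ℝ, 0 < y → Summable fun m : ℕ+ =>
        prodLimit J x * ((m : ℂ) ^ p * Complex.exp (m * (y * w))) := fun y hy =>
      (summable_zpow_mul_exp p (by rw [Complex.re_ofReal_mul]; nlinarith)).mul_left _
    refine ⟨fun y hy0 hy1 => ?_, ?_⟩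
    · simp_rw [hdec]
      exact (hTs y hy0.le hy1).add (hs y hy0)
    · obtain ⟨D, hD, hlim⟩ := exists_tendsto_expSum hp hwre
      refine ⟨prodLimit J x * D, fun h => by rw [hD h, mul_zero], ?_⟩
      refine (hT0.add (hlim.const_mul (prodLimit J x))).congr' ?_
      filter_upwards [Ioc_mem_nhdsGT (show (0 : ℝ) < 1 / 2 by norm_num)] with y hy
      simp_rw [hdec]
      rw [(hTs y hy.1.le hy.2).tsum_add (hs y hy.1), tsum_mul_left, expSum]
      ring
  · have h0 : prodLimit J x = 0 := if_neg hneg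
    simp_rw [hdec, h0, zero_mul, add_zero]
    exact ⟨fun y hy0 hy1 => hTs y hy0.le hy1, 0, fun _ => rfl, by simpa only [zero_mul, sub_zero, T, h0] using hT0⟩

/-! ### The regularized series equals the Bernoulli sum -/

theorem re_mul_two_pi_I_div (a b : ℂ) :
    (a * (2 * Real.pi * Complex.I / b)).re = -(2 * Real.pi) * (a / b).im := by
  have : a * (2 * Real.pi * Complex.I / b) = ((2 * Real.pi : ℝ) : ℂ) * (Complex.I * (a / b)) := by
    push_cast; ring
  rw [this, Complex.re_ofReal_mul, Complex.I_mul_re]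
  ring

theorem card_erase_parity {n : ℕ} (k : Fin n) :
    ((-1 : ℂ)) ^ (Finset.univ.erase k).card = (-1) ^ (n + 1) := by
  rw [Finset.card_erase_of_mem (Finset.mem_univ k), Finset.card_univ, Fintype.card_fin]
  obtain ⟨m, rfl⟩ : ∃ m, n = m + 1 := ⟨n - 1, by have := k.pos; omega⟩
  rw [Nat.add_sub_cancel, pow_add, pow_add, pow_one]
  ring

/-- On the ray of 2πi/ω_k the j-th exponent has real part -2π Im(ω_j/ω_k). All are negative exactly
when no imaginary part is negative, the value 0 being excluded; the sign agrees because n - 1 and n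
+ 1 have equal parity. -/
theorem prodLimit_eq_deltaJ_indexNeg {n : ℕ} {ω : Fin n → ℂ}
    (him : ∀ j k, j ≠ k → (ω j / ω k).im ≠ 0) (k : Fin n) :
    prodLimit (Finset.univ.erase k) (fun j => ω j * (2 * Real.pi * Complex.I / ω k)) =
      deltaJ (indexNeg ω k) := by
  rw [prodLimit, deltaJ, card_erase_parity]
  suffices h : (∀ j ∈ Finset.univ.erase k, (ω j * (2 * Real.pi * Complex.I / ω k)).re < 0) ↔
      indexNeg ω k = ∅ by
    by_cases h' : indexNeg ω k = ∅
    · rw [if_pos h', if_pos (h.mpr h')]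
    · rw [if_neg h', if_neg (mt h.mp h')]
  simp only [Finset.mem_erase, Finset.mem_univ, and_true, indexNeg, Finset.filter_eq_empty_iff,
    true_imp_iff, not_and, not_lt, re_mul_two_pi_I_div]
  have hpi := Real.two_pi_pos
  refine ⟨fun h j hj => ?_, fun h j hj => ?_⟩
  · nlinarith [h j hj]
  · have := lt_of_le_of_ne (h hj) (him j k hj).symm
    nlinarith

theorem prodLimit_eq_deltaJ_indexPos {n : ℕ} {ω : Fin n → ℂ}
    (him : ∀ j k, j ≠ k → (ω j / ω k).im ≠ 0) (k : Fin n) :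
    prodLimit (Finset.univ.erase k) (fun j => ω j * -(2 * Real.pi * Complex.I / ω k)) =
      deltaJ (indexPos ω k) := by
  rw [prodLimit, deltaJ, card_erase_parity]
  suffices h : (∀ j ∈ Finset.univ.erase k, (ω j * -(2 * Real.pi * Complex.I / ω k)).re < 0) ↔
      indexPos ω k = ∅ by
    by_cases h' : indexPos ω k = ∅
    · rw [if_pos h', if_pos (h.mpr h')]
    · rw [if_neg h', if_neg (mt h.mp h')]
  simp only [Finset.mem_erase, Finset.mem_univ, and_true, indexPos, Finset.filter_eq_empty_iff,
    true_imp_iff, not_and, not_lt, mul_neg, Complex.neg_re, re_mul_two_pi_I_div]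
  have hpi := Real.two_pi_pos
  refine ⟨fun h j hj => ?_, fun h j hj => ?_⟩
  · nlinarith [h j hj]
  · have := lt_of_le_of_ne (h hj) (him j k hj)
    nlinarith

theorem termPos_eq {n : ℕ} {ω : Fin n → ℂ} (him : ∀ j k, j ≠ k → (ω j / ω k).im ≠ 0) (l : ℤ)
    (k : Fin n) (m : ℕ+) :
    termPos ω l k m = (2 * Real.pi * Complex.I / ω k) ^ ((n : ℤ) - l - 1) *
      ((m : ℂ) ^ ((n : ℤ) - l - 1) * (∏ j ∈ Finset.univ.erase k,
        1 / (Complex.exp (m * (ω j * (2 * Real.pi * Complex.I / ω k))) - 1) -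
          prodLimit (Finset.univ.erase k) fun j => ω j * (2 * Real.pi * Complex.I / ω k))) := by
  rw [prodLimit_eq_deltaJ_indexNeg him, termPos, ← mul_assoc, ← mul_zpow]
  congr 2
  · ring
  · exact Finset.prod_congr rfl fun j _ => by congr 3; ring

theorem termNeg_eq {n : ℕ} {ω : Fin n → ℂ} (him : ∀ j k, j ≠ k → (ω j / ω k).im ≠ 0) (l : ℤ)
    (k : Fin n) (m : ℕ+) :
    termNeg ω l k m = (-(2 * Real.pi * Complex.I / ω k)) ^ ((n : ℤ) - l - 1) *
      ((m : ℂ) ^ ((n : ℤ) - l - 1) * (∏ j ∈ Finset.univ.erase k,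
        1 / (Complex.exp (m * (ω j * -(2 * Real.pi * Complex.I / ω k))) - 1) -
          prodLimit (Finset.univ.erase k) fun j => ω j * -(2 * Real.pi * Complex.I / ω k))) := by
  rw [prodLimit_eq_deltaJ_indexPos him, termNeg, ← mul_assoc, ← mul_zpow]
  congr 2
  · ring
  · exact Finset.prod_congr rfl fun j _ => by congr 3; ring

/-- Rewrites a residue in the shape required by `ray_sum`; `q` is the generator ±2πi/ω_k of the ray,
so one formula serves M = m and M = -m. -/
theorem barnesResidue_eq {n : ℕ} (ω : Fin n → ℂ) (y : ℂ) (l : ℤ) (k : Fin n) (m : ℕ+) {M : ℤ}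
    {q : ℂ} (hM : (M : ℂ) * (2 * Real.pi * Complex.I / ω k) = m * q) :
    barnesResidue ω y l k M = (ω k)⁻¹ * q ^ ((n : ℤ) - l - 1) * ((m : ℂ) ^ ((n : ℤ) - l - 1) *
      (Complex.exp (y * (m * (ω k * q + ∑ j ∈ Finset.univ.erase k, ω j * q))) *
        ∏ j ∈ Finset.univ.erase k, 1 / (Complex.exp (m * (ω j * q)) - 1))) := by
  have h1 : Complex.exp (y * (m * (ω k * q + ∑ j ∈ Finset.univ.erase k, ω j * q))) =
      Complex.exp (y * ω k * (m * q)) *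
        ∏ j ∈ Finset.univ.erase k, Complex.exp (y * ω j * (m * q)) := by
    rw [← Complex.exp_sum, ← Complex.exp_add, mul_add, mul_add, Finset.mul_sum, Finset.mul_sum]
    congr 2
    · ring
    · exact Finset.sum_congr rfl fun j _ => by ring
  rw [barnesResidue, hM, mul_zpow, h1]
  have h2 : ∏ j ∈ Finset.univ.erase k, Complex.exp (y * ω j * (m * q)) /
      (Complex.exp (ω j * (m * q)) - 1) =
      (∏ j ∈ Finset.univ.erase k, Complex.exp (y * ω j * (m * q))) *
        ∏ j ∈ Finset.univ.erase k, 1 / (Complex.exp (m * (ω j * q)) - 1) := by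
    rw [← Finset.prod_mul_distrib]
    exact Finset.prod_congr rfl fun j _ => by rw [mul_one_div, mul_left_comm (ω j)]
  rw [h2]
  ring

theorem ray_sum_barnes {n : ℕ} (hn : 2 ≤ n) {ω : Fin n → ℂ} (hω : ∀ j, ω j ≠ 0)
    (him : ∀ j k, j ≠ k → (ω j / ω k).im ≠ 0) {l : ℤ} (hl : l ≠ n) (k : Fin n) {σ : ℤ}
    (hσ : σ = 1 ∨ σ = -1) {q : ℂ} (hq : q = σ * (2 * Real.pi * Complex.I / ω k)) :
    (Summable fun m : ℕ+ => q ^ ((n : ℤ) - l - 1) * ((m : ℂ) ^ ((n : ℤ) - l - 1) *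
      (∏ j ∈ Finset.univ.erase k, 1 / (Complex.exp (m * (ω j * q)) - 1) -
        prodLimit (Finset.univ.erase k) fun j => ω j * q))) ∧
    (∀ y : ℝ, 0 < y → y ≤ 1 / 2 → Summable fun m : ℕ+ => barnesResidue ω y l k (σ * m)) ∧
    ∃ D : ℂ, ((n : ℤ) - l - 1 < 0 → D = 0) ∧ Filter.Tendsto
      (fun y : ℝ => (∑' m : ℕ+, barnesResidue ω y l k (σ * m)) - D * (y : ℂ) ^ (l - n))
      (nhdsWithin 0 (Set.Ioi 0))
      (nhds ((ω k)⁻¹ * ((∑' m : ℕ+, q ^ ((n : ℤ) - l - 1) * ((m : ℂ) ^ ((n : ℤ) - l - 1) *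
        (∏ j ∈ Finset.univ.erase k, 1 / (Complex.exp (m * (ω j * q)) - 1) -
          prodLimit (Finset.univ.erase k) fun j => ω j * q))) +
        prodLimit (Finset.univ.erase k) (fun j => ω j * q) * q ^ ((n : ℤ) - l - 1) *
          riemannZeta (1 - n + l)))) := by
  have hre : ∀ j, (ω j * q).re = -σ * (2 * Real.pi) * (ω j / ω k).im := by
    intro j
    rw [hq, mul_left_comm, ← Complex.ofReal_intCast, Complex.re_ofReal_mul, re_mul_two_pi_I_div]
    ring
  have hσ0 : (σ : ℝ) ≠ 0 := by rcases hσ with rfl | rfl <;> simp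
  have hu : (ω k * q).re = 0 := by rw [hre, div_self (hω k)]; simp
  have hx : ∀ j ∈ Finset.univ.erase k, (ω j * q).re ≠ 0 := by
    intro j hj
    rw [hre]
    have := him j k (Finset.ne_of_mem_erase hj)
    exact mul_ne_zero (mul_ne_zero (neg_ne_zero.mpr hσ0) Real.two_pi_pos.ne') this
  have hJ : (Finset.univ.erase k).Nonempty := by
    rw [← Finset.card_pos, Finset.card_erase_of_mem (Finset.mem_univ k), Finset.card_univ,
      Fintype.card_fin]
    omega
  obtain ⟨h1, h2, D, hD, h3⟩ := ray_sum (Finset.univ.erase k) (fun j => ω j * q) hx hJ hu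
    (p := (n : ℤ) - l - 1) (by omega)
  have hR : ∀ (y : ℝ) (m : ℕ+), barnesResidue ω y l k (σ * m) = _ := fun y m =>
    barnesResidue_eq ω y l k m (M := σ * m) (q := q) (by rw [hq]; push_cast; ring)
  refine ⟨h1.mul_left _, fun y hy0 hy1 => ?_, (ω k)⁻¹ * q ^ ((n : ℤ) - l - 1) * D,
    fun h => by rw [hD h, mul_zero], ?_⟩
  · simp_rw [hR]
    exact (h2 y hy0 hy1).mul_left _
  · simp_rw [hR, tsum_mul_left]
    have h4 := h3.const_mul ((ω k)⁻¹ * q ^ ((n : ℤ) - l - 1))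
    rw [show (-1 : ℤ) - (n - l - 1) = l - n by ring] at h4
    have hz : riemannZeta (-(((n : ℤ) - l - 1 : ℤ) : ℂ)) = riemannZeta (1 - n + l) := by
      congr 1; push_cast; ring
    rw [hz] at h4
    refine (h4.congr fun y => by ring).trans (le_of_eq ?_)
    congr 1
    ring

theorem summable_termPos {n : ℕ} (hn : 2 ≤ n) {ω : Fin n → ℂ} (hω : ∀ j, ω j ≠ 0)
    (him : ∀ j k, j ≠ k → (ω j / ω k).im ≠ 0) {l : ℤ} (hl : l ≠ n) (k : Fin n) :
    Summable (termPos ω l k) :=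
  (ray_sum_barnes hn hω him hl k (Or.inl rfl) (by simp)).1.congr fun m => (termPos_eq him l k m).symm

theorem summable_termNeg {n : ℕ} (hn : 2 ≤ n) {ω : Fin n → ℂ} (hω : ∀ j, ω j ≠ 0)
    (him : ∀ j k, j ≠ k → (ω j / ω k).im ≠ 0) {l : ℤ} (hl : l ≠ n) (k : Fin n) :
    Summable (termNeg ω l k) :=
  (ray_sum_barnes hn hω him hl k (Or.inr rfl) (by simp)).1.congr fun m => (termNeg_eq him l k m).symm

/-- Lets y → 0+ in `sum_tsum_barnesResidue`: both sides have limits once the accumulated singular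
coefficient D is known to be zero. -/
theorem regularizedSeries_eq_bernoulliSum {n : ℕ} (hn : 2 ≤ n) {ω : Fin n → ℂ}
    (hω : ∀ j, ω j ≠ 0) (him : ∀ j k, j ≠ k → (ω j / ω k).im ≠ 0) {l : ℤ} (hl : l ≠ n) :
    regularizedSeries ω l = bernoulliSum ω l := by
  have hpos := fun k => ray_sum_barnes hn hω him hl k (σ := 1) (Or.inl rfl)
    (q := 2 * Real.pi * Complex.I / ω k) (by simp)
  have hneg := fun k => ray_sum_barnes hn hω him hl k (σ := -1) (Or.inr rfl)
    (q := -(2 * Real.pi * Complex.I / ω k)) (by simp)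
  simp only [one_mul, ← termPos_eq him] at hpos
  simp only [prodLimit_eq_deltaJ_indexNeg him] at hpos
  simp only [neg_one_mul, ← termNeg_eq him] at hneg
  simp only [prodLimit_eq_deltaJ_indexPos him] at hneg
  choose _ hsp Dp hDp hlp using hpos
  choose _ hsn Dn hDn hln using hneg
  have hlim := tendsto_finsetSum Finset.univ fun k _ => (hlp k).add (hln k)
  set D := ∑ k, (Dp k + Dn k) with hD
  have hreg : ∑ k, ((ω k)⁻¹ * (∑' m : ℕ+, termPos ω l k m + deltaJ (indexNeg ω k) *
      (2 * Real.pi * Complex.I / ω k) ^ ((n : ℤ) - l - 1) * riemannZeta (1 - n + l)) +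
      (ω k)⁻¹ * (∑' m : ℕ+, termNeg ω l k m + deltaJ (indexPos ω k) *
      (-(2 * Real.pi * Complex.I / ω k)) ^ ((n : ℤ) - l - 1) * riemannZeta (1 - n + l))) =
      regularizedSeries ω l := by
    rw [regularizedSeries]
    refine Finset.sum_congr rfl fun k _ => ?_
    rw [show -2 * (Real.pi : ℂ) * Complex.I * (ω k)⁻¹ = -(2 * Real.pi * Complex.I / ω k) by ring,
      show 2 * (Real.pi : ℂ) * Complex.I * (ω k)⁻¹ = 2 * Real.pi * Complex.I / ω k by ring]
    ring
  rw [hreg] at hlim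
  have hlim2 : Filter.Tendsto (fun y : ℝ => -laurentCoeff ω y l - D * (y : ℂ) ^ (l - n))
      (nhdsWithin 0 (Set.Ioi 0)) (nhds (regularizedSeries ω l)) := by
    refine hlim.congr' ?_
    filter_upwards [Ioc_mem_nhdsGT (show (0 : ℝ) < 1 / 2 by norm_num)] with y hy
    rw [← sum_tsum_barnesResidue hn hω him hy.1 (by linarith [hy.2]) l
      (fun k => hsp k y hy.1 hy.2) (fun k => hsn k y hy.1 hy.2), hD, Finset.sum_mul,
      ← Finset.sum_sub_distrib]
    exact Finset.sum_congr rfl fun k _ => by ring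
  have hlaur : Filter.Tendsto (fun y : ℝ => -laurentCoeff ω y l) (nhdsWithin 0 (Set.Ioi 0))
      (nhds (bernoulliSum ω l)) := by
    have : Continuous fun y : ℝ => -laurentCoeff ω y l :=
      ((continuous_laurentCoeff ω l).comp Complex.continuous_ofReal).neg
    simpa [bernoulliSum_eq] using (this.tendsto 0).mono_left nhdsWithin_le_nhds
  -- For l < n, subtracting two convergent expressions shows that D y^{l-n} has a finite limit;
  -- multiplied by y^{n-l} → 0 it gives D = 0.
  have hD0 : D = 0 := by
    rcases lt_or_ge ((n : ℤ) - l - 1) 0 with h | h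
    · exact Finset.sum_eq_zero fun k _ => by rw [hDp k h, hDn k h, add_zero]
    · have h1 := hlaur.sub hlim2
      have h2 : Filter.Tendsto (fun y : ℝ => (y : ℂ) ^ (n - l).toNat) (nhdsWithin 0 (Set.Ioi 0))
          (nhds 0) := by
        have : Continuous fun y : ℝ => (y : ℂ) ^ (n - l).toNat := by fun_prop
        have h3 := (this.tendsto 0).mono_left (nhdsWithin_le_nhds (s := Set.Ioi 0))
        rwa [Complex.ofReal_zero, zero_pow (by omega)] at h3
      have h3 := h1.mul h2
      rw [mul_zero] at h3
      refine tendsto_nhds_unique (tendsto_const_nhds.congr' ?_) h3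
      filter_upwards [self_mem_nhdsWithin] with y hy
      have hy : (y : ℂ) ≠ 0 := by exact_mod_cast (ne_of_gt hy : y ≠ 0)
      rw [sub_sub_cancel, ← zpow_natCast, mul_assoc, ← zpow_add₀ hy, Int.toNat_of_nonneg (by omega)]
      simp
  rw [hD0] at hlim2
  simp only [zero_mul, sub_zero] at hlim2
  exact tendsto_nhds_unique hlim2 hlaur

/-! ### The Mellin integral of the Barnes series -/

theorem summable_norm_and_hasSum_prod {n : ℕ} (f : Fin n → ℕ → ℂ)
    (hf : ∀ j, Summable fun i => ‖f j i‖) :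
    (Summable fun m : Fin n → ℕ => ‖∏ j, f j (m j)‖) ∧
      HasSum (fun m : Fin n → ℕ => ∏ j, f j (m j)) (∏ j, ∑' i, f j i) := by
  suffices h : (Summable fun m : Fin n → ℕ => ‖∏ j, f j (m j)‖) ∧
      ∑' m : Fin n → ℕ, ∏ j, f j (m j) = ∏ j, ∑' i, f j i by
    exact ⟨h.1, h.2 ▸ h.1.of_norm.hasSum⟩
  induction n with
  | zero => simp [Summable.of_finite]
  | succ n ih =>
    obtain ⟨h1, h2⟩ := ih (fun j => f j.succ) fun j => hf j.succ
    let e := Fin.consEquiv (fun _ : Fin (n + 1) => ℕ)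
    have he : ∀ x : ℕ × (Fin n → ℕ), ∏ j, f j (e x j) = f 0 x.1 * ∏ j : Fin n, f j.succ (x.2 j) := by
      intro x
      rw [Fin.prod_univ_succ]
      simp [e, Fin.consEquiv]
    refine ⟨?_, ?_⟩
    · rw [← e.summable_iff]
      refine ((hf 0).mul_norm h1).congr fun x => ?_
      simp only [Function.comp, he]
    · rw [← e.tsum_eq]
      simp_rw [he]
      rw [← tsum_mul_tsum_of_summable_norm (hf 0) h1, h2, Fin.prod_univ_succ]

theorem integrableOn_rpow_mul_exp_neg {σ b : ℝ} (hσ : 0 < σ) (hb : 0 < b) :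
    MeasureTheory.IntegrableOn (fun t : ℝ => t ^ (σ - 1) * Real.exp (-b * t)) (Set.Ioi 0) := by
  exact integrableOn_rpow_mul_exp_neg_mul_rpow (p := 1) (s := σ - 1) (by linarith) one_pos hb
    |>.congr_fun (fun t _ => by simp) measurableSet_Ioi

theorem norm_cpow_mul_exp_neg {s x : ℂ} {t : ℝ} (ht : 0 < t) :
    ‖(t : ℂ) ^ (s - 1) * Complex.exp (-(x * t))‖ = t ^ (s.re - 1) * Real.exp (-x.re * t) := by
  rw [norm_mul, Complex.norm_cpow_eq_rpow_re_of_pos ht, Complex.norm_exp]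
  simp

theorem continuousOn_cpow_mul_exp_neg (s x : ℂ) :
    ContinuousOn (fun t : ℝ => (t : ℂ) ^ (s - 1) * Complex.exp (-(x * t))) (Set.Ioi 0) := by
  refine ContinuousOn.mul (fun t ht => ?_) (by fun_prop)
  have ht : 0 < t := ht
  exact (Complex.continuousAt_ofReal_cpow_const t (s - 1) (Or.inr ht.ne')).continuousWithinAt

theorem integrableOn_cpow_mul_exp_neg {s x : ℂ} (hs : 0 < s.re) (hx : 0 < x.re) :
    MeasureTheory.IntegrableOn (fun t : ℝ => (t : ℂ) ^ (s - 1) * Complex.exp (-(x * t)))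
      (Set.Ioi 0) := by
  refine (integrableOn_rpow_mul_exp_neg hs hx).mono'
    ((continuousOn_cpow_mul_exp_neg s x).aestronglyMeasurable measurableSet_Ioi) ?_
  filter_upwards [MeasureTheory.ae_restrict_mem measurableSet_Ioi] with t ht
  exact (norm_cpow_mul_exp_neg ht).le

theorem differentiableAt_integral_cpow_mul_exp_neg {s x : ℂ} (hs : 0 < s.re) (hx : 0 < x.re) :
    DifferentiableAt ℂ
      (fun x : ℂ => ∫ t : ℝ in Set.Ioi 0, (t : ℂ) ^ (s - 1) * Complex.exp (-(x * t))) x := by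
  have hnhds : {w : ℂ | x.re / 2 < w.re} ∈ nhds x :=
    (isOpen_lt continuous_const Complex.continuous_re).mem_nhds (by
      simp only [Set.mem_ofPred_eq]; linarith)
  have hb : 0 < x.re / 2 := by linarith
  refine (hasDerivAt_integral_of_dominated_loc_of_deriv_le (𝕜 := ℂ)
    (F := fun (x : ℂ) (t : ℝ) => (t : ℂ) ^ (s - 1) * Complex.exp (-(x * t)))
    (F' := fun (x : ℂ) (t : ℝ) => (t : ℂ) ^ (s - 1) * (Complex.exp (-(x * t)) * -t))
    (bound := fun t => t ^ (s.re + 1 - 1) * Real.exp (-(x.re / 2) * t)) hnhds ?_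
    (integrableOn_cpow_mul_exp_neg hs hx) ?_ ?_
    (integrableOn_rpow_mul_exp_neg (by linarith) hb) ?_).2.differentiableAt
  · exact Filter.Eventually.of_forall fun w =>
      (continuousOn_cpow_mul_exp_neg s w).aestronglyMeasurable measurableSet_Ioi
  · refine ContinuousOn.aestronglyMeasurable ?_ measurableSet_Ioi
    have h := (continuousOn_cpow_mul_exp_neg s x).mul
      (Complex.continuous_ofReal.neg.continuousOn (s := Set.Ioi (0 : ℝ)))
    refine h.congr fun t _ => ?_
    simp [mul_assoc]
  · filter_upwards [MeasureTheory.ae_restrict_mem measurableSet_Ioi] with t ht w hw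
    have ht : 0 < t := ht
    have hw : x.re / 2 < w.re := hw
    rw [← mul_assoc, norm_mul, norm_cpow_mul_exp_neg ht, norm_neg, Complex.norm_real,
      Real.norm_of_nonneg ht.le, mul_right_comm, ← Real.rpow_add_one ht.ne']
    rw [show s.re - 1 + 1 = s.re + 1 - 1 by ring]
    refine mul_le_mul_of_nonneg_left (Real.exp_le_exp.mpr ?_) (by positivity)
    nlinarith
  · filter_upwards with t w _
    refine HasDerivAt.const_mul _ ?_
    have h : HasDerivAt (fun w : ℂ => -(w * t)) (-(1 * t)) w := ((hasDerivAt_id w).mul_const (t : ℂ)).neg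
    simpa using h.cexp

/-- Both sides are analytic in x on the right half plane and agree for real x > 0 by Euler's
integral, so the identity theorem applies. -/
theorem integral_cpow_mul_exp_neg {s x : ℂ} (hs : 0 < s.re) (hx : 0 < x.re) :
    ∫ t : ℝ in Set.Ioi 0, (t : ℂ) ^ (s - 1) * Complex.exp (-(x * t)) =
      Complex.Gamma s * Complex.exp (-s * Complex.log x) := by
  set U : Set ℂ := {w : ℂ | 0 < w.re} with hU
  have hUo : IsOpen U := isOpen_lt continuous_const Complex.continuous_re
  have hf : AnalyticOnNhd ℂ
      (fun x : ℂ => ∫ t : ℝ in Set.Ioi 0, (t : ℂ) ^ (s - 1) * Complex.exp (-(x * t))) U :=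
    DifferentiableOn.analyticOnNhd (fun w hw =>
      (differentiableAt_integral_cpow_mul_exp_neg hs hw).differentiableWithinAt) hUo
  have hg : AnalyticOnNhd ℂ (fun x : ℂ => Complex.Gamma s * Complex.exp (-s * Complex.log x)) U := by
    refine DifferentiableOn.analyticOnNhd (fun w hw => ?_) hUo
    have : w ∈ Complex.slitPlane := Or.inl hw
    exact (((Complex.differentiableAt_log this).const_mul (-s)).cexp.const_mul
      _).differentiableWithinAt
  refine hf.eqOn_of_preconnected_of_frequently_eq hg (z₀ := 1)
    (convex_halfSpace_re_gt 0).isPreconnected (by simp [hU]) ?_ hx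
  have hreal : ∀ r : ℝ, 0 < r →
      ∫ t : ℝ in Set.Ioi 0, (t : ℂ) ^ (s - 1) * Complex.exp (-((r : ℂ) * t)) =
        Complex.Gamma s * Complex.exp (-s * Complex.log r) := by
    intro r hr
    have hr0 : (r : ℂ) ≠ 0 := by exact_mod_cast hr.ne'
    have harg : (r : ℂ).arg ≠ Real.pi := by
      rw [Complex.arg_ofReal_of_nonneg hr.le]; exact Real.pi_pos.ne
    rw [Complex.integral_cpow_mul_exp_neg_mul_Ioi hs hr, mul_comm, one_div,
      Complex.inv_cpow _ _ harg, ← Complex.cpow_neg, Complex.cpow_def_of_ne_zero hr0,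
      mul_comm (Complex.log r)]
  -- A sequence of real points accumulating at 1 without meeting it.
  have htend : Filter.Tendsto (fun k : ℕ => ((1 + 1 / ((k : ℝ) + 1) : ℝ) : ℂ)) Filter.atTop
      (nhdsWithin 1 {1}ᶜ) := by
    rw [tendsto_nhdsWithin_iff]
    refine ⟨?_, Filter.Eventually.of_forall fun k => ?_⟩
    · have h1 : Filter.Tendsto (fun k : ℕ => (1 + 1 / ((k : ℝ) + 1) : ℝ)) Filter.atTop (nhds (1 + 0)) :=
        tendsto_const_nhds.add tendsto_one_div_add_atTop_nhds_zero_nat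
      have h2 := (Complex.continuous_ofReal.tendsto _).comp h1
      rwa [add_zero, Complex.ofReal_one] at h2
    · have : (0 : ℝ) < 1 / ((k : ℝ) + 1) := by positivity
      have h2 : (1 + 1 / ((k : ℝ) + 1) : ℝ) ≠ 1 := by linarith
      exact fun h => h2 (Complex.ofReal_eq_one.mp h)
  exact htend.frequently (Filter.Frequently.of_forall fun k => hreal _ (by positivity))

/-- The function `∏_j 1 / (e^{ν_j t} - 1)` of a real variable. -/
def barnesGen {n : ℕ} (ν : Fin n → ℂ) (t : ℝ) : ℂ := ∏ j, 1 / (Complex.exp (ν j * t) - 1)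

/-- The summation starts at e^{-νt}, not at 1, which is why the shift a(0) yields exactly 1/(e^{νt}
- 1) with no exponential in the numerator. -/
theorem hasSum_exp_neg_mul {ν : ℂ} (hν : 0 < ν.re) {t : ℝ} (ht : 0 < t) :
    (Summable fun i : ℕ => ‖Complex.exp (-(ν * (i + 1) * t))‖) ∧
      ∑' i : ℕ, Complex.exp (-(ν * (i + 1) * t)) = 1 / (Complex.exp (ν * t) - 1) := by
  have hlt : ‖Complex.exp (-(ν * t))‖ < 1 := by
    rw [Complex.norm_exp, Real.exp_lt_one_iff, Complex.neg_re, Complex.re_mul_ofReal]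
    nlinarith
  have h : ∀ i : ℕ, Complex.exp (-(ν * (i + 1) * t)) =
      Complex.exp (-(ν * t)) * Complex.exp (-(ν * t)) ^ i := by
    intro i
    rw [← Complex.exp_nat_mul, ← Complex.exp_add]
    congr 1; ring
  simp_rw [h]
  refine ⟨?_, ?_⟩
  · simp_rw [norm_mul, norm_pow]
    exact (summable_geometric_of_lt_one (norm_nonneg _) hlt).mul_left _
  · rw [tsum_mul_left, tsum_geometric_of_norm_lt_one hlt, Complex.exp_neg]
    have h0 := Complex.exp_ne_zero (ν * t)
    have h1 : Complex.exp (ν * t) - 1 ≠ 0 := by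
      apply exp_sub_one_ne_zero_of_re_ne_zero
      rw [Complex.re_mul_ofReal]
      positivity
    have h2 : 1 - (Complex.exp (ν * t))⁻¹ ≠ 0 := by
      intro h
      apply h1
      have := congrArg (· * Complex.exp (ν * t)) h
      simpa [sub_mul, h0] using this
    field_simp

theorem hasSum_exp_neg_sum_mul {n : ℕ} {ν : Fin n → ℂ} (hν : ∀ j, 0 < (ν j).re) {t : ℝ}
    (ht : 0 < t) : HasSum (fun m : Fin n → ℕ => Complex.exp (-((∑ j, ν j * (m j + 1)) * t)))
      (barnesGen ν t) := by
  have h := (summable_norm_and_hasSum_prod (fun j (i : ℕ) => Complex.exp (-(ν j * (i + 1) * t)))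
    fun j => (hasSum_exp_neg_mul (hν j) ht).1).2
  simp_rw [(hasSum_exp_neg_mul (hν _) ht).2, ← Complex.exp_sum] at h
  refine h.congr_fun fun m => ?_
  rw [Finset.sum_neg_distrib, Finset.sum_mul]

/-- With S = ∑(m_j + 1) one has ∏(m_j + 1) ≤ S^n, so S^{-σ} ≤ ∏(m_j + 1)^{-σ/n}, a product of
one-variable series that converge because σ/n > 1. -/
theorem summable_sum_rpow_neg {n : ℕ} (hn : n ≠ 0) {b : Fin n → ℝ} (hb : ∀ j, 0 < b j) {σ : ℝ}
    (hσ : n < σ) : Summable fun m : Fin n → ℕ => (∑ j, b j * ((m j : ℝ) + 1)) ^ (-σ) := by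
  have hn0 : (0 : ℝ) < n := by positivity
  have hσ0 : 0 < σ := hn0.trans hσ
  have hne : (Finset.univ : Finset (Fin n)).Nonempty := ⟨⟨0, by omega⟩, Finset.mem_univ _⟩
  obtain ⟨j₀, -, hj₀⟩ := Finset.exists_min_image Finset.univ b hne
  set c := b j₀ with hc
  have hc0 : 0 < c := hb j₀
  have hs : Summable fun i : ℕ => ‖((((i : ℝ) + 1) ^ (-(σ / n)) : ℝ) : ℂ)‖ := by
    have h1 : 1 < σ / n := by rwa [one_lt_div hn0]
    have := (summable_nat_add_iff 1).mpr (Real.summable_nat_rpow.mpr (show -(σ / n) < -1 by linarith))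
    refine this.congr fun i => ?_
    rw [Complex.norm_real, Real.norm_of_nonneg (by positivity)]
    push_cast; rfl
  have h := ((summable_norm_and_hasSum_prod
    (fun (_ : Fin n) (i : ℕ) => ((((i : ℝ) + 1) ^ (-(σ / n)) : ℝ) : ℂ)) fun _ => hs).1).mul_left
      (c ^ (-σ))
  refine Summable.of_nonneg_of_le (fun m => ?_) (fun m => ?_) h
  · exact Real.rpow_nonneg (Finset.sum_nonneg fun j _ => by have := hb j; positivity) _
  · set S : ℝ := ∑ j, ((m j : ℝ) + 1) with hS
    have hS0 : 0 < S := Finset.sum_pos (fun j _ => by positivity) hne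
    have h1 : c * S ≤ ∑ j, b j * ((m j : ℝ) + 1) := by
      rw [hS, Finset.mul_sum]
      exact Finset.sum_le_sum fun j _ =>
        mul_le_mul_of_nonneg_right (hj₀ j (Finset.mem_univ j)) (by positivity)
    have h2 : ∏ j, ((m j : ℝ) + 1) ≤ S ^ n := by
      calc ∏ j, ((m j : ℝ) + 1) ≤ ∏ _j : Fin n, S :=
            Finset.prod_le_prod (fun j _ => by positivity) fun j _ =>
              Finset.single_le_sum (f := fun j => (m j : ℝ) + 1) (fun i _ => by positivity)
                (Finset.mem_univ j)
        _ = S ^ n := by simp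
    have h3 : ‖∏ j, ((((m j : ℝ) + 1) ^ (-(σ / n)) : ℝ) : ℂ)‖ =
        (∏ j, ((m j : ℝ) + 1)) ^ (-(σ / n)) := by
      rw [← Complex.ofReal_prod, Complex.norm_real, Real.norm_of_nonneg
        (Finset.prod_nonneg fun j _ => by positivity),
        Real.finsetProd_rpow _ _ fun j _ => by positivity]
    rw [h3]
    calc (∑ j, b j * ((m j : ℝ) + 1)) ^ (-σ) ≤ (c * S) ^ (-σ) :=
          Real.rpow_le_rpow_of_nonpos (by positivity) h1 (by linarith)
      _ = c ^ (-σ) * (S ^ n) ^ (-(σ / n)) := by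
          rw [Real.mul_rpow hc0.le hS0.le, ← Real.rpow_natCast, ← Real.rpow_mul hS0.le]
          congr 2; field_simp
      _ ≤ _ := by
          refine mul_le_mul_of_nonneg_left ?_ (by positivity)
          exact Real.rpow_le_rpow_of_nonpos (Finset.prod_pos fun j _ => by positivity) h2
            (neg_nonpos.mpr (by positivity))

theorem hasSum_Gamma_mul_exp {n : ℕ} (hn : n ≠ 0) {ν : Fin n → ℂ} (hν : ∀ j, 0 < (ν j).re) {s : ℂ}
    (hs : n < s.re) : HasSum (fun m : Fin n → ℕ => Complex.Gamma s *
      Complex.exp (-s * Complex.log (∑ j, ν j * (m j + 1)))) (mellin (barnesGen ν) s) := by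
  have hs0 : 0 < s.re := lt_of_le_of_lt (Nat.cast_nonneg n) hs
  have hne : (Finset.univ : Finset (Fin n)).Nonempty := ⟨⟨0, by omega⟩, Finset.mem_univ _⟩
  have hre : ∀ m : Fin n → ℕ, (∑ j, ν j * (m j + 1)).re = ∑ j, (ν j).re * ((m j : ℝ) + 1) := by
    intro m
    rw [Complex.re_sum]
    refine Finset.sum_congr rfl fun j _ => ?_
    rw [← Complex.re_mul_ofReal]
    push_cast; rfl
  have hpos : ∀ m : Fin n → ℕ, 0 < (∑ j, ν j * (m j + 1)).re := by
    intro m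
    rw [hre]
    exact Finset.sum_pos (fun j _ => mul_pos (hν j) (by positivity)) hne
  have key := MeasureTheory.hasSum_integral_of_summable_integral_norm
    (μ := MeasureTheory.volume.restrict (Set.Ioi (0 : ℝ)))
    (F := fun (m : Fin n → ℕ) (t : ℝ) =>
      (t : ℂ) ^ (s - 1) * Complex.exp (-((∑ j, ν j * (m j + 1)) * t)))
    (fun m => integrableOn_cpow_mul_exp_neg hs0 (hpos m)) ?_
  · simp_rw [integral_cpow_mul_exp_neg hs0 (hpos _)] at key
    convert! key using 1
    refine MeasureTheory.setIntegral_congr_fun measurableSet_Ioi fun t ht => ?_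
    simp only [smul_eq_mul]
    rw [tsum_mul_left, (hasSum_exp_neg_sum_mul hν ht).tsum_eq]
  -- The integral of the norm is again a Gamma integral, with Re s and the real part of the linear
  -- form; this justifies exchanging sum and integral.
  · refine ((summable_sum_rpow_neg hn hν hs).mul_right (Real.Gamma s.re)).congr fun m => ?_
    rw [← hre]
    have h1 := Real.integral_rpow_mul_exp_neg_mul_Ioi hs0 (hpos m)
    rw [one_div, Real.inv_rpow (hpos m).le, ← Real.rpow_neg (hpos m).le] at h1
    rw [← h1]
    refine MeasureTheory.setIntegral_congr_fun measurableSet_Ioi fun t ht => ?_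
    rw [norm_cpow_mul_exp_neg ht, neg_mul]

/-! ### Continuation of the Mellin transform -/

theorem barnesGen_eq {n : ℕ} (ν : Fin n → ℂ) {t : ℝ} (ht : t ≠ 0) :
    (∏ j, bernoulliGen 0 (ν j)) t = (t : ℂ) ^ n * barnesGen ν t := by
  have ht' : (t : ℂ) ≠ 0 := by exact_mod_cast ht
  rw [Finset.prod_apply, Finset.prod_congr rfl fun j _ => bernoulliGen_of_ne 0 (ν j) ht',
    Finset.prod_mul_distrib, barnesGen]
  simp

theorem continuousOn_barnesGen {n : ℕ} {ν : Fin n → ℂ} (hν : ∀ j, 0 < (ν j).re) :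
    ContinuousOn (barnesGen ν) (Set.Ioi 0) := by
  unfold barnesGen
  refine continuousOn_finsetProd _ fun j _ => ContinuousOn.div (by fun_prop) (by fun_prop) ?_
  intro t ht
  have ht : 0 < t := ht
  apply exp_sub_one_ne_zero_of_re_ne_zero
  rw [Complex.re_mul_ofReal]
  exact (mul_pos (hν j) ht).ne'

theorem isBigO_one_div_exp_sub_one {ν : ℂ} (hν : 0 < ν.re) :
    (fun t : ℝ => 1 / (Complex.exp (ν * t) - 1)) =O[Filter.atTop] fun t => Real.exp (-ν.re * t) := by
  refine Asymptotics.IsBigO.of_bound 2 ?_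
  have h : Filter.Tendsto (fun t : ℝ => Real.exp (ν.re * t)) Filter.atTop Filter.atTop :=
    Real.tendsto_exp_atTop.comp (Filter.tendsto_id.const_mul_atTop hν)
  filter_upwards [h.eventually_ge_atTop 2] with t ht
  have h1 := norm_sub_norm_le (Complex.exp (ν * t)) 1
  rw [Complex.norm_exp, Complex.re_mul_ofReal, norm_one] at h1
  have h2 : Real.exp (ν.re * t) / 2 ≤ ‖Complex.exp (ν * t) - 1‖ := by linarith
  rw [norm_div, norm_one, Real.norm_of_nonneg (Real.exp_pos _).le, neg_mul, Real.exp_neg]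
  calc 1 / ‖Complex.exp (ν * t) - 1‖ ≤ 1 / (Real.exp (ν.re * t) / 2) :=
        one_div_le_one_div_of_le (by positivity) h2
    _ = _ := by field_simp

theorem isBigO_barnesGen_atTop {n : ℕ} {ν : Fin n → ℂ} (hν : ∀ j, 0 < (ν j).re) :
    barnesGen ν =O[Filter.atTop] fun t => Real.exp (-(∑ j, (ν j).re) * t) := by
  have h := Asymptotics.IsBigO.finsetProd (s := Finset.univ)
    fun j _ => isBigO_one_div_exp_sub_one (hν j)
  refine h.congr (fun t => rfl) fun t => ?_
  rw [← Real.exp_sum, ← Finset.sum_mul, Finset.sum_neg_distrib]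

/-- The function `∏_j 1 / (e^{ν_j t} - 1)` with the first `K` terms of its expansion at `0` removed on
`(0, 1]`. -/
def barnesGenRem {n : ℕ} (ν : Fin n → ℂ) (K : ℕ) (t : ℝ) : ℂ :=
  barnesGen ν t - ∑ k ∈ Finset.range K,
    laurentCoeff ν 0 k * (Set.Ioc 0 1).indicator (fun t : ℝ => (t : ℂ) ^ ((k : ℂ) - n)) t

theorem barnesGenRem_succ {n : ℕ} (ν : Fin n → ℂ) (K : ℕ) (t : ℝ) :
    barnesGenRem ν (K + 1) t = barnesGenRem ν K t - laurentCoeff ν 0 K *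
      (Set.Ioc 0 1).indicator (fun t : ℝ => (t : ℂ) ^ ((K : ℂ) - n)) t := by
  rw [barnesGenRem, barnesGenRem, Finset.sum_range_succ]
  ring

theorem barnesGenRem_zero {n : ℕ} (ν : Fin n → ℂ) : barnesGenRem ν 0 = barnesGen ν := by
  funext t
  simp [barnesGenRem]

theorem locallyIntegrableOn_barnesGenRem {n : ℕ} {ν : Fin n → ℂ} (hν : ∀ j, 0 < (ν j).re) (K : ℕ) :
    MeasureTheory.LocallyIntegrableOn (barnesGenRem ν K) (Set.Ioi 0) := by
  induction K with
  | zero =>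
    rw [barnesGenRem_zero]
    exact (continuousOn_barnesGen hν).locallyIntegrableOn measurableSet_Ioi
  | succ K ih =>
    have hpow : ContinuousOn (fun t : ℝ => (t : ℂ) ^ ((K : ℂ) - n)) (Set.Ioi 0) := fun t ht =>
      (Complex.continuousAt_ofReal_cpow_const t _ (Or.inr (ne_of_gt ht))).continuousWithinAt
    have hind : MeasureTheory.LocallyIntegrableOn (fun t : ℝ => laurentCoeff ν 0 K *
        (Set.Ioc 0 1).indicator (fun t : ℝ => (t : ℂ) ^ ((K : ℂ) - n)) t) (Set.Ioi 0) := by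
      intro x hx
      obtain ⟨U, hU, hint⟩ := (hpow.locallyIntegrableOn (μ := MeasureTheory.volume)
        measurableSet_Ioi) x hx
      exact ⟨U, hU, (MeasureTheory.Integrable.indicator hint measurableSet_Ioc).const_mul _⟩
    rw [show barnesGenRem ν (K + 1) = _ from funext (barnesGenRem_succ ν K)]
    exact ih.sub hind

theorem isBigO_barnesGenRem_atTop {n : ℕ} {ν : Fin n → ℂ} (hν : ∀ j, 0 < (ν j).re) (K : ℕ) :
    barnesGenRem ν K =O[Filter.atTop] fun t => Real.exp (-(∑ j, (ν j).re) * t) := by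
  refine (isBigO_barnesGen_atTop hν).congr' ?_ Filter.EventuallyEq.rfl
  filter_upwards [Filter.eventually_gt_atTop 1] with t ht
  rw [barnesGenRem, Finset.sum_eq_zero, sub_zero]
  intro k _
  rw [Set.indicator_of_notMem (by simp [ht]), mul_zero]

/-- On (0, 1] what is left is t^{K-n} times the analytic Taylor remainder of t^n ∏_j 1/(e^{ν_j t} -
1). Each removed term thus widens the half plane of convergence by one, while the truncation to (0,
1] leaves the decay at infinity intact. -/
theorem isBigO_barnesGenRem_zero {n : ℕ} {ν : Fin n → ℂ} (hν : ∀ j, 0 < (ν j).re) (K : ℕ) :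
    barnesGenRem ν K =O[nhdsWithin 0 (Set.Ioi 0)] fun t => t ^ (-((n : ℝ) - K)) := by
  have hν0 : ∀ j, ν j ≠ 0 := fun j h => by have := hν j; rw [h] at this; simp at this
  obtain ⟨g, hg, h⟩ := exists_taylor_remainder (f := ∏ j, bernoulliGen 0 (ν j))
    (Finset.analyticAt_prod _ fun j _ => analyticAt_bernoulliGen 0 (hν0 j)) K
  have hgO : (fun t : ℝ => g t) =O[nhdsWithin 0 (Set.Ioi 0)] fun _ => (1 : ℝ) := by
    have h1 : Filter.Tendsto (fun t : ℝ => (t : ℂ)) (nhdsWithin 0 (Set.Ioi 0)) (nhds 0) := by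
      simpa using (Complex.continuous_ofReal.tendsto 0).mono_left nhdsWithin_le_nhds
    exact (hg.continuousAt.tendsto.comp h1).isBigO_one ℝ
  have hpO : (fun t : ℝ => (t : ℂ) ^ ((K : ℂ) - n)) =O[nhdsWithin 0 (Set.Ioi 0)]
      fun t => t ^ (-((n : ℝ) - K)) := by
    refine Asymptotics.IsBigO.of_bound 1 ?_
    filter_upwards [self_mem_nhdsWithin] with t ht
    have ht : 0 < t := ht
    rw [Complex.norm_cpow_eq_rpow_re_of_pos ht, one_mul, Real.norm_of_nonneg (by positivity)]
    simp
  have hprod := hpO.mul hgO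
  simp only [mul_one] at hprod
  refine hprod.congr' ?_ Filter.EventuallyEq.rfl
  filter_upwards [Ioc_mem_nhdsGT (zero_lt_one (α := ℝ))] with t ht
  have ht0 : (t : ℂ) ≠ 0 := by exact_mod_cast ht.1.ne'
  have hpow : ∀ k : ℕ, (t : ℂ) ^ ((k : ℂ) - n) = (t : ℂ) ^ k / (t : ℂ) ^ n := fun k => by
    rw [Complex.cpow_sub _ _ ht0, Complex.cpow_natCast, Complex.cpow_natCast]
  have h1 := h t
  rw [barnesGen_eq ν ht.1.ne'] at h1
  simp only [coeff_taylorPS_prod_bernoulliGen hν0] at h1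
  have h2 : barnesGen ν t = (∑ k ∈ Finset.range K, laurentCoeff ν 0 k * (t : ℂ) ^ k +
      (t : ℂ) ^ K * g t) / (t : ℂ) ^ n := by
    rw [eq_div_iff (pow_ne_zero _ ht0), mul_comm, h1]
  rw [barnesGenRem, h2, hpow, add_div, Finset.sum_div]
  have h3 : ∀ k ∈ Finset.range K, laurentCoeff ν 0 k *
      (Set.Ioc 0 1).indicator (fun t : ℝ => (t : ℂ) ^ ((k : ℂ) - n)) t =
      laurentCoeff ν 0 k * (t : ℂ) ^ k / (t : ℂ) ^ n := by
    intro k _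
    rw [Set.indicator_of_mem ht, hpow, mul_div_assoc]
  rw [Finset.sum_congr rfl h3]
  ring

theorem sum_re_pos {n : ℕ} (hn : n ≠ 0) {ν : Fin n → ℂ} (hν : ∀ j, 0 < (ν j).re) :
    0 < ∑ j, (ν j).re :=
  Finset.sum_pos (fun j _ => hν j) ⟨⟨0, by omega⟩, Finset.mem_univ _⟩

theorem mellinConvergent_barnesGenRem {n : ℕ} (hn : n ≠ 0) {ν : Fin n → ℂ}
    (hν : ∀ j, 0 < (ν j).re) (K : ℕ) {s : ℂ} (hs : (n : ℝ) - K < s.re) :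
    MellinConvergent (barnesGenRem ν K) s :=
  mellinConvergent_of_isBigO_rpow_exp (sum_re_pos hn hν) (locallyIntegrableOn_barnesGenRem hν K)
    (isBigO_barnesGenRem_atTop hν K) (isBigO_barnesGenRem_zero hν K) hs

theorem differentiableAt_mellin_barnesGenRem {n : ℕ} (hn : n ≠ 0) {ν : Fin n → ℂ}
    (hν : ∀ j, 0 < (ν j).re) (K : ℕ) {s : ℂ} (hs : (n : ℝ) - K < s.re) :
    DifferentiableAt ℂ (mellin (barnesGenRem ν K)) s :=
  mellin_differentiableAt_of_isBigO_rpow_exp (sum_re_pos hn hν)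
    (locallyIntegrableOn_barnesGenRem hν K) (isBigO_barnesGenRem_atTop hν K)
    (isBigO_barnesGenRem_zero hν K) hs

/-- The continuation of the Mellin transform of `barnesGen ν` to `Re s > n - K`. -/
def mellinContAux {n : ℕ} (ν : Fin n → ℂ) (K : ℕ) (s : ℂ) : ℂ :=
  mellin (barnesGenRem ν K) s + ∑ k ∈ Finset.range K, laurentCoeff ν 0 k / (s + ((k : ℂ) - n))

/-- The removed term has Mellin transform ∫_0^1 t^{s-1+K-n} dt = 1/(s + K - n), which the finite sum
puts back. -/
theorem mellinContAux_succ {n : ℕ} (hn : n ≠ 0) {ν : Fin n → ℂ} (hν : ∀ j, 0 < (ν j).re) (K : ℕ)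
    {s : ℂ} (hs : (n : ℝ) - K < s.re) : mellinContAux ν (K + 1) s = mellinContAux ν K s := by
  have h1 := hasMellin_cpow_Ioc ((K : ℂ) - n) (s := s) (by simp; linarith)
  have h2 := hasMellin_sub (mellinConvergent_barnesGenRem hn hν K hs)
    (h1.1.const_smul (laurentCoeff ν 0 K))
  have h3 : barnesGenRem ν (K + 1) = fun t => barnesGenRem ν K t - laurentCoeff ν 0 K •
      (Set.Ioc 0 1).indicator (fun t : ℝ => (t : ℂ) ^ ((K : ℂ) - n)) t :=
    funext (barnesGenRem_succ ν K)
  rw [mellinContAux, h3, h2.2, mellin_const_smul, h1.2, mellinContAux, Finset.sum_range_succ,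
    smul_eq_mul]
  ring

theorem mellinContAux_eq {n : ℕ} (hn : n ≠ 0) {ν : Fin n → ℂ} (hν : ∀ j, 0 < (ν j).re) {K K' : ℕ}
    (hK : K ≤ K') {s : ℂ} (hs : (n : ℝ) - K < s.re) :
    mellinContAux ν K' s = mellinContAux ν K s := by
  induction K', hK using Nat.le_induction with
  | base => rfl
  | succ K' hK ih =>
    have : (K : ℝ) ≤ K' := by exact_mod_cast hK
    rw [mellinContAux_succ hn hν K' (by linarith), ih]

/-- The meromorphic continuation of the Mellin transform of `barnesGen ν`. -/
def mellinCont {n : ℕ} (ν : Fin n → ℂ) (s : ℂ) : ℂ :=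
  mellinContAux ν (⌊|(n : ℝ) - s.re|⌋₊ + 1) s

/-- The cutoff ⌊|n - Re s|⌋ + 1 in the definition depends on s; independence of K lets a fixed K be
used near a given point, which is what analyticity requires. -/
theorem mellinCont_eq {n : ℕ} (hn : n ≠ 0) {ν : Fin n → ℂ} (hν : ∀ j, 0 < (ν j).re) (K : ℕ) {s : ℂ}
    (hs : (n : ℝ) - K < s.re) : mellinCont ν s = mellinContAux ν K s := by
  have h1 := Nat.lt_floor_add_one |(n : ℝ) - s.re|
  have h2 := le_abs_self ((n : ℝ) - s.re)
  rw [mellinCont]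
  rcases le_total K (⌊|(n : ℝ) - s.re|⌋₊ + 1) with h | h
  · exact mellinContAux_eq hn hν h hs
  · exact (mellinContAux_eq hn hν h (by push_cast; linarith)).symm

theorem mellinCont_eq_mellin {n : ℕ} (hn : n ≠ 0) {ν : Fin n → ℂ} (hν : ∀ j, 0 < (ν j).re) {s : ℂ}
    (hs : n < s.re) : mellinCont ν s = mellin (barnesGen ν) s := by
  rw [mellinCont_eq hn hν 0 (by simpa using hs), mellinContAux, barnesGenRem_zero]
  simp

theorem exists_nat_sub_lt (n : ℕ) (x : ℝ) (L : ℤ) : ∃ K : ℕ, (n : ℝ) - K < x ∧ L < K := by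
  obtain ⟨K, hK⟩ := exists_nat_gt (max ((n : ℝ) - x) L)
  refine ⟨K, by linarith [le_max_left ((n : ℝ) - x) L], ?_⟩
  exact_mod_cast (le_max_right ((n : ℝ) - x) L).trans_lt hK

theorem eventually_mellinCont_eq {n : ℕ} (hn : n ≠ 0) {ν : Fin n → ℂ} (hν : ∀ j, 0 < (ν j).re)
    {K : ℕ} {s : ℂ} (hs : (n : ℝ) - K < s.re) : mellinCont ν =ᶠ[nhds s] mellinContAux ν K := by
  filter_upwards [(isOpen_lt continuous_const Complex.continuous_re).mem_nhds hs] with w hw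
  exact mellinCont_eq hn hν K hw

theorem analyticAt_mellin_barnesGenRem {n : ℕ} (hn : n ≠ 0) {ν : Fin n → ℂ}
    (hν : ∀ j, 0 < (ν j).re) {K : ℕ} {s : ℂ} (hs : (n : ℝ) - K < s.re) :
    AnalyticAt ℂ (mellin (barnesGenRem ν K)) s := by
  have hU : IsOpen {w : ℂ | (n : ℝ) - K < w.re} := isOpen_lt continuous_const Complex.continuous_re
  exact DifferentiableOn.analyticAt (fun w hw =>
    (differentiableAt_mellin_barnesGenRem hn hν K hw).differentiableWithinAt) (hU.mem_nhds hs)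

theorem meromorphicAt_mellinCont {n : ℕ} (hn : n ≠ 0) {ν : Fin n → ℂ} (hν : ∀ j, 0 < (ν j).re)
    (s : ℂ) : MeromorphicAt (mellinCont ν) s := by
  obtain ⟨K, hK, -⟩ := exists_nat_sub_lt n s.re 0
  refine MeromorphicAt.congr ?_
    ((eventually_mellinCont_eq hn hν hK).filter_mono nhdsWithin_le_nhds).symm
  refine (analyticAt_mellin_barnesGenRem hn hν hK).meromorphicAt.add ?_
  exact MeromorphicAt.fun_sum fun k _ => (MeromorphicAt.const _ _).fun_div
    ((MeromorphicAt.id s).fun_add (MeromorphicAt.const _ _))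

/-- Taking K > l puts the term k = l into the finite sum, and it alone is singular at n - l. For l <
0 there is no such term, in accordance with the vanishing Laurent coefficient. -/
theorem exists_mellinCont_eq {n : ℕ} (hn : n ≠ 0) {ν : Fin n → ℂ} (hν : ∀ j, 0 < (ν j).re)
    (l : ℤ) : ∃ A : ℂ → ℂ, AnalyticAt ℂ A ((n : ℂ) - l) ∧
      ∀ᶠ s in nhds ((n : ℂ) - l), mellinCont ν s = A s + laurentCoeff ν 0 l / (s - ((n : ℂ) - l)) := by
  obtain ⟨K, hK, hlK⟩ := exists_nat_sub_lt n ((n : ℂ) - l).re l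
  refine ⟨fun s => mellin (barnesGenRem ν K) s + ∑ k ∈ (Finset.range K).filter (fun k : ℕ => (k : ℤ) ≠ l),
    laurentCoeff ν 0 k / (s + ((k : ℂ) - n)), ?_, ?_⟩
  · refine (analyticAt_mellin_barnesGenRem hn hν hK).add ?_
    refine Finset.analyticAt_fun_sum _ fun k hk => ?_
    refine AnalyticAt.div (by fun_prop) (by fun_prop) ?_
    rw [Finset.mem_filter] at hk
    have : ((k - l : ℤ) : ℂ) ≠ 0 := by exact_mod_cast sub_ne_zero.mpr hk.2
    push_cast at this
    intro h
    apply this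
    linear_combination h
  · filter_upwards [eventually_mellinCont_eq hn hν hK] with s hs
    rw [hs, mellinContAux, ← Finset.sum_filter_add_sum_filter_not _ (fun k : ℕ => (k : ℤ) ≠ l),
      add_assoc]
    congr 2
    rcases lt_or_ge l 0 with h | h
    · rw [laurentCoeff_of_neg ν 0 h, zero_div]
      refine Finset.sum_eq_zero fun k hk => ?_
      simp at hk
      omega
    · obtain ⟨L, rfl⟩ := Int.eq_ofNat_of_zero_le h
      rw [Finset.sum_eq_single L]
      · push_cast; congr 1; ring
      · intro k hk hkL
        rw [Finset.mem_filter, not_not] at hk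
        exact absurd (Int.ofNat_inj.mp hk.2) hkL
      · intro hL
        exact absurd (Finset.mem_filter.mpr
          ⟨Finset.mem_range.mpr (by exact_mod_cast hlK), by simp⟩) hL

/-! ### The Barnes zeta-function: continuation, residues, values -/

theorem rotate_re_pos {θ : ℝ} {z : ℂ} (hz : z ∈ halfPlaneH θ) :
    0 < (z * Complex.exp (-(Complex.I * θ))).re := by
  obtain ⟨r, u, hr, h1, h2, rfl⟩ := hz
  have h : (r : ℂ) * Complex.exp (Complex.I * (θ + u)) * Complex.exp (-(Complex.I * θ)) =
      r * Complex.exp (u * Complex.I) := by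
    rw [mul_assoc, ← Complex.exp_add]
    congr 2; ring
  rw [h, Complex.re_ofReal_mul, Complex.exp_ofReal_mul_I_re]
  exact mul_pos hr (Real.cos_pos_of_mem_Ioo ⟨by linarith, h2⟩)

theorem ne_zero_of_mem_halfPlaneH {θ : ℝ} {z : ℂ} (hz : z ∈ halfPlaneH θ) : z ≠ 0 := by
  rintro rfl
  have := rotate_re_pos hz
  simp at this

theorem barnesTerm_eq {n : ℕ} (θ : ℝ) (ω : Fin n → ℂ) (s : ℂ) (m : Fin n → ℕ) :
    barnesTerm θ (barnesA ω 0) ω s m = Complex.exp (-s * (Complex.I * θ)) *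
      Complex.exp (-s * Complex.log (∑ j, ω j * Complex.exp (-(Complex.I * θ)) * (m j + 1))) := by
  have h : (barnesA ω 0 + ∑ j, ω j * (m j : ℂ)) * Complex.exp (-(Complex.I * θ)) =
      ∑ j, ω j * Complex.exp (-(Complex.I * θ)) * (m j + 1) := by
    rw [barnesA, ← Finset.sum_add_distrib, Finset.sum_mul]
    exact Finset.sum_congr rfl fun j _ => by simp; ring
  rw [barnesTerm, logH, h, mul_add, Complex.exp_add, mul_comm]

/-- The continuation of the Barnes zeta-function `ζₙ(s, ω₁ + ⋯ + ωₙ; ω)`, before its values at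
removable singularities are corrected. -/
def barnesCont {n : ℕ} (θ : ℝ) (ω : Fin n → ℂ) (s : ℂ) : ℂ :=
  Complex.exp (-s * (Complex.I * θ)) * (Complex.Gamma s)⁻¹ *
    mellinCont (fun j => ω j * Complex.exp (-(Complex.I * θ))) s

theorem analyticAt_exp_mul_inv_Gamma (θ : ℝ) (s : ℂ) :
    AnalyticAt ℂ (fun s => Complex.exp (-s * (Complex.I * θ)) * (Complex.Gamma s)⁻¹) s := by
  refine AnalyticAt.mul (by fun_prop) ?_
  exact Complex.differentiable_one_div_Gamma.analyticAt s

theorem meromorphicAt_barnesCont {n : ℕ} (hn : n ≠ 0) {θ : ℝ} {ω : Fin n → ℂ}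
    (hω : ∀ j, ω j ∈ halfPlaneH θ) (s : ℂ) : MeromorphicAt (barnesCont θ ω) s :=
  (analyticAt_exp_mul_inv_Gamma θ s).meromorphicAt.mul
    (meromorphicAt_mellinCont hn (fun j => rotate_re_pos (hω j)) s)

/-- Functions in normal form that agree on a punctured neighbourhood agree at the centre too; so
values at removable singularities are read off from any analytic representative. -/
theorem toMeromorphicNFOn_eventuallyEq {f g : ℂ → ℂ} (hf : MeromorphicOn f Set.univ) {s : ℂ}
    (hg : AnalyticAt ℂ g s) (h : f =ᶠ[nhdsWithin s {s}ᶜ] g) :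
    toMeromorphicNFOn f Set.univ =ᶠ[nhds s] g :=
  ((meromorphicNFOn_toMeromorphicNFOn f Set.univ
    (Set.mem_univ s)).eventuallyEq_nhdsNE_iff_eventuallyEq_nhds hg.meromorphicNFAt).mp
    ((hf.toMeromorphicNFOn_eq_self_on_nhdsNE (Set.mem_univ s)).trans h)

theorem isBarnesZeta_toMeromorphicNFOn {n : ℕ} (hn : n ≠ 0) {θ : ℝ} {ω : Fin n → ℂ}
    (hω : ∀ j, ω j ∈ halfPlaneH θ) :
    IsBarnesZeta θ (barnesA ω 0) ω (toMeromorphicNFOn (barnesCont θ ω) Set.univ) := by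
  have hmer : MeromorphicOn (barnesCont θ ω) Set.univ := fun s _ => meromorphicAt_barnesCont hn hω s
  have hν := fun j => rotate_re_pos (hω j)
  refine ⟨meromorphicNFOn_toMeromorphicNFOn _ _, fun s hs => ?_⟩
  have han : AnalyticAt ℂ (barnesCont θ ω) s := by
    refine (analyticAt_exp_mul_inv_Gamma θ s).mul ?_
    have hs' : (n : ℝ) - (0 : ℕ) < s.re := by simpa using hs
    refine AnalyticAt.congr ?_ (eventually_mellinCont_eq hn hν hs').symm
    refine (analyticAt_mellin_barnesGenRem hn hν hs').congr ?_
    exact Filter.Eventually.of_forall fun w => by simp [mellinContAux]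
  rw [(toMeromorphicNFOn_eventuallyEq hmer han Filter.EventuallyEq.rfl).eq_of_nhds]
  have hs0 : 0 < s.re := lt_of_le_of_lt (Nat.cast_nonneg n) hs
  have hΓ : Complex.Gamma s ≠ 0 := Complex.Gamma_ne_zero_of_re_pos hs0
  have h := (hasSum_Gamma_mul_exp hn hν hs).mul_left
    (Complex.exp (-s * (Complex.I * θ)) * (Complex.Gamma s)⁻¹)
  rw [← mellinCont_eq_mellin hn hν hs] at h
  refine h.congr_fun fun m => ?_
  rw [barnesTerm_eq, mul_assoc, inv_mul_cancel_left₀ hΓ]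

theorem isBarnesZeta_barnesZeta {n : ℕ} (hn : n ≠ 0) {θ : ℝ} {ω : Fin n → ℂ}
    (hω : ∀ j, ω j ∈ halfPlaneH θ) :
    IsBarnesZeta θ (barnesA ω 0) ω (barnesZeta θ (barnesA ω 0) ω) := by
  have h : ∃ Z : ℂ → ℂ, IsBarnesZeta θ (barnesA ω 0) ω Z := ⟨_, isBarnesZeta_toMeromorphicNFOn hn hω⟩
  rw [barnesZeta, dif_pos h]
  exact h.choose_spec

theorem barnesZeta_eq {n : ℕ} (hn : n ≠ 0) {θ : ℝ} {ω : Fin n → ℂ}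
    (hω : ∀ j, ω j ∈ halfPlaneH θ) :
    barnesZeta θ (barnesA ω 0) ω = toMeromorphicNFOn (barnesCont θ ω) Set.univ :=
  (isBarnesZeta_barnesZeta hn hω).unique (isBarnesZeta_toMeromorphicNFOn hn hω)

theorem prod_zpow_eq_zpow_sum {ι : Type*} (s : Finset ι) (f : ι → ℤ) {c : ℂ} (hc : c ≠ 0) :
    ∏ j ∈ s, c ^ f j = c ^ ∑ j ∈ s, f j := by
  classical
  induction s using Finset.induction_on with
  | empty => simp
  | insert a s ha ih => rw [Finset.prod_insert ha, Finset.sum_insert ha, zpow_add₀ hc, ih]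

/-- Homogeneity of degree l - n. At s = n - l it cancels the factor e^{-isθ} introduced by the
rotation. -/
theorem laurentCoeff_rotate {n : ℕ} (ω : Fin n → ℂ) (y : ℂ) {c : ℂ} (hc : c ≠ 0) (l : ℤ) :
    laurentCoeff (fun j => ω j * c) y l = c ^ (l - n) * laurentCoeff ω y l := by
  rw [laurentCoeff, laurentCoeff, Finset.mul_sum]
  refine Finset.sum_congr rfl fun m hm => ?_
  rw [mem_tuplesWithSum] at hm
  have h : c ^ (l - n) = ∏ j, c ^ ((m j : ℤ) - 1) := by
    rw [prod_zpow_eq_zpow_sum _ _ hc, ← hm, Finset.sum_sub_distrib]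
    simp
  rw [h, ← Finset.prod_mul_distrib]
  exact Finset.prod_congr rfl fun j _ => by rw [mul_zpow]; ring

/-- Exhibits the zeros of 1/Γ at 0, -1, …, 1 - q as explicit linear factors. -/
theorem inv_Gamma_eq_prod (s : ℂ) (q : ℕ) :
    (Complex.Gamma s)⁻¹ = (∏ i ∈ Finset.range q, (s + i)) * (Complex.Gamma (s + q))⁻¹ := by
  induction q with
  | zero => simp
  | succ q ih =>
    rw [ih, Complex.one_div_Gamma_eq_self_mul_one_div_Gamma_add_one (s + q), Finset.prod_range_succ]
    push_cast
    rw [add_assoc s]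
    ring

theorem prod_range_neg_add (q : ℕ) :
    ∏ i ∈ Finset.range q, (-(q : ℂ) + i) = (-1) ^ q * q ! := by
  have h : ∀ i ∈ Finset.range q, (-(q : ℂ) + i) = -1 * ((q - 1 - i : ℕ) + 1 : ℂ) := by
    intro i hi
    have hi := Finset.mem_range.mp hi
    have : ((q - 1 - i : ℕ) : ℂ) = (q : ℂ) - 1 - i := by
      rw [Nat.sub_sub, Nat.cast_sub (by omega)]; push_cast; ring
    rw [this]; ring
  rw [Finset.prod_congr rfl h, Finset.prod_mul_distrib, Finset.prod_range_reflect
    (fun i => (i : ℂ) + 1), Finset.prod_const, Finset.card_range]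
  congr 1
  exact_mod_cast Finset.prod_range_add_one_eq_factorial q

theorem residueAt_eq {f G : ℂ → ℂ} {c a : ℂ} (hG : AnalyticAt ℂ G c)
    (h : ∀ᶠ z in nhdsWithin c {c}ᶜ, f z = a * (z - c)⁻¹ + G z) : residueAt f c = a := by
  refine Filter.Tendsto.limUnder_eq (tendsto_const_nhds.congr' ?_)
  rw [eventually_nhdsWithin_iff] at h
  obtain ⟨ε, hε, hball⟩ := Metric.eventually_nhds_iff_ball.mp (h.and hG.eventually_analyticAt)
  filter_upwards [Ioo_mem_nhdsGT hε] with r hr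
  have hsub : ∀ z ∈ Metric.closedBall c r, z ∈ Metric.ball c ε := fun z hz =>
    Metric.closedBall_subset_ball hr.2 hz
  have hsph : ∀ z ∈ Metric.sphere c r, z ≠ c := by
    rintro z hz rfl
    simp at hz
    linarith [hr.1]
  have h1 : ∮ z in C(c, r), f z = ∮ z in C(c, r), (a * (z - c)⁻¹ + G z) :=
    circleIntegral.integral_congr hr.1.le fun z hz =>
      (hball z (hsub z (Metric.sphere_subset_closedBall hz))).1 (hsph z hz)
  have hG0 : ∮ z in C(c, r), G z = 0 :=
    Complex.circleIntegral_eq_zero_of_differentiable_on_off_countable hr.1.le Set.countable_empty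
      (fun z hz => (hball z (hsub z hz)).2.continuousAt.continuousWithinAt)
      fun z hz => (hball z (hsub z (Metric.ball_subset_closedBall hz.1))).2.differentiableAt
  have hi1 : CircleIntegrable (fun z => a * (z - c)⁻¹) c r := by
    refine ContinuousOn.circleIntegrable hr.1.le fun z hz => ?_
    exact (continuousAt_const.mul ((continuousAt_id.sub continuousAt_const).inv₀
      (sub_ne_zero.mpr (hsph z hz)))).continuousWithinAt
  have hi2 : CircleIntegrable G c r := by
    refine ContinuousOn.circleIntegrable hr.1.le fun z hz => ?_
    exact (hball z (hsub z
      (Metric.sphere_subset_closedBall hz))).2.continuousAt.continuousWithinAt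
  have hmul := circleIntegral.integral_const_mul a (fun z : ℂ => (z - c)⁻¹) c r
  rw [h1, circleIntegral.integral_add hi1 hi2, hG0, hmul,
    circleIntegral.integral_sub_center_inv c hr.1.ne', add_zero]
  have := Complex.two_pi_I_ne_zero
  field_simp

theorem residueAt_barnesZeta {n : ℕ} (hn : n ≠ 0) {θ : ℝ} {ω : Fin n → ℂ}
    (hω : ∀ j, ω j ∈ halfPlaneH θ) {l : ℤ} (hl : l < n) :
    residueAt (barnesZeta θ (barnesA ω 0) ω) ((n : ℂ) - l) =
      laurentCoeff ω 0 l / ((n - l - 1).toNat ! : ℂ) := by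
  have hν := fun j => rotate_re_pos (hω j)
  have hmer : MeromorphicOn (barnesCont θ ω) Set.univ := fun s _ => meromorphicAt_barnesCont hn hω s
  set s₀ : ℂ := (n : ℂ) - l with hs₀
  obtain ⟨A, hA, hAeq⟩ := exists_mellinCont_eq hn hν l
  set h : ℂ → ℂ := fun s => Complex.exp (-s * (Complex.I * θ)) * (Complex.Gamma s)⁻¹ with hh
  have hha : AnalyticAt ℂ h s₀ := analyticAt_exp_mul_inv_Gamma θ s₀
  set c := laurentCoeff (fun j => ω j * Complex.exp (-(Complex.I * θ))) 0 l with hc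
  have hval : c * h s₀ = laurentCoeff ω 0 l / ((n - l - 1).toNat ! : ℂ) := by
    have h1 : Complex.Gamma s₀ = ((n - l - 1).toNat ! : ℂ) := by
      rw [← Complex.Gamma_nat_eq_factorial]
      congr 1
      have : (((n - l - 1).toNat : ℤ) : ℂ) = ((n - l - 1 : ℤ) : ℂ) := by
        rw [Int.toNat_of_nonneg (by omega)]
      push_cast at this
      rw [this, hs₀]; ring
    have h2 : Complex.exp (-s₀ * (Complex.I * θ)) * Complex.exp (-(Complex.I * θ)) ^ (l - n) = 1 := by
      rw [← Complex.exp_int_mul, ← Complex.exp_add, ← Complex.exp_zero]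
      congr 1
      rw [hs₀]; push_cast; ring
    rw [hc, hh, laurentCoeff_rotate _ _ (Complex.exp_ne_zero _)]
    simp only []
    rw [h1, div_eq_mul_inv]
    linear_combination laurentCoeff ω 0 l * ((n - l - 1).toNat ! : ℂ)⁻¹ * h2
  rw [← hval]
  -- Writing h(s) = h(s₀) + (s - s₀)·`dslope h s₀ s` turns h(s)·c/(s - s₀) into the polar part
  -- c·h(s₀)/(s - s₀) plus an analytic term.
  refine residueAt_eq (G := fun s => h s * A s + c * dslope h s₀ s)
    ((hha.mul hA).add (analyticAt_const.mul hha.dslope_same)) ?_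
  rw [barnesZeta_eq hn hω]
  filter_upwards [hmer.toMeromorphicNFOn_eq_self_on_nhdsNE (Set.mem_univ s₀),
    hAeq.filter_mono nhdsWithin_le_nhds, self_mem_nhdsWithin] with s h1 h2 h3
  have h3 : s - s₀ ≠ 0 := sub_ne_zero.mpr h3
  have h4 := sub_smul_dslope h s₀ s
  rw [smul_eq_mul] at h4
  rw [h1, barnesCont, h2, ← hs₀]
  have h5 : dslope h s₀ s = (h s - h s₀) / (s - s₀) := by rw [← h4]; field_simp
  rw [h5]
  change h s * _ = _
  field_simp
  ring

theorem barnesZeta_neg {n : ℕ} (hn : n ≠ 0) {θ : ℝ} {ω : Fin n → ℂ}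
    (hω : ∀ j, ω j ∈ halfPlaneH θ) {l : ℤ} (hl : n < l) :
    AnalyticAt ℂ (barnesZeta θ (barnesA ω 0) ω) ((n : ℂ) - l) ∧
      barnesZeta θ (barnesA ω 0) ω ((n : ℂ) - l) =
        laurentCoeff ω 0 l * ((-1) ^ (l - n).toNat * ((l - n).toNat ! : ℂ)) := by
  have hν := fun j => rotate_re_pos (hω j)
  have hmer : MeromorphicOn (barnesCont θ ω) Set.univ := fun s _ => meromorphicAt_barnesCont hn hω s
  obtain ⟨A, hA, hAeq⟩ := exists_mellinCont_eq hn hν l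
  set s₀ : ℂ := (n : ℂ) - l with hs₀
  set q := (l - n).toNat with hq
  have hqs : s₀ = -(q : ℂ) := by
    have : ((q : ℤ) : ℂ) = ((l - n : ℤ) : ℂ) := by rw [hq, Int.toNat_of_nonneg (by omega)]
    push_cast at this
    rw [this, hs₀]; ring
  set c := laurentCoeff (fun j => ω j * Complex.exp (-(Complex.I * θ))) 0 l with hc
  set g : ℂ → ℂ := fun s => Complex.exp (-s * (Complex.I * θ)) * (Complex.Gamma s)⁻¹ * A s +
    c * (Complex.exp (-s * (Complex.I * θ)) * ((∏ i ∈ Finset.range q, (s + i)) *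
      (Complex.Gamma (s + (q + 1 : ℕ)))⁻¹)) with hg
  have hga : AnalyticAt ℂ g s₀ := by
    refine ((analyticAt_exp_mul_inv_Gamma θ s₀).mul hA).add
      (analyticAt_const.mul (AnalyticAt.mul (by fun_prop) (AnalyticAt.mul ?_ ?_)))
    · exact Finset.analyticAt_fun_prod _ fun i _ => by fun_prop
    · have h1 : Differentiable ℂ fun s : ℂ => (Complex.Gamma (s + (q + 1 : ℕ)))⁻¹ :=
        Complex.differentiable_one_div_Gamma.comp (differentiable_id.add_const _)
      exact h1.analyticAt s₀
  have heq : barnesCont θ ω =ᶠ[nhdsWithin s₀ {s₀}ᶜ] g := by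
    filter_upwards [hAeq.filter_mono nhdsWithin_le_nhds, self_mem_nhdsWithin] with s h2 h3
    have h3 : s - s₀ ≠ 0 := sub_ne_zero.mpr h3
    rw [barnesCont, h2, hg]
    simp only []
    rw [mul_add]
    congr 1
    -- With q + 1 factors the last one is s + q = s - s₀, which cancels the simple pole; the other q
    -- factors give (-1)^q q! at s₀, where the remaining Gamma value is Γ(1).
    rw [inv_Gamma_eq_prod s (q + 1), Finset.prod_range_succ]
    have h4 : s + (q : ℂ) = s - s₀ := by rw [hqs]; ring
    rw [h4]
    field_simp
  have hZ : barnesZeta θ (barnesA ω 0) ω =ᶠ[nhds s₀] g := by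
    rw [barnesZeta_eq hn hω]
    exact toMeromorphicNFOn_eventuallyEq hmer hga heq
  refine ⟨hga.congr hZ.symm, ?_⟩
  rw [hZ.eq_of_nhds, hg]
  simp only []
  have h1 : (Complex.Gamma s₀)⁻¹ = 0 := by
    rw [hqs, Complex.Gamma_neg_nat_eq_zero, inv_zero]
  have h2 : Complex.Gamma (s₀ + (q + 1 : ℕ)) = 1 := by
    rw [hqs]; push_cast; rw [neg_add_cancel_left, Complex.Gamma_one]
  have h3 : ∏ i ∈ Finset.range q, (s₀ + i) = (-1) ^ q * q ! := by rw [hqs, prod_range_neg_add]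
  have h4 : Complex.exp (-s₀ * (Complex.I * θ)) * Complex.exp (-(Complex.I * θ)) ^ (l - n) = 1 := by
    rw [← Complex.exp_int_mul, ← Complex.exp_add, ← Complex.exp_zero]
    congr 1
    rw [hs₀]; push_cast; ring
  rw [h1, h2, h3, hc, laurentCoeff_rotate _ _ (Complex.exp_ne_zero _), inv_one]
  linear_combination laurentCoeff ω 0 l * ((-1) ^ q * q !) * h4

/-! ### Ramanujan's formula from n = 2 -/

theorem bernoulliB_zero (m : ℕ) : bernoulliB m 0 = (bernoulli m : ℂ) := by
  rw [bernoulliB, ← map_zero (algebraMap ℚ ℂ), Polynomial.aeval_algebraMap_apply,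
    Polynomial.coe_aeval_eq_eval, Polynomial.bernoulli_eval_zero]
  rfl

theorem bernoulliB_zero_of_odd {m : ℕ} (hm : Odd m) (h1 : m ≠ 1) : bernoulliB m 0 = 0 := by
  have : 1 < m := by obtain ⟨r, rfl⟩ := hm; omega
  rw [bernoulliB_zero, bernoulli_eq_zero_of_odd hm this, Rat.cast_zero]

/-- As the total 2N + 2 is even, the two indices have the same parity. An odd pair contributes only
through B_1·B_1, which would need 2N + 2 = 2; so N ≠ 0 leaves the even pairs. -/
theorem bernoulliSum_pair {N : ℤ} (hN : N ≠ 0) (τ : ℂ) :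
    bernoulliSum ![1, τ] (2 * N + 2) = -∑ k ∈ Finset.range (N + 2).toNat,
      bernoulliB (2 * k) 0 / ((2 * k)! : ℂ) *
        (bernoulliB (2 * N + 2 - 2 * k).toNat 0 / ((2 * N + 2 - 2 * k).toNat ! : ℂ)) *
        τ ^ (2 * N + 1 - 2 * k) := by
  rw [bernoulliSum]
  congr 1
  symm
  refine Finset.sum_of_injOn (fun k => ![2 * k, (2 * N + 2 - 2 * k).toNat]) ?_ ?_ ?_ ?_
  · intro a _ b _ h
    have := congrFun h 0
    simp only [Matrix.cons_val_zero] at this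
    omega
  · intro k hk
    have hk : k < (N + 2).toNat := by simpa using hk
    rw [Finset.mem_coe, mem_tuplesWithSum, Fin.sum_univ_two]
    simp only [Matrix.cons_val_zero, Matrix.cons_val_one]
    omega
  · intro m hm hmem
    rw [mem_tuplesWithSum, Fin.sum_univ_two] at hm
    rw [Fin.prod_univ_two]
    rcases Nat.even_or_odd (m 0) with h0 | h0
    · exfalso
      apply hmem
      obtain ⟨r, hr⟩ := h0
      refine ⟨r, by simp; omega, ?_⟩
      funext j
      fin_cases j
      · simp; omega
      · simp; omega
    · obtain ⟨r, hr⟩ := h0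
      by_cases h : m 0 = 1
      · rw [bernoulliB_zero_of_odd (m := m 1) ⟨(m 1) / 2, by omega⟩ (by omega)]
        simp
      · rw [bernoulliB_zero_of_odd (m := m 0) ⟨r, hr⟩ h]
        simp
  · intro k hk
    have hk : k < (N + 2).toNat := by simpa using hk
    have he : (((2 * N + 2 - 2 * k).toNat : ℤ)) - 1 = 2 * N + 1 - 2 * k := by omega
    rw [Fin.prod_univ_two]
    simp only [Matrix.cons_val_zero, Matrix.cons_val_one, he, one_zpow]
    ring

/-- Inverting τ = iα/π exchanges α and β up to sign; this is the source of the symmetry in the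
formula. -/
theorem inv_I_mul_div_pi {α β : ℝ} (h : α * β = Real.pi ^ 2) :
    (Complex.I * α / Real.pi)⁻¹ = -(Complex.I * β / Real.pi) := by
  have hπ : (Real.pi : ℂ) ≠ 0 := by exact_mod_cast Real.pi_ne_zero
  have h : (α : ℂ) * β = Real.pi ^ 2 := by exact_mod_cast h
  refine inv_eq_of_mul_eq_one_right ?_
  field_simp
  linear_combination (-Complex.I ^ 2) * h - Real.pi ^ 2 * Complex.I_sq

theorem im_I_mul_div_pi (α : ℝ) : (Complex.I * α / Real.pi).im = α / Real.pi := by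
  rw [Complex.div_ofReal_im]; simp

theorem im_inv_I_mul_div_pi {α β : ℝ} (h : α * β = Real.pi ^ 2) :
    (Complex.I * α / Real.pi)⁻¹.im = -(β / Real.pi) := by
  rw [inv_I_mul_div_pi h, Complex.neg_im, im_I_mul_div_pi]

theorem erase_zero_fin_two : (Finset.univ.erase 0 : Finset (Fin 2)) = {1} := by decide

theorem erase_one_fin_two : (Finset.univ.erase 1 : Finset (Fin 2)) = {0} := by decide

section Pair

variable {α β : ℝ} (N : ℤ)

theorem indexNeg_pair_zero (hα : 0 < α) :
    indexNeg ![1, Complex.I * α / Real.pi] 0 = ∅ := by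
  refine Finset.filter_eq_empty_iff.mpr fun j _ => ?_
  fin_cases j
  · simp
  · have := im_I_mul_div_pi α
    have := div_pos hα Real.pi_pos
    simp_all [le_of_lt]

theorem indexPos_pair_zero (hα : 0 < α) :
    indexPos ![1, Complex.I * α / Real.pi] 0 ≠ ∅ := by
  refine Finset.Nonempty.ne_empty ⟨1, Finset.mem_filter.mpr ⟨Finset.mem_univ _, one_ne_zero, ?_⟩⟩
  simp only [Matrix.cons_val_zero, Matrix.cons_val_one, div_one, im_I_mul_div_pi]
  exact div_pos hα Real.pi_pos

theorem indexPos_pair_one (hβ : 0 < β) (h : α * β = Real.pi ^ 2) :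
    indexPos ![1, Complex.I * α / Real.pi] 1 = ∅ := by
  refine Finset.filter_eq_empty_iff.mpr fun j _ => ?_
  fin_cases j
  · simp only [Fin.zero_eta, Matrix.cons_val_zero, Matrix.cons_val_one, one_div,
      im_inv_I_mul_div_pi h]
    have := div_pos hβ Real.pi_pos
    rintro ⟨_, h⟩
    linarith
  · simp

theorem indexNeg_pair_one (hβ : 0 < β) (h : α * β = Real.pi ^ 2) :
    indexNeg ![1, Complex.I * α / Real.pi] 1 ≠ ∅ := by
  refine Finset.Nonempty.ne_empty ⟨0, Finset.mem_filter.mpr ⟨Finset.mem_univ _, zero_ne_one, ?_⟩⟩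
  simp only [Matrix.cons_val_zero, Matrix.cons_val_one, one_div, im_inv_I_mul_div_pi h]
  exact neg_neg_of_pos (div_pos hβ Real.pi_pos)

theorem im_div_pair_ne_zero (hα : 0 < α) (hβ : 0 < β) (h : α * β = Real.pi ^ 2) (j k : Fin 2)
    (hjk : j ≠ k) : (![1, Complex.I * α / Real.pi] j / ![1, Complex.I * α / Real.pi] k).im ≠ 0 := by
  have h1 := div_pos hα Real.pi_pos
  have h2 := div_pos hβ Real.pi_pos
  fin_cases j <;> fin_cases k
  · exact absurd rfl hjk
  · simp only [Fin.zero_eta, Fin.mk_one, Matrix.cons_val_zero, Matrix.cons_val_one, one_div,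
      im_inv_I_mul_div_pi h]
    linarith
  · simp only [Fin.zero_eta, Fin.mk_one, Matrix.cons_val_zero, Matrix.cons_val_one, div_one,
      im_I_mul_div_pi]
    linarith
  · exact absurd rfl hjk

theorem neg_zpow_odd (z : ℂ) : (-z) ^ (-(2 * N + 1)) = -z ^ (-(2 * N + 1)) :=
  Odd.neg_zpow (by exact (odd_two_mul_add_one N).neg) z

theorem ramanujanTerm_eq (α : ℝ) (m : ℕ+) : ramanujanTerm α N m =
    (m : ℂ) ^ (-(2 * N + 1)) * (1 / (Complex.exp (2 * (m : ℂ) * α) - 1)) := by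
  rw [ramanujanTerm, zpow_neg, one_div, mul_inv, one_div, mul_comm]

theorem exp_two_mul_sub_one_ne_zero (hα : 0 < α) (m : ℕ+) :
    Complex.exp (2 * (m : ℂ) * α) - 1 ≠ 0 := by
  refine exp_sub_one_ne_zero_of_re_ne_zero ?_
  have hm : (0 : ℝ) < m := by exact_mod_cast m.pos
  have : (2 * (m : ℂ) * α).re = 2 * m * α := by
    rw [Complex.re_mul_ofReal]; simp
  rw [this]
  positivity

/-- For n = 2 the nonzero δ is -1, so a regularized term with a decaying exponential becomes minus
the term with the growing one. -/
theorem exp_neg_term (hα : 0 < α) (m : ℕ+) :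
    1 / (Complex.exp (-(2 * (m : ℂ) * α)) - 1) + 1 =
      -(1 / (Complex.exp (2 * (m : ℂ) * α) - 1)) := by
  have h1 := exp_two_mul_sub_one_ne_zero hα m
  have h2 := Complex.exp_ne_zero (2 * (m : ℂ) * α)
  rw [Complex.exp_neg]
  have h3 : (Complex.exp (2 * (m : ℂ) * α))⁻¹ - 1 ≠ 0 := by
    intro h
    apply h1
    rw [sub_eq_zero, inv_eq_one] at h
    rw [h, sub_self]
  have h4 : (1 - Complex.exp (2 * (m : ℂ) * α)) ≠ 0 := by
    rw [← neg_sub]; exact neg_ne_zero.mpr h1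
  field_simp
  ring

theorem exponent_pair : ((2 : ℕ) : ℤ) - (2 * N + 2) - 1 = -(2 * N + 1) := by
  push_cast; ring

theorem termPos_pair_zero (hα : 0 < α) (m : ℕ+) :
    termPos ![1, Complex.I * α / Real.pi] (2 * N + 2) 0 m =
      -(2 * Real.pi * Complex.I) ^ (-(2 * N + 1)) * ramanujanTerm α N m := by
  have hπ : (Real.pi : ℂ) ≠ 0 := by exact_mod_cast Real.pi_ne_zero
  have he : 2 * (m : ℂ) * Real.pi * Complex.I * (Complex.I * α / Real.pi) / 1 =
      -(2 * (m : ℂ) * α) := by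
    field_simp
    linear_combination (α : ℂ) * Complex.I_sq
  rw [termPos, exponent_pair, erase_zero_fin_two, Finset.prod_singleton, indexNeg_pair_zero hα,
    ramanujanTerm_eq, deltaJ, if_pos rfl]
  simp only [Matrix.cons_val_zero, Matrix.cons_val_one]
  rw [he, inv_one, mul_one, show 2 * (m : ℂ) * Real.pi * Complex.I = 2 * Real.pi * Complex.I * m by ring,
    mul_zpow]
  linear_combination (2 * Real.pi * Complex.I) ^ (-(2 * N + 1)) * (m : ℂ) ^ (-(2 * N + 1)) *
    exp_neg_term hα m

theorem termNeg_pair_zero (hα : 0 < α) (m : ℕ+) :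
    termNeg ![1, Complex.I * α / Real.pi] (2 * N + 2) 0 m =
      -(2 * Real.pi * Complex.I) ^ (-(2 * N + 1)) * ramanujanTerm α N m := by
  have hπ : (Real.pi : ℂ) ≠ 0 := by exact_mod_cast Real.pi_ne_zero
  have he : -2 * (m : ℂ) * Real.pi * Complex.I * (Complex.I * α / Real.pi) / 1 =
      2 * (m : ℂ) * α := by
    field_simp
    linear_combination -(α : ℂ) * Complex.I_sq
  rw [termNeg, exponent_pair, erase_zero_fin_two, Finset.prod_singleton, deltaJ,
    if_neg (indexPos_pair_zero hα), ramanujanTerm_eq]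
  simp only [Matrix.cons_val_zero, Matrix.cons_val_one]
  rw [he, inv_one, mul_one,
    show -2 * (m : ℂ) * Real.pi * Complex.I = -(2 * Real.pi * Complex.I * m) by ring,
    neg_zpow_odd, mul_zpow]
  ring

theorem termPos_pair_one (hβ : 0 < β) (h : α * β = Real.pi ^ 2) (m : ℕ+) :
    termPos ![1, Complex.I * α / Real.pi] (2 * N + 2) 1 m =
      (2 * (β : ℂ)) ^ (-(2 * N + 1)) * ramanujanTerm β N m := by
  have hπ : (Real.pi : ℂ) ≠ 0 := by exact_mod_cast Real.pi_ne_zero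
  have he : 2 * (m : ℂ) * Real.pi * Complex.I * (Complex.I * α / Real.pi)⁻¹ =
      2 * (m : ℂ) * β := by
    rw [inv_I_mul_div_pi h]
    field_simp
    linear_combination -(β : ℂ) * Complex.I_sq
  rw [termPos, exponent_pair, erase_one_fin_two, Finset.prod_singleton, deltaJ,
    if_neg (indexNeg_pair_one hβ h), ramanujanTerm_eq]
  simp only [Matrix.cons_val_zero, Matrix.cons_val_one]
  rw [mul_one, div_eq_mul_inv _ (Complex.I * α / Real.pi : ℂ), he,
    show 2 * (m : ℂ) * β = 2 * β * m by ring, mul_zpow]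
  ring

theorem termNeg_pair_one (hβ : 0 < β) (h : α * β = Real.pi ^ 2) (m : ℕ+) :
    termNeg ![1, Complex.I * α / Real.pi] (2 * N + 2) 1 m =
      (2 * (β : ℂ)) ^ (-(2 * N + 1)) * ramanujanTerm β N m := by
  have hπ : (Real.pi : ℂ) ≠ 0 := by exact_mod_cast Real.pi_ne_zero
  have he : -2 * (m : ℂ) * Real.pi * Complex.I * (Complex.I * α / Real.pi)⁻¹ =
      -(2 * (m : ℂ) * β) := by
    rw [inv_I_mul_div_pi h]
    field_simp
    linear_combination (β : ℂ) * Complex.I_sq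
  rw [termNeg, exponent_pair, erase_one_fin_two, Finset.prod_singleton, indexPos_pair_one hβ h,
    deltaJ, if_pos rfl, ramanujanTerm_eq]
  simp only [Matrix.cons_val_zero, Matrix.cons_val_one]
  rw [mul_one, div_eq_mul_inv _ (Complex.I * α / Real.pi : ℂ), he, neg_zpow_odd]
  have hz : (2 * (m : ℂ) * β) ^ (-(2 * N + 1)) =
      (2 * (β : ℂ)) ^ (-(2 * N + 1)) * (m : ℂ) ^ (-(2 * N + 1)) := by
    rw [← mul_zpow]; congr 1; ring
  rw [hz]
  linear_combination -(2 * (β : ℂ)) ^ (-(2 * N + 1)) * (m : ℂ) ^ (-(2 * N + 1)) *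
    exp_neg_term hβ m

/-- For each k the two opposite rays give equal series, while exactly one of the two δ is nonzero;
hence ζ appears with weight 1/2 relative to the series. -/
theorem regularizedSeries_pair (hα : 0 < α) (hβ : 0 < β) (h : α * β = Real.pi ^ 2) :
    regularizedSeries ![1, Complex.I * α / Real.pi] (2 * N + 2) =
      -2 * (2 * Real.pi * Complex.I) ^ (-(2 * N + 1)) *
          (1 / 2 * riemannZeta (2 * N + 1) + ∑' k : ℕ+, ramanujanTerm α N k) -
        2 * (Complex.I * β / Real.pi) * (2 * (β : ℂ)) ^ (-(2 * N + 1)) *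
          (1 / 2 * riemannZeta (2 * N + 1) + ∑' k : ℕ+, ramanujanTerm β N k) := by
  have hπ : (Real.pi : ℂ) ≠ 0 := by exact_mod_cast Real.pi_ne_zero
  have hζ : (1 : ℂ) - (2 : ℕ) + ((2 * N + 2 : ℤ) : ℂ) = 2 * N + 1 := by push_cast; ring
  have h1 : 2 * (Real.pi : ℂ) * Complex.I * 1⁻¹ = 2 * Real.pi * Complex.I := by ring
  have h2 : -2 * (Real.pi : ℂ) * Complex.I * (Complex.I * α / Real.pi)⁻¹ = -(2 * β) := by
    rw [inv_I_mul_div_pi h]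
    field_simp
    linear_combination (β : ℂ) * Complex.I_sq
  rw [regularizedSeries, Fin.sum_univ_two, tsum_congr (termPos_pair_zero N hα),
    tsum_congr (termNeg_pair_zero N hα), tsum_congr (termPos_pair_one N hβ h),
    tsum_congr (termNeg_pair_one N hβ h), tsum_mul_left, tsum_mul_left, exponent_pair, hζ,
    indexNeg_pair_zero hα, indexPos_pair_one hβ h]
  simp only [deltaJ, if_neg (indexPos_pair_zero hα), if_neg (indexNeg_pair_one hβ h), if_true,
    Matrix.cons_val_zero, Matrix.cons_val_one]
  rw [h1, h2, neg_zpow_odd, inv_I_mul_div_pi h]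
  ring

theorem summable_ramanujanTerm (hN : N ≠ 0) (hα : 0 < α) (hβ : 0 < β)
    (h : α * β = Real.pi ^ 2) : Summable (ramanujanTerm α N) := by
  have hτ : Complex.I * α / Real.pi ≠ 0 := by
    intro h0
    have := im_I_mul_div_pi α
    rw [h0, Complex.zero_im] at this
    exact (div_pos hα Real.pi_pos).ne this
  have hs := summable_termPos le_rfl (fun j => by fin_cases j; exacts [one_ne_zero, hτ])
    (im_div_pair_ne_zero hα hβ h) (l := 2 * N + 2) (by omega) 0
  have hs := hs.congr fun m => (termPos_pair_zero N hα m)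
  refine (summable_mul_left_iff ?_).mp hs
  exact neg_ne_zero.mpr (zpow_ne_zero _ Complex.two_pi_I_ne_zero)

end Pair

theorem I_zpow_two_mul_add_one (k : ℤ) :
    Complex.I ^ (2 * k + 1) = (-1) ^ k * Complex.I := by
  rw [zpow_add_one₀ Complex.I_ne_zero, zpow_mul, zpow_ofNat, Complex.I_sq]

/-- Ramanujan's formula for `ζ(2N + 1)`. -/
theorem ramanujan_formula {N : ℤ} (hN : N ≠ 0) {α β : ℝ} (hα : 0 < α) (hβ : 0 < β)
    (h : α * β = Real.pi ^ 2) :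
    (α : ℂ) ^ (-N) * (1 / 2 * riemannZeta (2 * N + 1) + ∑' k : ℕ+, ramanujanTerm α N k) =
      (-(β : ℂ)) ^ (-N) * (1 / 2 * riemannZeta (2 * N + 1) + ∑' k : ℕ+, ramanujanTerm β N k) -
        (2 : ℂ) ^ (2 * N) * ∑ k ∈ Finset.range (N + 2).toNat,
          (-1) ^ k * (bernoulliB (2 * k) 0 / ((2 * k)! : ℂ)) *
            (bernoulliB (2 * N + 2 - 2 * k).toNat 0 / ((2 * N + 2 - 2 * k).toNat ! : ℂ)) *
            (α : ℂ) ^ (N + 1 - k) * (β : ℂ) ^ k := by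
  have hπ : (Real.pi : ℂ) ≠ 0 := by exact_mod_cast Real.pi_ne_zero
  have hα0 : (α : ℂ) ≠ 0 := by exact_mod_cast hα.ne'
  have hβ0 : (β : ℂ) ≠ 0 := by exact_mod_cast hβ.ne'
  have hτ : Complex.I * α / Real.pi ≠ 0 := div_ne_zero (mul_ne_zero Complex.I_ne_zero hα0) hπ
  have hαβ : (β : ℂ) = Real.pi ^ 2 / α := by
    rw [eq_div_iff hα0, mul_comm]; exact_mod_cast h
  have key := regularizedSeries_eq_bernoulliSum le_rfl
    (fun j => by fin_cases j; exacts [one_ne_zero, hτ])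
    (im_div_pair_ne_zero hα hβ h) (l := 2 * N + 2) (by omega)
  rw [regularizedSeries_pair N hα hβ h, bernoulliSum_pair hN] at key
  set Sα := 1 / 2 * riemannZeta (2 * N + 1) + ∑' k : ℕ+, ramanujanTerm α N k
  set Sβ := 1 / 2 * riemannZeta (2 * N + 1) + ∑' k : ℕ+, ramanujanTerm β N k
  -- The constant that turns the coefficient of `Sα` into α^{-N}; αβ = π² then makes that of `Sβ`
  -- equal to -(-β)^{-N}.
  set F : ℂ := 2 ^ (2 * N) * (α : ℂ) ^ (-N) * (Real.pi : ℂ) ^ (2 * N + 1) * (-Complex.I) * (-1) ^ N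
    with hF
  have hone : ((-1 : ℂ) ^ N) * (-1) ^ N = 1 := by
    rw [← mul_zpow]; simp
  have h2N : (2 : ℂ) ^ (2 * N) ≠ 0 := zpow_ne_zero _ two_ne_zero
  have hαN : (α : ℂ) ^ (-N) = (β : ℂ) ^ N * ((Real.pi : ℂ) ^ (N + N))⁻¹ := by
    have ha := zpow_ne_zero N hα0
    rw [hαβ, div_zpow, zpow_add₀ hπ, zpow_neg, sq, mul_zpow]
    field_simp
  have e1 : F * (2 * (2 * Real.pi * Complex.I) ^ (-(2 * N + 1))) = -(α : ℂ) ^ (-N) := by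
    rw [zpow_neg (2 * Real.pi * Complex.I), mul_zpow, mul_zpow, zpow_add_one₀ two_ne_zero,
      I_zpow_two_mul_add_one, hF]
    have := zpow_ne_zero (2 * N + 1) hπ
    field_simp
  have e2 : F * (2 * (Complex.I * β / Real.pi) * (2 * (β : ℂ)) ^ (-(2 * N + 1))) =
      (-(β : ℂ)) ^ (-N) := by
    have hb := zpow_ne_zero N hβ0
    rw [hF, hαN, zpow_neg (2 * (β : ℂ)), mul_zpow, zpow_add_one₀ two_ne_zero, zpow_add_one₀ hβ0,
      two_mul N, zpow_add₀ hβ0, zpow_add_one₀ hπ, zpow_neg (-(β : ℂ)), neg_eq_neg_one_mul (β : ℂ), mul_zpow]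
    field_simp
    linear_combination -Complex.I ^ 2 * hone - Complex.I_sq
  have e3 : F * (∑ k ∈ Finset.range (N + 2).toNat, bernoulliB (2 * k) 0 / ((2 * k)! : ℂ) *
      (bernoulliB (2 * N + 2 - 2 * k).toNat 0 / ((2 * N + 2 - 2 * k).toNat ! : ℂ)) *
      (Complex.I * α / Real.pi) ^ (2 * N + 1 - 2 * k)) =
      (2 : ℂ) ^ (2 * N) * ∑ k ∈ Finset.range (N + 2).toNat,
          (-1) ^ k * (bernoulliB (2 * k) 0 / ((2 * k)! : ℂ)) *
            (bernoulliB (2 * N + 2 - 2 * k).toNat 0 / ((2 * N + 2 - 2 * k).toNat ! : ℂ)) *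
            (α : ℂ) ^ (N + 1 - k) * (β : ℂ) ^ k := by
    rw [Finset.mul_sum, Finset.mul_sum]
    refine Finset.sum_congr rfl fun k _ => ?_
    have hk : F * (Complex.I * α / Real.pi) ^ (2 * N + 1 - 2 * k) =
        2 ^ (2 * N) * ((-1) ^ k * (α : ℂ) ^ (N + 1 - k) * (β : ℂ) ^ k) := by
      have h1 : (-1 : ℂ) ^ k * (-1) ^ k = 1 := by rw [← mul_pow]; simp
      have ha := zpow_ne_zero N hα0
      have hp := zpow_ne_zero N hπ
      have hI : Complex.I ^ (2 * N + 1 - 2 * k : ℤ) = (-1) ^ N * (-1) ^ k * Complex.I := by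
        rw [show 2 * N + 1 - 2 * (k : ℤ) = 2 * (N - k) + 1 by ring, I_zpow_two_mul_add_one,
          zpow_sub₀ (by norm_num), zpow_natCast, div_eq_mul_inv, inv_eq_of_mul_eq_one_right h1]
      rw [div_zpow, mul_zpow, hI, hF, hαβ, div_pow, ← pow_mul,
        show 2 * N + 1 - 2 * (k : ℤ) = N + N + 1 - (2 * k : ℕ) by push_cast; ring, two_mul N,
        zpow_sub₀ hα0, zpow_sub₀ hπ, zpow_sub₀ hα0, zpow_add_one₀ hα0, zpow_add_one₀ hα0,
        zpow_add₀ hα0, zpow_natCast, zpow_natCast, zpow_natCast, zpow_neg]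
      have h3 := zpow_ne_zero (N + N + 1) hπ
      field_simp
      rw [pow_mul']
      linear_combination -(α ^ k : ℂ) ^ 2 * (Complex.I ^ 2 * hone + Complex.I_sq)
    linear_combination (bernoulliB (2 * k) 0 / ((2 * k)! : ℂ)) *
      (bernoulliB (2 * N + 2 - 2 * k).toNat 0 / ((2 * N + 2 - 2 * k).toNat ! : ℂ)) * hk
  linear_combination F * key + Sα * e1 + Sβ * e2 - e3

end

theorem corollary2p4 :
    (∀ (n : ℕ) (θ : ℝ) (ω : Fin n → ℂ), 2 ≤ n → (∀ j, ω j ∈ halfPlaneH θ) →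
      (∀ j k, j ≠ k → (ω j / ω k).im ≠ 0) →
      -- the Dirichlet series converges for `Re s > n` and continues meromorphically to `ℂ`
      IsBarnesZeta θ (barnesA ω 0) ω (barnesZeta θ (barnesA ω 0) ω) ∧
      ∀ l : ℤ, l ≠ n →
        (∀ k, Summable (termPos ω l k) ∧ Summable (termNeg ω l k)) ∧
        ((n : ℤ) < l →
          AnalyticAt ℂ (barnesZeta θ (barnesA ω 0) ω) ((n : ℂ) - l) ∧
          regularizedSeries ω l =
            (-1) ^ (l - n + 1) / ((l - n).toNat ! : ℂ) *
              barnesZeta θ (barnesA ω 0) ω ((n : ℂ) - l)) ∧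
        (l < (n : ℤ) →
          regularizedSeries ω l =
            -((n - l - 1).toNat ! : ℂ) *
              residueAt (barnesZeta θ (barnesA ω 0) ω) ((n : ℂ) - l)) ∧
        regularizedSeries ω l = bernoulliSum ω l) ∧
    -- the formula of Ramanujan, which is deduced from the case n = 2
    (∀ (N : ℤ) (α β : ℝ), N ≠ 0 → 0 < α → 0 < β → α * β = Real.pi ^ 2 →
      Summable (ramanujanTerm α N) ∧ Summable (ramanujanTerm β N) ∧
      (α : ℂ) ^ (-N) * (1 / 2 * riemannZeta (2 * N + 1) + ∑' k : ℕ+, ramanujanTerm α N k) =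
        (-(β : ℂ)) ^ (-N) * (1 / 2 * riemannZeta (2 * N + 1) + ∑' k : ℕ+, ramanujanTerm β N k) -
          (2 : ℂ) ^ (2 * N) * ∑ k ∈ Finset.range (N + 2).toNat,
            (-1) ^ k * (bernoulliB (2 * k) 0 / ((2 * k)! : ℂ)) *
              (bernoulliB (2 * N + 2 - 2 * k).toNat 0 / ((2 * N + 2 - 2 * k).toNat ! : ℂ)) *
              (α : ℂ) ^ (N + 1 - k) * (β : ℂ) ^ k) := by
  refine ⟨fun n θ ω hn hH him => ?_, fun N α β hN hα hβ h => ⟨summable_ramanujanTerm N hN hα hβ h,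
    summable_ramanujanTerm N hN hβ hα (by rwa [mul_comm]), ramanujan_formula hN hα hβ h⟩⟩
  have hn0 : n ≠ 0 := by omega
  have hω : ∀ j, ω j ≠ 0 := fun j => ne_zero_of_mem_halfPlaneH (hH j)
  refine ⟨isBarnesZeta_barnesZeta hn0 hH, fun l hl => ?_⟩
  have hreg := regularizedSeries_eq_bernoulliSum hn hω him hl
  refine ⟨fun k => ⟨summable_termPos hn hω him hl k, summable_termNeg hn hω him hl k⟩,
    fun hnl => ?_, fun hln => ?_, hreg⟩
  · obtain ⟨han, hval⟩ := barnesZeta_neg hn0 hH hnl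
    refine ⟨han, ?_⟩
    have hf : ((l - n).toNat ! : ℂ) ≠ 0 := by exact_mod_cast Nat.factorial_ne_zero _
    have hs : (-1 : ℂ) ^ (l - n + 1) * (-1) ^ (l - n).toNat = -1 := by
      rw [← zpow_natCast, Int.toNat_of_nonneg (by omega), zpow_add_one₀ (by norm_num),
        mul_right_comm, ← mul_zpow]
      simp
    rw [hreg, hval, bernoulliSum_eq]
    field_simp
    linear_combination -laurentCoeff ω 0 l * hs
  · have hf : ((n - l - 1).toNat ! : ℂ) ≠ 0 := by exact_mod_cast Nat.factorial_ne_zero _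
    rw [hreg, residueAt_barnesZeta hn0 hH hln, bernoulliSum_eq]
    field_simp
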